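/- **Setting.** Let $n\ge 1$, let $\mathcal B$ be the closed unit Euclidean ball of $\mathbb R^n$, and let $\mathcal K\subset\mathbb R^n$ be convex and compact with $r\mathcal B\subseteq\mathcal K\subseteq R\mathcal B$, where $r>0$. Let $T$ be a perfect square. Let $f_1,g_1,\dots,f_T,g_T:\mathbb R^n\to\mathbb R$ be fixed in advance (oblivious adversary) and convex on $R\mathcal B$, with subgradients on $R\mathcal B$ bounded in norm by $G_f>0$ for the $f_t$ and by $G_g$ for the $g_t$ (that is, $G_f$- and $G_g$-Lipschitz on $R\mathcal B$), and with $|f_t|\le M_f$, $|g_t|\le M_g$ on $\mathcal K$. Put $g_t^+=\max\{g_t,0\}$ and $M=\max\{G_f,G_g,M_f,M_g\}$. The set $\mathcal K$ is accessed through a (measurable) linear optimization oracle (LOO), which maps $c\in\mathbb R^n$ to a minimizer of $\langle c,x\rangle$ over $x\in\mathcal K$. One call to it, rescaled by $1-\mu/r$, is one call to a LOO of the shrunk set $\mathcal K_{\mu/r}:=(1-\mu/r)\mathcal K$. **Subroutines** (for a set $\mathcal C$ with a LOO and a tolerance $\epsilon$). *Frank–Wolfe* with input $x_1\in\mathcal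 C$, $y\in\mathbb R^n$: for $i=1,2,\dots$, call the LOO to get $v_i\in\arg\min_{x\in\mathcal C}\langle x_i-y,x\rangle$; if $\langle x_i-y,x_i-v_i\rangle\le\epsilon$ or $\|x_i-y\|^2\le3\epsilon$, return $x_i$; otherwise set $x_{i+1}=x_i+\sigma_i(v_i-x_i)$ with $\sigma_i\in\arg\min_{\sigma\in[0,1]}\|y-x_i-\sigma(v_i-x_i)\|^2$. *Approximately feasible projection* $\mathrm{AFP}(y_1,x_0,\epsilon,\mathcal C)$ with $x_0\in\mathcal C$: if $\|x_0-y_1\|^2\le3\epsilon$, return $(x_0,y_1)$. Otherwise, for $i=1,2,\dots$, let $x_i$ be the Frank–Wolfe output for the initial point $x_{i-1}$ and the point $y_i$; if $\|x_i-y_i\|^2\le3\epsilon$, return $(x_i,y_i)$; otherwise set $y_{i+1}=y_i-\tfrac23(y_i-x_i)$. **Algorithm.** Let $x_1=\tilde y_1$ be an arbitrary point of $\mathcal K_{\mu/r}$ and $\lambda_1=0$. The rounds are divided into $T/K$ consecutive blocks $\mathcal T_m=\{(m-1)K+1,\dots,mK\}$. In round $t\in\mathcal T_m$ play $z_t=x_m+\mu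 u_t$, where $u_1,\dots,u_T$ are independent and uniform on the unit sphere, and observe only $f_t(z_t)$ and $g_t(z_t)$. At the end of block $m$ set $$\nabla_{m,x}=\sum_{t\in\mathcal T_m}\frac n\mu\big(f_t(z_t)+\lambda_m g_t^+(z_t)\big)u_t,\qquad \nabla_{m,\lambda}=\sum_{t\in\mathcal T_m}\big(g_t^+(z_t)-\delta\eta\lambda_m\big),$$ $$y_{m+1}=\Pi_{R\mathcal B}(\tilde y_m-\eta\nabla_{m,x}),\quad (x_{m+1},\tilde y_{m+1})=\mathrm{AFP}(y_{m+1},x_m,\epsilon,\mathcal K_{\mu/r}),\quad \lambda_{m+1}=\max\{0,\lambda_m+\eta\nabla_{m,\lambda}\}.$$ **Theorem.** There is a universal constant $C>0$ such that, for every $T\ge T_0(n,R,r,G_f,G_g,M_f,M_g)$, the following holds for all data as above for which $\widehat{\mathcal K}=\{x\in\mathcal K: g_t(x)\le0\ \forall t\in\{1,\dots,T\}\}$ is nonempty. Run the algorithm with $$\delta=24\sqrt{183}\,M^2\max\Big\{\frac nr,\frac n{\sqrt r},\sqrt n,\frac n{\sqrt r R}\Big\}T^{1/2}\sqrt{\log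 T},\qquad \eta=\frac{R}{\sqrt n\,M}T^{-3/4},$$ $$\epsilon=61R^2T^{-1/2}\log T,\qquad K=T^{1/2},\qquad \mu=\sqrt{nr}\,T^{-1/4}.$$ Then all played points $z_t$ lie in $\mathcal K$, the minimum of $\sum_t f_t$ over $\widehat{\mathcal K}$ is attained, the random variables $f_t(z_t)$ and $g_t^+(z_t)$ are integrable, and $$\mathbb E\Big[\sum_{t=1}^Tf_t(z_t)\Big]-\min_{x\in\widehat{\mathcal K}}\sum_{t=1}^Tf_t(x)\le C\sqrt n\,M\,T^{3/4}\Big(\max\Big\{\frac Rr,R,\frac1{\sqrt r}\Big\}+R\Big(\frac1{\sqrt n}+\frac1{\sqrt r}\Big)\sqrt{\log T}\Big),$$ $$\mathbb E\Big[\sum_{t=1}^Tg_t^+(z_t)\Big]\le C\sqrt{R\,G_f\,M\max\Big\{\frac Rr,\frac R{\sqrt r},\frac R{\sqrt n},\frac1{\sqrt r},\frac1R\Big\}}\;n^{1/4}\,T^{7/8}(\log T)^{1/4},$$ and (for every realization of $u_1,\dots,u_T$) all loops of the algorithm end and the overall number of calls to the LOO of $\mathcal K$ is at most $T$. -/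

import Mathlib

open MeasureTheory ProbabilityTheory

/-- The space `ℝⁿ` with its Euclidean norm. -/
abbrev Euc (n : ℕ) : Type := EuclideanSpace ℝ (Fin n)

/-- The uniform distribution on the origin-centred unit sphere of `ℝⁿ` (for `n ≥ 1`):
the surface measure divided by its total mass. -/
noncomputable def uniformSphere (n : ℕ) : Measure (Metric.sphere (0 : Euc n) 1) :=
  ((volume : Measure (Euc n)).toSphere Set.univ)⁻¹ • (volume : Measure (Euc n)).toSphere

/-- `v` is a subgradient at `x` of the function `h`, considered on the set `B`. -/
def IsSubgradientOn {n : ℕ} (B : Set (Euc n)) (h : Euc n → ℝ) (x v : Euc n) : Prop :=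
  ∀ y ∈ B, h x + inner ℝ v (y - x) ≤ h y

/-- `h` is convex on the ball of radius `R` and its subgradients there have norm at most `G`.
The bound is asked for one subgradient at each point: at a point of the bounding sphere, the
subgradients relative to the ball always contain an unbounded ray, and the functions are not
constrained outside the ball. This is the same as `h` being convex and `G`-Lipschitz on the ball,
and it holds if `h` is convex on the whole space and all its subgradients at points of the ball have
norm at most `G`. -/
def ConvexWithSubgradientBound {n : ℕ} (R G : ℝ) (h : Euc n → ℝ) : Prop :=
  ConvexOn ℝ (Metric.closedBall 0 R) h ∧
    ∀ x ∈ Metric.closedBall (0 : Euc n) R,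
      ∃ v : Euc n, IsSubgradientOn (Metric.closedBall 0 R) h x v ∧ ‖v‖ ≤ G

/-- `lo` is a linear optimization oracle of `S`: it maps a vector `c` to a minimizer over `S`
of the linear function `x ↦ ⟪c, x⟫`. -/
def IsLinearOracle {n : ℕ} (S : Set (Euc n)) (lo : Euc n → Euc n) : Prop :=
  ∀ c : Euc n, lo c ∈ S ∧ ∀ x ∈ S, inner ℝ c (lo c) ≤ inner ℝ c x

/-- One call to the linear optimization oracle of `S`, rescaled by `a ≥ 0`, answers one call to the
linear optimization oracle of the scaled set `a S`. -/
theorem IsLinearOracle.smul {n : ℕ} {S : Set (Euc n)} {lo : Euc n → Euc n}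
    (h : IsLinearOracle S lo) {a : ℝ} (ha : 0 ≤ a) :
    IsLinearOracle ((fun x : Euc n => a • x) '' S) (fun c => a • lo c) := by
  intro c
  refine ⟨⟨lo c, (h c).1, rfl⟩, ?_⟩
  rintro _ ⟨x, hx, rfl⟩
  simp only [inner_smul_right]
  exact mul_le_mul_of_nonneg_left ((h c).2 x hx) ha

/-- Euclidean projection onto the ball of radius `R` around the origin. -/
noncomputable def projBall {n : ℕ} (R : ℝ) (y : Euc n) : Euc n :=
  if ‖y‖ ≤ R then y else (R / ‖y‖) • y

theorem projBall_spec {n : ℕ} {R : ℝ} (hR : 0 ≤ R) (y : Euc n) :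
    projBall R y ∈ Metric.closedBall (0 : Euc n) R ∧
      ∀ z ∈ Metric.closedBall (0 : Euc n) R, ‖y - projBall R y‖ ≤ ‖y - z‖ := by
  unfold projBall
  split_ifs with h
  · exact ⟨by simpa using h, fun z _ => by simp⟩
  · rw [not_le] at h
    have hy : 0 < ‖y‖ := lt_of_le_of_lt hR h
    refine ⟨?_, fun z hz => ?_⟩
    · rw [mem_closedBall_zero_iff, norm_smul, Real.norm_of_nonneg (by positivity)]
      exact (div_mul_cancel₀ R hy.ne').le
    · have e : y - (R / ‖y‖) • y = (1 - R / ‖y‖) • y := by rw [sub_smul, one_smul]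
      have h1 : R / ‖y‖ ≤ 1 := (div_le_one hy).2 h.le
      rw [e, norm_smul, Real.norm_of_nonneg (by linarith), sub_mul, one_mul,
        div_mul_cancel₀ R hy.ne']
      have h2 := norm_sub_norm_le y z
      rw [mem_closedBall_zero_iff] at hz
      linarith

/-- Exact line search: the minimizer over `σ ∈ [0, 1]` of `‖y - x - σ (v - x)‖²`. -/
noncomputable def lineSearch {n : ℕ} (y x v : Euc n) : ℝ :=
  max 0 (min 1 (inner ℝ (y - x) (v - x) / ‖v - x‖ ^ 2))

theorem lineSearch_spec {n : ℕ} (y x v : Euc n) :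
    lineSearch y x v ∈ Set.Icc (0 : ℝ) 1 ∧
      IsMinOn (fun σ : ℝ => ‖y - x - σ • (v - x)‖ ^ 2) (Set.Icc 0 1) (lineSearch y x v) := by
  have hmem : lineSearch y x v ∈ Set.Icc (0 : ℝ) 1 :=
    ⟨le_max_left _ _, max_le zero_le_one (min_le_left _ _)⟩
  refine ⟨hmem, ?_⟩
  rw [isMinOn_iff]
  rintro σ ⟨h0, h1⟩
  have hexp : ∀ τ : ℝ, ‖y - x - τ • (v - x)‖ ^ 2 =
      ‖y - x‖ ^ 2 - 2 * (τ * inner ℝ (y - x) (v - x)) + τ ^ 2 * ‖v - x‖ ^ 2 := by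
    intro τ
    rw [norm_sub_sq_real, inner_smul_right, norm_smul, mul_pow, Real.norm_eq_abs, sq_abs]
  simp only [hexp]
  by_cases hv : ‖v - x‖ = 0
  · have : v - x = 0 := norm_eq_zero.1 hv
    simp [this]
  · have hp : 0 < ‖v - x‖ ^ 2 := by positivity
    set d := ‖v - x‖ ^ 2
    set c := inner ℝ (y - x) (v - x)
    have hc : c = c / d * d := (div_mul_cancel₀ c hp.ne').symm
    have key : (lineSearch y x v - c / d) ^ 2 ≤ (σ - c / d) ^ 2 := by
      change (max 0 (min 1 (c / d)) - c / d) ^ 2 ≤ (σ - c / d) ^ 2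
      rcases le_total (c / d) 0 with ha | ha
      · rw [max_eq_left ((min_le_right _ _).trans ha)]; nlinarith
      · rcases le_total (c / d) 1 with hb | hb
        · rw [min_eq_right hb, max_eq_right ha]; nlinarith [sq_nonneg (σ - c / d)]
        · rw [min_eq_left hb, max_eq_right zero_le_one]; nlinarith
    have := mul_le_mul_of_nonneg_right key hp.le
    generalize c / d = q at *
    rw [hc]
    nlinarith

/-! ### The Frank-Wolfe subroutine -/

/-- The Frank-Wolfe iterates for `x ↦ ‖x - y‖² / 2` from `x₁`, with linear optimization oracle `lo`
and exact line search (index `0` is the initial point). -/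
noncomputable def fwIter {n : ℕ} (lo : Euc n → Euc n) (x₁ y : Euc n) : ℕ → Euc n
  | 0 => x₁
  | i + 1 =>
    let x := fwIter lo x₁ y i
    let v := lo (x - y)
    x + lineSearch y x v • (v - x)

/-- The stopping test of the Frank-Wolfe subroutine at the iterate of index `i`. -/
def FWStop {n : ℕ} (ε : ℝ) (lo : Euc n → Euc n) (x₁ y : Euc n) (i : ℕ) : Prop :=
  let x := fwIter lo x₁ y i
  let v := lo (x - y)
  inner ℝ (x - y) (x - v) ≤ ε ∨ ‖x - y‖ ^ 2 ≤ 3 * ε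

/-- The output of the Frank-Wolfe subroutine: the first iterate that passes the stopping test
(of no relevance if there is none, in which case `fwCalls` is infinite). -/
noncomputable def fwOut {n : ℕ} (ε : ℝ) (lo : Euc n → Euc n) (x₁ y : Euc n) : Euc n :=
  fwIter lo x₁ y (sInf {i | FWStop ε lo x₁ y i})

open Classical in
/-- The number of oracle calls of the Frank-Wolfe subroutine: one for each iterate up to and
including the one that is returned; infinite if the loop does not end. -/
noncomputable def fwCalls {n : ℕ} (ε : ℝ) (lo : Euc n → Euc n) (x₁ y : Euc n) : ℕ∞ :=
  if ∃ i, FWStop ε lo x₁ y i then ((sInf {i | FWStop ε lo x₁ y i} + 1 : ℕ) : ℕ∞) else ⊤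

/-! ### Approximately feasible projection -/

/-- The pairs of the loop of the approximately feasible projection: the entry of index `i` is
`(x_i, y_{i+1})`, where `x_{i+1}` is the output of the Frank-Wolfe subroutine started at `x_i` for
the point `y_{i+1}`, and `y_{i+2} = y_{i+1} - (2/3) (y_{i+1} - x_{i+1})`. -/
noncomputable def afpIter {n : ℕ} (ε : ℝ) (lo : Euc n → Euc n) (x₀ y₁ : Euc n) :
    ℕ → Euc n × Euc n
  | 0 => (x₀, y₁)
  | i + 1 =>
    let s := afpIter ε lo x₀ y₁ i
    let x := fwOut ε lo s.1 s.2
    (x, s.2 - (2 / 3 : ℝ) • (s.2 - x))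

/-- The point `x_{i+1}` computed by the pass of index `i` through the loop. -/
noncomputable def afpPoint {n : ℕ} (ε : ℝ) (lo : Euc n → Euc n) (x₀ y₁ : Euc n) (i : ℕ) : Euc n :=
  fwOut ε lo (afpIter ε lo x₀ y₁ i).1 (afpIter ε lo x₀ y₁ i).2

/-- The loop returns in the pass of index `i`. -/
def AFPStop {n : ℕ} (ε : ℝ) (lo : Euc n → Euc n) (x₀ y₁ : Euc n) (i : ℕ) : Prop :=
  ‖afpPoint ε lo x₀ y₁ i - (afpIter ε lo x₀ y₁ i).2‖ ^ 2 ≤ 3 * ε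

open Classical in
/-- The output `(x, ỹ)` of the approximately feasible projection of `y₁` with feasible starting
point `x₀` (of no relevance if the loop does not end, in which case `afpCalls` is infinite). -/
noncomputable def afpOut {n : ℕ} (ε : ℝ) (lo : Euc n → Euc n) (x₀ y₁ : Euc n) : Euc n × Euc n :=
  if ‖x₀ - y₁‖ ^ 2 ≤ 3 * ε then (x₀, y₁)
  else
    let i := sInf {i | AFPStop ε lo x₀ y₁ i}
    (afpPoint ε lo x₀ y₁ i, (afpIter ε lo x₀ y₁ i).2)

open Classical in
/-- The number of oracle calls of the approximately feasible projection; infinite if its loop, or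
one of the runs of the Frank-Wolfe subroutine in it, does not end. -/
noncomputable def afpCalls {n : ℕ} (ε : ℝ) (lo : Euc n → Euc n) (x₀ y₁ : Euc n) : ℕ∞ :=
  if ‖x₀ - y₁‖ ^ 2 ≤ 3 * ε then 0
  else if ∃ i, AFPStop ε lo x₀ y₁ i then
    ∑ i ∈ Finset.range (sInf {i | AFPStop ε lo x₀ y₁ i} + 1),
      fwCalls ε lo (afpIter ε lo x₀ y₁ i).1 (afpIter ε lo x₀ y₁ i).2
  else ⊤

/-! ### The bandit primal-dual method

Rounds and blocks are numbered from `0`: the rounds are `t < T`, block `m < T / K` consists of the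
rounds `m K ≤ t < (m + 1) K`, and round `t` lies in block `t / K`. -/

/-- Parameters of the method: block length `K`, tolerance `ε`, dual regularization `δ`, step size
`η`, smoothing radius `μ`, and the radii `R`, `r` of the enclosing and the enclosed ball. -/
structure BanditParams where
  K : ℕ
  ε : ℝ
  δ : ℝ
  η : ℝ
  μ : ℝ
  R : ℝ
  r : ℝ

/-- The variables `x_m`, `ỹ_m`, `λ_m`. -/
structure BanditState (n : ℕ) where
  x : Euc n
  y : Euc n
  lam : ℝ

/-- The rounds of block `m`. -/
def block (K m : ℕ) : Finset ℕ := Finset.Ico (m * K) ((m + 1) * K)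

/-- The oracle of the shrunk set `(1 - μ/r) 𝒦` obtained from the oracle `lo` of `𝒦`; each call to it
is one call to `lo`. -/
noncomputable def shrunkOracle {n : ℕ} (p : BanditParams) (lo : Euc n → Euc n) :
    Euc n → Euc n :=
  fun c => (1 - p.μ / p.r) • lo c

/-- The gradient estimate `∇_{m,x}`; the functions are used through their values at the played
points only. -/
noncomputable def gradX {n : ℕ} (p : BanditParams) (f g : ℕ → Euc n → ℝ) (u : ℕ → Euc n)
    (m : ℕ) (s : BanditState n) : Euc n :=
  ∑ t ∈ block p.K m,
    ((n / p.μ) * (f t (s.x + p.μ • u t) + s.lam * max (g t (s.x + p.μ • u t)) 0)) • u t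

/-- The dual gradient `∇_{m,λ}`. -/
noncomputable def gradLam {n : ℕ} (p : BanditParams) (g : ℕ → Euc n → ℝ) (u : ℕ → Euc n)
    (m : ℕ) (s : BanditState n) : ℝ :=
  ∑ t ∈ block p.K m, (max (g t (s.x + p.μ • u t)) 0 - p.δ * p.η * s.lam)

/-- The point `y_{m+1}`, which is handed to the approximately feasible projection. -/
noncomputable def primalStep {n : ℕ} (p : BanditParams) (f g : ℕ → Euc n → ℝ) (u : ℕ → Euc n)
    (m : ℕ) (s : BanditState n) : Euc n :=
  projBall p.R (s.y - p.η • gradX p f g u m s)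

/-- The variables at the beginning of block `m`, when the method starts at `x₁` and samples the unit
vectors `u`. -/
noncomputable def banditState {n : ℕ} (p : BanditParams) (lo : Euc n → Euc n)
    (f g : ℕ → Euc n → ℝ) (x₁ : Euc n) (u : ℕ → Euc n) : ℕ → BanditState n
  | 0 => ⟨x₁, x₁, 0⟩
  | m + 1 =>
    let s := banditState p lo f g x₁ u m
    let q := afpOut p.ε (shrunkOracle p lo) s.x (primalStep p f g u m s)
    ⟨q.1, q.2, max 0 (s.lam + p.η * gradLam p g u m s)⟩

/-- The point `z_t` played in round `t`. -/
noncomputable def played {n : ℕ} (p : BanditParams) (lo : Euc n → Euc n)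
    (f g : ℕ → Euc n → ℝ) (x₁ : Euc n) (u : ℕ → Euc n) (t : ℕ) : Euc n :=
  (banditState p lo f g x₁ u (t / p.K)).x + p.μ • u t

/-- The number of calls to the oracle `lo` of `𝒦` over all `T` rounds. -/
noncomputable def totalCalls {n : ℕ} (p : BanditParams) (lo : Euc n → Euc n)
    (f g : ℕ → Euc n → ℝ) (x₁ : Euc n) (u : ℕ → Euc n) (T : ℕ) : ℕ∞ :=
  ∑ m ∈ Finset.range (T / p.K),
    afpCalls p.ε (shrunkOracle p lo) (banditState p lo f g x₁ u m).x
      (primalStep p f g u m (banditState p lo f g x₁ u m))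

/-- The choice of the parameters, in terms of the dimension `n`, the horizon `T`, the block length
`K` (which is to be `T^{1/2}`), the radii, and `M = max{G_f, G_g, M_f, M_g}`. -/
noncomputable def chosenParams (n T K : ℕ) (R r M : ℝ) : BanditParams where
  K := K
  ε := 61 * R ^ 2 * (T : ℝ) ^ (-(1 / 2) : ℝ) * Real.log T
  δ := 24 * √183 * M ^ 2 *
    max (max (n / r) (n / √r)) (max √n (n / (√r * R))) * (T : ℝ) ^ (1 / 2 : ℝ) * √(Real.log T)
  η := R / (√n * M) * (T : ℝ) ^ (-(3 / 4) : ℝ)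
  μ := √(n * r) * (T : ℝ) ^ (-(1 / 4) : ℝ)
  R := R
  r := r

/-- The points of `S` that satisfy all soft constraints `g_t(x) ≤ 0`, `t < T`. -/
def feasibleSet {n : ℕ} (S : Set (Euc n)) (g : ℕ → Euc n → ℝ) (T : ℕ) : Set (Euc n) :=
  {x | x ∈ S ∧ ∀ t < T, g t x ≤ 0}

/-! The method is an approximate primal-dual descent on the Lagrangians `f_t + λ g_t⁺`, with two
inexact ingredients: projections that use only linear optimization, and gradients estimated from
single function values.

Projection. The Frank-Wolfe routine returns an approximate projection `x` of `y`. Moving `y` towards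
`x` by the factor 2/3 brings it closer to every feasible point (`sq_norm_step_le`), and the squared
distance to a suitable feasible point shrinks by 5/9 in each pass. Few passes therefore suffice
(`afpStop_exists`), and the result is a pair: a feasible `x` and a point `ỹ` within `√(3ε)` of it
that is no farther than `y` from any feasible point (`afpOut_spec`). Descent is run on `ỹ`; the gap
between `x` and `ỹ` costs `√(3ε) ‖∇‖` per step.

Gradients. The average of `(n/μ) h(x + μu) u` over the sphere is the gradient of the average of `h`
over a ball. Stokes' theorem in the form `sphere_mean_le_of_lineDeriv_le` shows that it is bounded
by the Lipschitz constant of `h`, without the factor `n/μ`, and that it is a subgradient up to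
`2Lμ`. Given `(x_m, λ_m)`, the samples of a block are independent. Mixed terms in the second moment
of the block estimate therefore contribute only `M²(1+λ_m)²`, and the whole is at most `M²(K(n/μ)² +
K²) E(1+λ_m)²` (`integral_rGrad_sq_le`). With the chosen `K` and `μ`, both summands are of order
`T`.

Combination. The moment bound grows with `λ_m²`. The dual regularization yields a term `-(c/2)(1-ηc)
λ_m²` per block, where `c = Kδη`, and `δ` is chosen so that it absorbs all this growth
(`primal_dual_arith`, `regularization_le`). Summation over blocks and expectation give, for every `l
≥ 0`, with `V` the expected total violation, `regret + l V ≤ U + l² W`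
(`regret_add_mul_violation_le`). The choice `l = 0` is the regret bound. The regret is at least `-2
R G_f T` and `U ≤ R G_f T` for large `T`, so `l V ≤ 3 R G_f T + l² W`; optimizing over `l` yields
`V² ≤ 12 W R G_f T`, of order `T^{7/4}` up to the logarithm.

The argument is carried out for globally Lipschitz functions and measurable samples. Since the
method only sees values at played points of `S`, the general case follows by Lipschitz extension and
modification on a null set. -/

/-! ### Frank-Wolfe for the squared distance: duality gap and iteration count. -/

section FrankWolfe

variable {n : ℕ} {C : Set (Euc n)} {lo : Euc n → Euc n} {ε D : ℝ}

theorem fwIter_mem (hC : Convex ℝ C) (hlo : IsLinearOracle C lo) {x₁ : Euc n} (hx : x₁ ∈ C)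
    (y : Euc n) (i : ℕ) : fwIter lo x₁ y i ∈ C := by
  induction i with
  | zero => exact hx
  | succ i ih =>
    have hs := (lineSearch_spec y (fwIter lo x₁ y i) (lo (fwIter lo x₁ y i - y))).1
    simpa only [fwIter] using hC.add_smul_sub_mem ih (hlo _).1 hs

/-- The duality gap bounds the distance of the Frank-Wolfe objective from its minimum. -/
theorem half_sq_sub_le_gap (hlo : IsLinearOracle C lo) (x y : Euc n) {z : Euc n} (hz : z ∈ C) :
    ‖x - y‖ ^ 2 / 2 - ‖z - y‖ ^ 2 / 2 ≤ inner ℝ (x - y) (x - lo (x - y)) := by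
  have h1 := (hlo (x - y)).2 z hz
  have h2 : z - y = (x - y) - (x - z) := by abel
  have h3 : ‖z - y‖ ^ 2 = ‖x - y‖ ^ 2 - 2 * inner ℝ (x - y) (x - z) + ‖x - z‖ ^ 2 := by
    rw [h2, norm_sub_sq_real]
  have h4 : inner ℝ (x - y) (x - z) = inner ℝ (x - y) x - inner ℝ (x - y) z :=
    inner_sub_right _ _ _
  have h5 : inner ℝ (x - y) (x - lo (x - y)) = inner ℝ (x - y) x - inner ℝ (x - y) (lo (x - y)) :=
    inner_sub_right _ _ _
  nlinarith [sq_nonneg ‖x - z‖]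

/-- Exact line search does at least as well as any fixed step `σ`, so the analysis may choose `σ`
freely. -/
theorem fwIter_succ_le (hC : Convex ℝ C) (hlo : IsLinearOracle C lo)
    (hD : ∀ x ∈ C, ∀ z ∈ C, ‖x - z‖ ≤ D) {x₁ : Euc n} (hx : x₁ ∈ C) (y : Euc n) (i : ℕ)
    {σ : ℝ} (h0 : 0 ≤ σ) (h1 : σ ≤ 1) :
    ‖fwIter lo x₁ y (i + 1) - y‖ ^ 2 / 2 ≤ ‖fwIter lo x₁ y i - y‖ ^ 2 / 2
      - σ * inner ℝ (fwIter lo x₁ y i - y) (fwIter lo x₁ y i - lo (fwIter lo x₁ y i - y))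
      + σ ^ 2 * D ^ 2 / 2 := by
  set x := fwIter lo x₁ y i with hxdef
  set v := lo (x - y) with hv
  have hxC : x ∈ C := fwIter_mem hC hlo hx y i
  have hmin := (isMinOn_iff.1 (lineSearch_spec y x v).2) σ ⟨h0, h1⟩
  have hstep : fwIter lo x₁ y (i + 1) = x + lineSearch y x v • (v - x) := rfl
  have e1 : ‖fwIter lo x₁ y (i + 1) - y‖ = ‖y - x - lineSearch y x v • (v - x)‖ := by
    rw [hstep, norm_sub_rev]; congr 1; abel
  have e2 : ‖y - x - σ • (v - x)‖ ^ 2 =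
      ‖x - y‖ ^ 2 - 2 * (σ * inner ℝ (x - y) (x - v)) + σ ^ 2 * ‖x - v‖ ^ 2 := by
    have : y - x - σ • (v - x) = σ • (x - v) - (x - y) := by rw [smul_sub, smul_sub]; abel
    rw [this, norm_sub_sq_real, inner_smul_left, norm_smul, mul_pow, Real.norm_eq_abs, sq_abs,
      real_inner_comm]
    simp only [conj_trivial]
    ring
  have hxv : ‖x - v‖ ^ 2 ≤ D ^ 2 := by
    have := hD x hxC v (hlo _).1
    gcongr
  rw [e2, ← e1] at hmin
  nlinarith [mul_le_mul_of_nonneg_left hxv (sq_nonneg σ)]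

/-- Two phases of about `2D²/ε` steps each. The usual `1/i` rate brings the primal error below `ε`.
If afterwards every gap exceeded `ε`, each step would gain `ε²/(2D²)` and the error would become
negative. Only the gap test is used; the distance test can only stop the loop earlier. -/
theorem fwStop_exists (hC : Convex ℝ C) (hcpt : IsCompact C) (hlo : IsLinearOracle C lo)
    (hD : ∀ x ∈ C, ∀ z ∈ C, ‖x - z‖ ≤ D) (hD0 : 0 < D) (hε : 0 < ε) {x₁ : Euc n} (hx : x₁ ∈ C)
    (y : Euc n) : ∃ i, FWStop ε lo x₁ y i ∧ (i : ℝ) ≤ 4 * D ^ 2 / ε + 2 := by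
  obtain ⟨z, hz, hzmin⟩ := hcpt.exists_isMinOn ⟨x₁, hx⟩
    (f := fun z => ‖z - y‖ ^ 2 / 2) (by fun_prop)
  rw [isMinOn_iff] at hzmin
  set h : ℕ → ℝ := fun i => ‖fwIter lo x₁ y i - y‖ ^ 2 / 2 - ‖z - y‖ ^ 2 / 2 with hh
  set g : ℕ → ℝ := fun i =>
    inner ℝ (fwIter lo x₁ y i - y) (fwIter lo x₁ y i - lo (fwIter lo x₁ y i - y)) with hg
  have hpos : ∀ i, 0 ≤ h i := fun i => by
    have := hzmin _ (fwIter_mem hC hlo hx y i)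
    simp only [hh]; linarith
  have hgap : ∀ i, h i ≤ g i := fun i => half_sq_sub_le_gap hlo _ _ hz
  have hstep : ∀ i σ, 0 ≤ σ → σ ≤ 1 → h (i + 1) ≤ h i - σ * g i + σ ^ 2 * D ^ 2 / 2 :=
    fun i σ h0 h1 => by
      have := fwIter_succ_le hC hlo hD hx y i h0 h1
      simp only [hh, hg]; linarith
  have hD2 : 0 < D ^ 2 := by positivity
  -- a step with gap at least `a ≤ D²` gains `a²/(2D²)`
  have hdec : ∀ i a, 0 ≤ a → a ≤ D ^ 2 → a ≤ g i → h (i + 1) ≤ h i - a ^ 2 / (2 * D ^ 2) := by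
    intro i a ha haD hag
    have := hstep i (a / D ^ 2) (by positivity) ((div_le_one hD2).2 haD)
    have e : (a / D ^ 2) ^ 2 * D ^ 2 / 2 = a ^ 2 / (2 * D ^ 2) := by field_simp
    have e2 : a / D ^ 2 * a = 2 * (a ^ 2 / (2 * D ^ 2)) := by field_simp
    have := mul_le_mul_of_nonneg_left hag (show 0 ≤ a / D ^ 2 by positivity)
    linarith
  -- A full step `σ = 1` removes the dependence on the starting point, because the gap dominates `h
  -- 0`.
  have hh1 : h 1 ≤ D ^ 2 / 2 := by
    have := hstep 0 1 zero_le_one le_rfl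
    have := hgap 0
    simp only [zero_add] at *
    linarith
  have hanti : ∀ i, h (i + 1) ≤ h i := fun i => by
    have := hstep i 0 le_rfl zero_le_one
    linarith
  have hle : ∀ i, h (i + 1) ≤ D ^ 2 / 2 := fun i => by
    induction i with
    | zero => exact hh1
    | succ i ih => exact (hanti _).trans ih
  have hrate : ∀ i, h (i + 1) * (i + 1) ≤ 2 * D ^ 2 := by
    intro i
    induction i with
    | zero => simp; linarith
    | succ i ih =>
      have hd := hdec (i + 1) (h (i + 1)) (hpos _) (by linarith [hle i]) (hgap _)
      set H := h (i + 1)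
      have hH0 : 0 ≤ H := hpos _
      have : h (i + 1 + 1) * (((i + 1 : ℕ) : ℝ) + 1) ≤
          (H - H ^ 2 / (2 * D ^ 2)) * (((i + 1 : ℕ) : ℝ) + 1) := by gcongr
      refine this.trans ?_
      push_cast
      set t : ℝ := (i : ℝ) + 1
      have ht : 1 ≤ t := by simp [t]
      -- In units of `2D²` the recursion is `q ↦ q - q²`, and `q t ≤ 1` with `t ≥ 1` implies `(q -
      -- q²)(t + 1) ≤ 1`.
      have hq : H = H / (2 * D ^ 2) * (2 * D ^ 2) := by field_simp
      set q := H / (2 * D ^ 2)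
      have e : H ^ 2 / (2 * D ^ 2) = q ^ 2 * (2 * D ^ 2) := by rw [hq]; field_simp
      have hq0 : 0 ≤ q := by positivity
      have hqt : q * t ≤ 1 := by
        rw [hq] at ih
        nlinarith
      rw [e, hq]
      have : (q - q ^ 2) * (t + 1) ≤ 1 := by nlinarith [mul_nonneg hq0 (sub_nonneg.2 hqt)]
      nlinarith
  set k := ⌈2 * D ^ 2 / ε⌉₊ with hk
  have hkle : 2 * D ^ 2 / ε ≤ k := Nat.le_ceil _
  have hklt : (k : ℝ) < 2 * D ^ 2 / ε + 1 := Nat.ceil_lt_add_one (by positivity)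
  have hk0 : 0 < k := Nat.ceil_pos.2 (by positivity)
  have hhk : h k ≤ ε := by
    obtain ⟨j, hj⟩ : ∃ j, k = j + 1 := ⟨k - 1, by omega⟩
    have := hrate j
    rw [hj] at hkle ⊢
    push_cast at hkle
    rw [div_le_iff₀ hε] at hkle
    by_contra! hcon
    have hj0 : (0 : ℝ) < j + 1 := by positivity
    nlinarith
  by_contra! hcon
  set N := ⌊2 * D ^ 2 / ε⌋₊ with hN
  have hNle : (N : ℝ) ≤ 2 * D ^ 2 / ε := Nat.floor_le (by positivity)
  have hNlt : 2 * D ^ 2 / ε < N + 1 := Nat.lt_floor_add_one _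
  have hgε : ∀ j ≤ N, ε < g (k + j) := by
    intro j hj
    by_contra! hle'
    have := hcon (k + j) (Or.inl hle')
    have : (j : ℝ) ≤ N := by exact_mod_cast hj
    have e : 4 * D ^ 2 / ε = 2 * D ^ 2 / ε + 2 * D ^ 2 / ε := by ring
    push_cast at *
    linarith
  -- The minimum with `D²` keeps the step `a / D²` in `[0, 1]`.
  have hlin : ∀ j ≤ N + 1, h (k + j) + j * (min ε (D ^ 2) ^ 2 / (2 * D ^ 2)) ≤ ε := by
    intro j
    induction j with
    | zero => intro _; simpa using hhk
    | succ j ih =>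
      intro hj
      have := hdec (k + j) (min ε (D ^ 2)) (le_min hε.le hD2.le) (min_le_right _ _)
        ((min_le_left _ _).trans (hgε j (by omega)).le)
      have := ih (by omega)
      have e : k + (j + 1) = k + j + 1 := by ring
      rw [e]; push_cast
      linarith
  rcases le_total ε (D ^ 2) with hεD | hεD
  · have := hlin (N + 1) le_rfl
    rw [min_eq_left hεD] at this
    have h0 := hpos (k + (N + 1))
    push_cast at this
    have h1 : (2 * D ^ 2 / ε) * (ε ^ 2 / (2 * D ^ 2)) = ε := by field_simp
    have h2 : (2 * D ^ 2 / ε) * (ε ^ 2 / (2 * D ^ 2)) < (N + 1) * (ε ^ 2 / (2 * D ^ 2)) := by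
      gcongr
    linarith
  · -- the first step from index one already has a gap above `D²`
    have := hgε 0 (Nat.zero_le _)
    have h3 := hstep k 1 zero_le_one le_rfl
    have h4 := hpos (k + 1)
    obtain ⟨j, hj⟩ : ∃ j, k = j + 1 := ⟨k - 1, by omega⟩
    have h5 := hle j
    rw [← hj] at h5
    simp only [add_zero] at this
    linarith

/-- The gap test is the approximate variational inequality of a projection, since the oracle's
answer is the worst feasible `z`. -/
theorem fwOut_spec (hC : Convex ℝ C) (hcpt : IsCompact C) (hlo : IsLinearOracle C lo)
    (hD : ∀ x ∈ C, ∀ z ∈ C, ‖x - z‖ ≤ D) (hD0 : 0 < D) (hε : 0 < ε) {x₁ : Euc n} (hx : x₁ ∈ C)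
    (y : Euc n) : fwOut ε lo x₁ y ∈ C ∧
      ((∀ z ∈ C, inner ℝ (fwOut ε lo x₁ y - y) (fwOut ε lo x₁ y - z) ≤ ε) ∨
        ‖fwOut ε lo x₁ y - y‖ ^ 2 ≤ 3 * ε) := by
  obtain ⟨i, hi, -⟩ := fwStop_exists hC hcpt hlo hD hD0 hε hx y
  refine ⟨fwIter_mem hC hlo hx y _, ?_⟩
  have hs : FWStop ε lo x₁ y (sInf {i | FWStop ε lo x₁ y i}) :=
    Nat.sInf_mem (s := {i | FWStop ε lo x₁ y i}) ⟨i, hi⟩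
  refine hs.imp (fun h z hz => ?_) id
  refine le_trans ?_ h
  have := (hlo (fwOut ε lo x₁ y - y)).2 z hz
  simp only [inner_sub_right (𝕜 := ℝ) (fwOut ε lo x₁ y - y)]
  change _ ≤ inner ℝ (fwOut ε lo x₁ y - y) (fwOut ε lo x₁ y - lo (fwOut ε lo x₁ y - y))
  rw [inner_sub_right]
  linarith

theorem fwCalls_le (hC : Convex ℝ C) (hcpt : IsCompact C) (hlo : IsLinearOracle C lo)
    (hD : ∀ x ∈ C, ∀ z ∈ C, ‖x - z‖ ≤ D) (hD0 : 0 < D) (hε : 0 < ε) {x₁ : Euc n} (hx : x₁ ∈ C)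
    (y : Euc n) : fwCalls ε lo x₁ y ≤ (⌊4 * D ^ 2 / ε + 3⌋₊ : ℕ) := by
  obtain ⟨i, hi, hile⟩ := fwStop_exists hC hcpt hlo hD hD0 hε hx y
  rw [fwCalls, if_pos ⟨i, hi⟩]
  have h1 : sInf {i | FWStop ε lo x₁ y i} ≤ i := Nat.sInf_le hi
  have h2 : i + 1 ≤ ⌊4 * D ^ 2 / ε + 3⌋₊ := Nat.le_floor (by push_cast; linarith)
  exact_mod_cast (by omega : sInf {i | FWStop ε lo x₁ y i} + 1 ≤ ⌊4 * D ^ 2 / ε + 3⌋₊)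

end FrankWolfe

/-! ### Approximately feasible projection: contraction and number of passes. -/

section ApproximatelyFeasibleProjection

variable {n : ℕ} {C : Set (Euc n)} {lo : Euc n → Euc n} {ε D : ℝ}

theorem afpIter_fst_mem (hC : Convex ℝ C) (hcpt : IsCompact C) (hlo : IsLinearOracle C lo)
    (hD : ∀ x ∈ C, ∀ z ∈ C, ‖x - z‖ ≤ D) (hD0 : 0 < D) (hε : 0 < ε) {x₀ : Euc n} (hx : x₀ ∈ C)
    (y : Euc n) (i : ℕ) : (afpIter ε lo x₀ y i).1 ∈ C := by
  induction i with
  | zero => exact hx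
  | succ i ih => exact (fwOut_spec hC hcpt hlo hD hD0 hε ih _).1

/-- Moving `y` towards an approximate projection by the factor `2/3` brings it closer to all feasible
points. -/
theorem sq_norm_step_le {x y z : Euc n} (h : inner ℝ (x - y) (x - z) ≤ ε)
    (hd : 3 * ε < ‖x - y‖ ^ 2) :
    ‖y - (2 / 3 : ℝ) • (y - x) - z‖ ^ 2 ≤ ‖y - z‖ ^ 2 - 4 / 9 * ‖x - y‖ ^ 2 := by
  have e1 : y - (2 / 3 : ℝ) • (y - x) - z = (y - z) + (2 / 3 : ℝ) • (x - y) := by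
    rw [smul_sub, smul_sub]; abel
  -- The hypotheses give `⟪y - z, x - y⟫ < -(2/3)‖x - y‖²`. A step of factor `γ` thus changes the
  -- squared distance by at most `(γ² - 4γ/3)‖x - y‖²`, which is smallest at `γ = 2/3`.
  have e2 : inner ℝ (x - y) (x - z) = ‖x - y‖ ^ 2 + inner ℝ (y - z) (x - y) := by
    rw [← real_inner_self_eq_norm_sq, real_inner_comm (x - y) (y - z), ← inner_add_right]
    congr 1; abel
  rw [e1, norm_add_sq_real, inner_smul_right, norm_smul, mul_pow, Real.norm_eq_abs, sq_abs]
  linarith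

theorem afpIter_succ_le (hC : Convex ℝ C) (hcpt : IsCompact C) (hlo : IsLinearOracle C lo)
    (hD : ∀ x ∈ C, ∀ z ∈ C, ‖x - z‖ ≤ D) (hD0 : 0 < D) (hε : 0 < ε) {x₀ : Euc n} (hx : x₀ ∈ C)
    (y : Euc n) {i : ℕ} (hi : ¬ AFPStop ε lo x₀ y i) {z : Euc n} (hz : z ∈ C) :
    ‖(afpIter ε lo x₀ y (i + 1)).2 - z‖ ^ 2 ≤ ‖(afpIter ε lo x₀ y i).2 - z‖ ^ 2
      - 4 / 9 * ‖afpPoint ε lo x₀ y i - (afpIter ε lo x₀ y i).2‖ ^ 2 := by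
  have hs := fwOut_spec hC hcpt hlo hD hD0 hε
    (afpIter_fst_mem hC hcpt hlo hD hD0 hε hx y i) (afpIter ε lo x₀ y i).2
  rcases hs.2 with h | h
  · exact sq_norm_step_le (h z hz) (not_le.1 hi)
  · exact absurd h hi

theorem afpPoint_mem (hC : Convex ℝ C) (hcpt : IsCompact C) (hlo : IsLinearOracle C lo)
    (hD : ∀ x ∈ C, ∀ z ∈ C, ‖x - z‖ ≤ D) (hD0 : 0 < D) (hε : 0 < ε) {x₀ : Euc n} (hx : x₀ ∈ C)
    (y : Euc n) (i : ℕ) : afpPoint ε lo x₀ y i ∈ C :=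
  afpIter_fst_mem hC hcpt hlo hD hD0 hε hx y (i + 1)

/-- While the loop runs, `y_i` stays at squared distance more than `3ε` from the point just
computed, yet its squared distance to some feasible point decays like `(5/9)^i`. The feasible point
of comparison may change from pass to pass. -/
theorem afpStop_exists (hC : Convex ℝ C) (hcpt : IsCompact C) (hlo : IsLinearOracle C lo)
    (hD : ∀ x ∈ C, ∀ z ∈ C, ‖x - z‖ ≤ D) (hD0 : 0 < D) (hε : 0 < ε) {x₀ : Euc n} (hx : x₀ ∈ C)
    {y z₀ : Euc n} (hz₀ : z₀ ∈ C) {ρ : ℝ} (hρ : 0 < ρ) (hy : ‖y - z₀‖ ≤ ρ) :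
    ∃ i, AFPStop ε lo x₀ y i ∧ (i : ℝ) ≤ max 0 (9 / 4 * Real.log (ρ ^ 2 / ε)) + 1 := by
  by_contra! hcon
  set B : ℝ := max 0 (9 / 4 * Real.log (ρ ^ 2 / ε)) with hB
  have hB0 : 0 ≤ B := le_max_left _ _
  set N := ⌊B⌋₊ + 1 with hN
  have hNle : (⌊B⌋₊ : ℝ) ≤ B := Nat.floor_le hB0
  have hNlt : B < N := by rw [hN]; push_cast; exact Nat.lt_floor_add_one _
  have hns : ∀ i ≤ N, ¬ AFPStop ε lo x₀ y i := fun i hi hs => by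
    have := hcon i hs
    have : (i : ℝ) ≤ N := by exact_mod_cast hi
    have : (N : ℝ) = ⌊B⌋₊ + 1 := by rw [hN]; push_cast; rfl
    linarith
  have key : ∀ i ≤ N + 1, ∃ z ∈ C, ‖(afpIter ε lo x₀ y i).2 - z‖ ^ 2 ≤ (5 / 9) ^ i * ρ ^ 2 := by
    intro i
    induction i with
    | zero => intro _; exact ⟨z₀, hz₀, by simpa [afpIter] using by gcongr⟩
    | succ i ih =>
      intro hi
      obtain ⟨z, hz, hle⟩ := ih (by omega)
      have hst := hns i (by omega)
      -- If the computed point is at least as far from `y_i` as `z` is, the gain of 4/9 of its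
      -- squared distance suffices for `z`. Otherwise that point is itself a better comparison
      -- point, and it replaces `z`.
      by_cases hc : ‖(afpIter ε lo x₀ y i).2 - z‖ ^ 2 ≤
          ‖afpPoint ε lo x₀ y i - (afpIter ε lo x₀ y i).2‖ ^ 2
      · refine ⟨z, hz, ?_⟩
        have := afpIter_succ_le hC hcpt hlo hD hD0 hε hx y hst hz
        rw [pow_succ (5 / 9 : ℝ) i]
        linarith
      · push Not at hc
        rw [norm_sub_rev (afpPoint _ _ _ _ _)] at hc
        have hp := afpPoint_mem hC hcpt hlo hD hD0 hε hx y i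
        refine ⟨_, hp, ?_⟩
        have := afpIter_succ_le hC hcpt hlo hD hD0 hε hx y hst hp
        rw [norm_sub_rev (afpPoint _ _ _ _ _)] at this
        rw [pow_succ (5 / 9 : ℝ) i]
        linarith
  obtain ⟨z, hz, hle⟩ := key N (by omega)
  have h1 := afpIter_succ_le hC hcpt hlo hD hD0 hε hx y (hns N le_rfl) hz
  have h2 := hns N le_rfl
  simp only [AFPStop, not_le] at h2
  -- Pass `N` does not stop either, so it removes more than `(4/9)·3ε > ε` from a squared distance
  -- that stays nonnegative.
  have h3 : ε < (5 / 9) ^ N * ρ ^ 2 := by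
    nlinarith [sq_nonneg ‖(afpIter ε lo x₀ y (N + 1)).2 - z‖]
  have h4 : Real.log (5 / 9) ≤ -(4 / 9) := by
    have := Real.log_le_sub_one_of_pos (show (0 : ℝ) < 5 / 9 by norm_num)
    linarith
  have h5 : Real.log ε < N * Real.log (5 / 9) + Real.log (ρ ^ 2) := by
    have := Real.log_lt_log hε h3
    rwa [Real.log_mul (by positivity) (by positivity), Real.log_pow] at this
  have h6 : Real.log (ρ ^ 2 / ε) = Real.log (ρ ^ 2) - Real.log ε :=
    Real.log_div (by positivity) hε.ne'
  have h7 : 9 / 4 * Real.log (ρ ^ 2 / ε) ≤ B := le_max_right _ _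
  have : (N : ℝ) * Real.log (5 / 9) ≤ N * (-(4 / 9)) := by gcongr
  linarith

/-- These three properties are all that the descent analysis needs in place of an exact projection.
The last one holds because every unsuccessful pass moves `y` closer to all feasible points at once.
-/
theorem afpOut_spec (hC : Convex ℝ C) (hcpt : IsCompact C) (hlo : IsLinearOracle C lo)
    (hD : ∀ x ∈ C, ∀ z ∈ C, ‖x - z‖ ≤ D) (hD0 : 0 < D) (hε : 0 < ε) {x₀ : Euc n} (hx : x₀ ∈ C)
    (y : Euc n) : (afpOut ε lo x₀ y).1 ∈ C ∧
      ‖(afpOut ε lo x₀ y).1 - (afpOut ε lo x₀ y).2‖ ^ 2 ≤ 3 * ε ∧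
      ∀ z ∈ C, ‖(afpOut ε lo x₀ y).2 - z‖ ^ 2 ≤ ‖y - z‖ ^ 2 := by
  unfold afpOut
  split_ifs with h
  · exact ⟨hx, h, fun z _ => le_rfl⟩
  · obtain ⟨i, hi, -⟩ := afpStop_exists hC hcpt hlo hD hD0 hε hx hx
      (show 0 < ‖y - x₀‖ + 1 by positivity) (le_add_of_nonneg_right zero_le_one)
    refine ⟨afpPoint_mem hC hcpt hlo hD hD0 hε hx y _, ?_, fun z hz => ?_⟩
    · exact Nat.sInf_mem (s := {i | AFPStop ε lo x₀ y i}) ⟨i, hi⟩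
    · have : ∀ j ≤ sInf {i | AFPStop ε lo x₀ y i},
          ‖(afpIter ε lo x₀ y j).2 - z‖ ^ 2 ≤ ‖y - z‖ ^ 2 := by
        intro j
        induction j with
        | zero => intro _; exact le_rfl
        | succ j ih =>
          intro hj
          have hns : ¬ AFPStop ε lo x₀ y j := Nat.notMem_of_lt_sInf (s := {i | AFPStop ε lo x₀ y i}) hj
          have := afpIter_succ_le hC hcpt hlo hD hD0 hε hx y hns hz
          have := ih (by omega)
          nlinarith [sq_nonneg ‖afpPoint ε lo x₀ y j - (afpIter ε lo x₀ y j).2‖]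
      exact this _ le_rfl

theorem afpCalls_le (hC : Convex ℝ C) (hcpt : IsCompact C) (hlo : IsLinearOracle C lo)
    (hD : ∀ x ∈ C, ∀ z ∈ C, ‖x - z‖ ≤ D) (hD0 : 0 < D) (hε : 0 < ε) {x₀ : Euc n} (hx : x₀ ∈ C)
    {y z₀ : Euc n} (hz₀ : z₀ ∈ C) {ρ : ℝ} (hρ : 0 < ρ) (hy : ‖y - z₀‖ ≤ ρ) {N : ℕ}
    (hN : (max 0 (9 / 4 * Real.log (ρ ^ 2 / ε)) + 2) * (4 * D ^ 2 / ε + 3) ≤ N) :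
    afpCalls ε lo x₀ y ≤ N := by
  unfold afpCalls
  split_ifs with h h'
  · exact zero_le
  · obtain ⟨i, hi, hile⟩ := afpStop_exists hC hcpt hlo hD hD0 hε hx hz₀ hρ hy
    have h1 : sInf {i | AFPStop ε lo x₀ y i} ≤ i := Nat.sInf_le hi
    refine (Finset.sum_le_card_nsmul _ _ _ fun j _ => fwCalls_le hC hcpt hlo hD hD0 hε
      (afpIter_fst_mem hC hcpt hlo hD hD0 hε hx y j) _).trans ?_
    rw [Finset.card_range, nsmul_eq_mul]
    norm_cast
    have h2 : (⌊4 * D ^ 2 / ε + 3⌋₊ : ℝ) ≤ 4 * D ^ 2 / ε + 3 := Nat.floor_le (by positivity)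
    have h3 : ((sInf {i | AFPStop ε lo x₀ y i} + 1 : ℕ) : ℝ) ≤
        max 0 (9 / 4 * Real.log (ρ ^ 2 / ε)) + 2 := by
      have : ((sInf {i | AFPStop ε lo x₀ y i} : ℕ) : ℝ) ≤ i := by exact_mod_cast h1
      push_cast
      linarith
    have : (((sInf {i | AFPStop ε lo x₀ y i} + 1) * ⌊4 * D ^ 2 / ε + 3⌋₊ : ℕ) : ℝ) ≤ N := by
      rw [Nat.cast_mul]
      exact (mul_le_mul h3 h2 (by positivity) (by positivity)).trans hN
    exact_mod_cast this
  · obtain ⟨i, hi, -⟩ := afpStop_exists hC hcpt hlo hD hD0 hε hx hz₀ hρ hy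
    exact absurd ⟨i, hi⟩ h'

end ApproximatelyFeasibleProjection

/-! ### Sphere averages as gradients of ball averages. -/

section Smoothing

open Filter Topology

theorem euc_nontrivial {n : ℕ} (hn : 0 < n) : Nontrivial (Euc n) := by
  have : Nonempty (Fin n) := ⟨⟨0, hn⟩⟩
  infer_instance

/-- Integration in polar coordinates over a ball of a function that only depends on the direction. -/
theorem integral_ball_direction {n : ℕ} (hn : 0 < n) (F : Euc n → ℝ) {ρ : ℝ} (hρ : 0 < ρ) :
    ∫ v in Metric.ball (0 : Euc n) ρ, F (‖v‖⁻¹ • v) =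
      (∫ u : Metric.sphere (0 : Euc n) 1, F u ∂(volume : Measure (Euc n)).toSphere) *
        (ρ ^ n / n) := by
  have := euc_nontrivial hn
  set μ : Measure (Euc n) := volume
  have hfr : Module.finrank ℝ (Euc n) = n := by simp
  calc ∫ v in Metric.ball (0 : Euc n) ρ, F (‖v‖⁻¹ • v)
      = ∫ v, F (‖v‖⁻¹ • v) * (Set.Iio ρ).indicator 1 ‖v‖ ∂μ := by
        rw [← integral_indicator measurableSet_ball]
        congr 1; ext v
        by_cases h : ‖v‖ < ρ <;> simp [Set.indicator, h]
    _ = ∫ v : ({(0)}ᶜ : Set (Euc n)), F (‖v.1‖⁻¹ • v.1) * (Set.Iio ρ).indicator 1 ‖v.1‖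
          ∂(μ.comap (↑)) := by
        rw [integral_subtype_comap (measurableSet_singleton _).compl
          fun v => F (‖v‖⁻¹ • v) * (Set.Iio ρ).indicator (1 : ℝ → ℝ) ‖v‖,
          restrict_compl_singleton]
    _ = ∫ p, F p.1 * (Set.Iio ρ).indicator 1 (p.2 : ℝ)
          ∂μ.toSphere.prod (.volumeIoiPow (Module.finrank ℝ (Euc n) - 1)) := by
        simpa using μ.measurePreserving_homeomorphUnitSphereProd.integral_comp
          (Homeomorph.measurableEmbedding _)
          (fun p => F p.1 * (Set.Iio ρ).indicator (1 : ℝ → ℝ) (p.2 : ℝ))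
    _ = _ := by
        rw [integral_prod_mul (fun u : Metric.sphere (0 : Euc n) 1 => F u)
          (fun s : Set.Ioi (0 : ℝ) => (Set.Iio ρ).indicator (1 : ℝ → ℝ) (s : ℝ))]
        congr 1
        have e : (fun s : Set.Ioi (0 : ℝ) => (Set.Iio ρ).indicator (1 : ℝ → ℝ) (s : ℝ)) =
            (Set.Iio (⟨ρ, hρ⟩ : Set.Ioi (0 : ℝ))).indicator 1 := by
          ext s
          simp only [Set.indicator, Set.mem_Iio, ← Subtype.coe_lt_coe]
          rfl
        rw [e, integral_indicator_one measurableSet_Iio, Measure.real,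
          Measure.volumeIoiPow_apply_Iio, ENNReal.toReal_ofReal (by positivity), hfr,
          Nat.sub_add_cancel hn, Nat.cast_pred hn, sub_add_cancel]

theorem toSphere_real_univ {n : ℕ} :
    (volume : Measure (Euc n)).toSphere.real Set.univ =
      n * (volume : Measure (Euc n)).real (Metric.ball 0 1) := by
  rw [Measure.toSphere_real_apply_univ]; simp

theorem isProbabilityMeasure_uniformSphere {n : ℕ} (hn : 0 < n) :
    IsProbabilityMeasure (uniformSphere n) := by
  have := euc_nontrivial hn
  refine ⟨?_⟩
  rw [uniformSphere, Measure.smul_apply, smul_eq_mul]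
  refine ENNReal.inv_mul_cancel ?_ (measure_ne_top _ _)
  rw [Ne, Measure.measure_univ_eq_zero]
  exact Measure.toSphere_ne_zero _

theorem integral_uniformSphere {n : ℕ} (F : Metric.sphere (0 : Euc n) 1 → ℝ) :
    ∫ u, F u ∂uniformSphere n = (n * (volume : Measure (Euc n)).real (Metric.ball 0 1))⁻¹ *
      ∫ u, F u ∂(volume : Measure (Euc n)).toSphere := by
  rw [uniformSphere, integral_smul_measure, smul_eq_mul, ENNReal.toReal_inv, ← toSphere_real_univ]
  rfl

/-- The cutoff `v ↦ max(0, min(1, (1 - ‖v‖)/κ))`. -/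
noncomputable def cutoff {n : ℕ} (κ : ℝ) (v : Euc n) : ℝ := max 0 (min 1 ((1 - ‖v‖) / κ))

theorem cutoff_lipschitz {n : ℕ} {κ : ℝ} (hκ : 0 < κ) :
    LipschitzWith (Real.toNNReal κ⁻¹) (cutoff (n := n) κ) := by
  have h1 : LipschitzWith (Real.toNNReal κ⁻¹) (fun v : Euc n => (1 - ‖v‖) / κ) := by
    refine LipschitzWith.of_dist_le_mul fun x y => ?_
    rw [Real.coe_toNNReal _ (by positivity), Real.dist_eq, dist_eq_norm, div_sub_div_same, abs_div,
      abs_of_pos hκ, div_eq_inv_mul]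
    gcongr
    have := abs_norm_sub_norm_le y x
    rw [norm_sub_rev] at this
    rwa [show 1 - ‖x‖ - (1 - ‖y‖) = ‖y‖ - ‖x‖ by ring]
  exact (h1.const_min 1).const_max 0

theorem cutoff_hasCompactSupport {n : ℕ} {κ : ℝ} (hκ : 0 < κ) :
    HasCompactSupport (cutoff (n := n) κ) := by
  refine HasCompactSupport.of_support_subset_isCompact (isCompact_closedBall (0 : Euc n) 1) ?_
  intro v hv
  by_contra h
  rw [mem_closedBall_zero_iff, not_le] at h
  refine hv (max_eq_left ((min_le_right _ _).trans ?_))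
  exact div_nonpos_of_nonpos_of_nonneg (by linarith) hκ.le

/-- The slope of the cutoff lives on the shell `1 - κ < ‖v‖ < 1`. The difference of two ball
indicators makes its integral accessible to polar coordinates. The excluded spheres are null sets.
-/
theorem lineDeriv_cutoff {n : ℕ} {κ : ℝ} (hκ : 0 < κ) (hκ1 : κ < 1) (w v : Euc n)
    (h1 : ‖v‖ ≠ 1) (h2 : ‖v‖ ≠ 1 - κ) :
    lineDeriv ℝ (cutoff κ) v (-w) =
      κ⁻¹ * ((Metric.ball (0 : Euc n) 1).indicator (fun v => inner ℝ (‖v‖⁻¹ • v) w) v -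
        (Metric.ball (0 : Euc n) (1 - κ)).indicator (fun v => inner ℝ (‖v‖⁻¹ • v) w) v) := by
  have hcont : Continuous fun v : Euc n => ‖v‖ := continuous_norm
  rcases lt_or_gt_of_ne h1 with h1 | h1
  · rcases lt_or_gt_of_ne h2 with h2 | h2
    · have e : cutoff κ =ᶠ[𝓝 v] fun _ => (1 : ℝ) := by
        filter_upwards [hcont.continuousAt.eventually_lt_const h2] with x hx
        have : 1 ≤ (1 - ‖x‖) / κ := by rw [le_div_iff₀ hκ]; linarith
        rw [cutoff, min_eq_left this]; norm_num
      rw [e.lineDeriv_eq]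
      simp [lineDeriv, h1, h2]
    · have hv0 : v ≠ 0 := by
        rintro rfl
        rw [norm_zero] at h2; linarith
      have e : cutoff κ =ᶠ[𝓝 v] fun x => (1 - ‖x‖) / κ := by
        filter_upwards [hcont.continuousAt.eventually_lt_const h1,
          hcont.continuousAt.eventually_const_lt h2] with x hx hx2
        have h3 : (1 - ‖x‖) / κ ≤ 1 := by rw [div_le_iff₀ hκ]; linarith
        have h4 : 0 ≤ (1 - ‖x‖) / κ := div_nonneg (by linarith) hκ.le
        rw [cutoff, min_eq_right h3, max_eq_right h4]
      rw [e.lineDeriv_eq]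
      have hsq : HasDerivAt (fun t : ℝ => ‖v + t • (-w)‖ ^ 2) (2 * inner ℝ v (-w)) 0 := by
        have h3 : HasDerivAt (fun t : ℝ => v + t • (-w)) (-w) 0 := by
          simpa using ((hasDerivAt_id (0 : ℝ)).smul_const (-w)).const_add v
        simpa using h3.norm_sq
      have hv1 : ‖v + (0 : ℝ) • (-w)‖ ^ 2 ≠ 0 := by simpa using hv0
      have hsqrt := (hsq.sqrt hv1)
      simp only [Real.sqrt_sq (norm_nonneg _), zero_smul, add_zero] at hsqrt
      have hd := (hsqrt.const_sub 1).div_const κ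
      rw [lineDeriv, hd.deriv]
      have hm : v ∉ Metric.ball (0 : Euc n) (1 - κ) := by simpa using h2.le
      have hm1 : v ∈ Metric.ball (0 : Euc n) 1 := by simpa using h1
      rw [Set.indicator_of_mem hm1, Set.indicator_of_notMem hm, inner_neg_right, inner_smul_left]
      simp only [conj_trivial]
      have : ‖v‖ ≠ 0 := norm_ne_zero_iff.2 hv0
      field_simp
      ring
  · have e : cutoff κ =ᶠ[𝓝 v] fun _ => (0 : ℝ) := by
      filter_upwards [hcont.continuousAt.eventually_const_lt h1] with x hx
      exact max_eq_left ((min_le_right _ _).trans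
        (div_nonpos_of_nonpos_of_nonneg (by linarith) hκ.le))
    have hm : v ∉ Metric.ball (0 : Euc n) (1 - κ) := by simp; linarith
    have hm1 : v ∉ Metric.ball (0 : Euc n) 1 := by simpa using h1.le
    rw [e.lineDeriv_eq]
    simp [lineDeriv, hm, hm1]

theorem abs_inner_direction_le {n : ℕ} (v w : Euc n) : |inner ℝ (‖v‖⁻¹ • v) w| ≤ ‖w‖ := by
  refine (abs_real_inner_le_norm _ _).trans (mul_le_of_le_one_left (norm_nonneg _) ?_)
  rw [norm_smul, norm_inv, norm_norm]
  exact inv_mul_le_one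

theorem integrableOn_ball_inner_mul {n : ℕ} {k : Euc n → ℝ} (hk : Measurable k)
    (w : Euc n) {ρ B : ℝ} (hB : ∀ v ∈ Metric.ball (0 : Euc n) ρ, |k v| ≤ B) :
    IntegrableOn (fun v => inner ℝ (‖v‖⁻¹ • v) w * k v) (Metric.ball (0 : Euc n) ρ) := by
  refine Measure.integrableOn_of_bounded (M := ‖w‖ * B) measure_ball_lt_top.ne
    (Measurable.aestronglyMeasurable (by fun_prop)) ?_
  filter_upwards [ae_restrict_mem measurableSet_ball] with v hv
  rw [Real.norm_eq_abs, abs_mul]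
  exact mul_le_mul (abs_inner_direction_le v w) (hB v hv) (abs_nonneg _) (norm_nonneg _)

open NNReal in
/-- Stokes' theorem for the ball, as an inequality for Lipschitz functions: a bound of the
derivatives in direction `w` bounds the flux of the function through the sphere. -/
theorem sphere_mean_le_of_lineDeriv_le {n : ℕ} (hn : 0 < n) {h : Euc n → ℝ} {L : ℝ≥0}
    (hL : LipschitzWith L h) {w : Euc n} {a : ℝ}
    (ha : ∀ v ∈ Metric.ball (0 : Euc n) 1, LineDifferentiableAt ℝ h v w → lineDeriv ℝ h v w ≤ a) :
    n * ∫ u, h u * inner ℝ (u : Euc n) w ∂uniformSphere n ≤ a := by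
  have := euc_nontrivial hn
  have hn' : (0 : ℝ) < n := by exact_mod_cast hn
  set V : ℝ := (volume : Measure (Euc n)).real (Metric.ball 0 1) with hV
  have hV0 : 0 < V := ENNReal.toReal_pos (Metric.measure_ball_pos _ _ one_pos).ne'
    measure_ball_lt_top.ne
  set J : ℝ := ∫ u : Metric.sphere (0 : Euc n) 1, h u * inner ℝ (u : Euc n) w
    ∂(volume : Measure (Euc n)).toSphere with hJ
  have hvol : ∀ ρ : ℝ, 0 < ρ → (volume : Measure (Euc n)).real (Metric.ball 0 ρ) = V * ρ ^ n := by
    intro ρ hρ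
    have := integral_ball_direction hn (fun _ => (1 : ℝ)) hρ
    simp only [integral_const, smul_eq_mul, mul_one, toSphere_real_univ] at this
    rw [measureReal_restrict_apply_univ] at this
    rw [this, ← hV]; field_simp
  suffices hmain : J ≤ a * V by
    rw [integral_uniformSphere, ← hJ, ← hV]
    rw [mul_inv, ← mul_assoc, ← mul_assoc, mul_inv_cancel₀ hn'.ne', one_mul, inv_mul_le_iff₀ hV0]
    linarith
  -- Integrating `∂_w h` against the cutoff by parts gives the mean over a thin shell of `h` times
  -- the normal component of `w`. Replacing `h` by its value at the radial projection costs at most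
  -- `Lκ`. All errors carry the factor `1 - (1 - κ)^n`, which vanishes as `κ → 0`.
  have key : ∀ κ : ℝ, 0 < κ → κ < 1 →
      J / n * ((1 - (1 - κ) ^ n) / κ) ≤
        a * V + (|a| * V + L * ‖w‖ * V) * (1 - (1 - κ) ^ n) := by
    intro κ hκ hκ1
    have hκ2 : 0 < 1 - κ := by linarith
    set s : ℝ := 1 - (1 - κ) ^ n with hs
    have hψc := cutoff_lipschitz (n := n) hκ
    have hψs := cutoff_hasCompactSupport (n := n) hκ
    have hψi : Integrable (cutoff (n := n) κ) := hψc.continuous.integrable_of_hasCompactSupport hψs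
    have hψ0 : ∀ v : Euc n, 0 ≤ cutoff κ v := fun v => le_max_left _ _
    have hψ1 : ∀ v : Euc n, cutoff κ v ≤ 1 := fun v => max_le zero_le_one (min_le_left _ _)
    have hψout : ∀ v ∉ Metric.ball (0 : Euc n) 1, cutoff κ v = 0 := fun v hv => by
      rw [mem_ball_zero_iff, not_lt] at hv
      exact max_eq_left ((min_le_right _ _).trans
        (div_nonpos_of_nonpos_of_nonneg (by linarith) hκ.le))
    have hψin : ∀ v ∈ Metric.ball (0 : Euc n) (1 - κ), cutoff κ v = 1 := fun v hv => by
      rw [mem_ball_zero_iff] at hv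
      have : 1 ≤ (1 - ‖v‖) / κ := by rw [le_div_iff₀ hκ]; linarith
      rw [cutoff, min_eq_left this]; norm_num
    -- the integral of the cutoff
    have hup : ∫ v : Euc n, cutoff κ v ≤ V := by
      calc ∫ v : Euc n, cutoff κ v ≤ ∫ v, (Metric.ball (0 : Euc n) 1).indicator 1 v := by
            refine integral_mono hψi
              ((integrable_indicator_iff measurableSet_ball).2
                (integrableOn_const measure_ball_lt_top.ne)) fun v => ?_
            by_cases hv : v ∈ Metric.ball (0 : Euc n) 1
            · rw [Set.indicator_of_mem hv]; exact hψ1 v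
            · rw [Set.indicator_of_notMem hv, hψout v hv]
        _ = V := integral_indicator_one measurableSet_ball
    have hlow : V * (1 - κ) ^ n ≤ ∫ v : Euc n, cutoff κ v := by
      calc V * (1 - κ) ^ n = ∫ v, (Metric.ball (0 : Euc n) (1 - κ)).indicator 1 v := by
            rw [integral_indicator_one measurableSet_ball, hvol _ hκ2]
        _ ≤ _ := by
            refine integral_mono ((integrable_indicator_iff measurableSet_ball).2
                (integrableOn_const measure_ball_lt_top.ne)) hψi fun v => ?_
            by_cases hv : v ∈ Metric.ball (0 : Euc n) (1 - κ)
            · rw [Set.indicator_of_mem hv, hψin v hv]; rfl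
            · rw [Set.indicator_of_notMem hv]; exact hψ0 v
    have h1 : ∫ v, lineDeriv ℝ h v w * cutoff κ v ≤ a * V + |a| * V * s := by
      have hle : ∫ v, lineDeriv ℝ h v w * cutoff κ v ≤ ∫ v : Euc n, a * cutoff κ v := by
        refine integral_mono_ae ?_ (hψi.const_mul a) ?_
        · exact hψi.bdd_mul (hL.memLp_lineDeriv w).aestronglyMeasurable
            (ae_of_all _ fun v => norm_lineDeriv_le_of_lipschitz ℝ hL)
        -- A Lipschitz function is differentiable along `w` almost everywhere, so the pointwise
        -- hypothesis is enough.
        · filter_upwards [hL.ae_lineDifferentiableAt w] with v hv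
          by_cases hv1 : v ∈ Metric.ball (0 : Euc n) 1
          · exact mul_le_mul_of_nonneg_right (ha v hv1 hv) (hψ0 v)
          · simp [hψout v hv1]
      rw [integral_const_mul] at hle
      refine hle.trans ?_
      have h2 : a * (∫ v : Euc n, cutoff κ v) = a * V - a * (V - ∫ v : Euc n, cutoff κ v) := by ring
      have h3 : -(a * (V - ∫ v : Euc n, cutoff κ v)) ≤ |a| * (V - ∫ v : Euc n, cutoff κ v) := by
        rw [← neg_mul]
        exact mul_le_mul_of_nonneg_right (neg_le_abs a) (by linarith)
      have h4 : |a| * (V - ∫ v : Euc n, cutoff κ v) ≤ |a| * (V * s) :=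
        mul_le_mul_of_nonneg_left (by rw [hs]; linarith) (abs_nonneg _)
      linarith
    have hcomp : Metric.ball (0 : Euc n) (1 - κ) ⊆ Metric.ball 0 1 :=
      Metric.ball_subset_ball (by linarith)
    -- the flux through the shell
    have hbd : ∀ v ∈ Metric.ball (0 : Euc n) 1, |h v| ≤ |h 0| + L := fun v hv => by
      have := hL.dist_le_mul v 0
      rw [Real.dist_eq, dist_zero_right] at this
      rw [mem_ball_zero_iff] at hv
      have h5 : |h v| ≤ |h 0| + |h v - h 0| := by
        have := abs_add_le (h 0) (h v - h 0); simpa using this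
      have h6 : (L : ℝ) * ‖v‖ ≤ L := mul_le_of_le_one_right L.2 hv.le
      linarith
    have hbd' : ∀ v ∈ Metric.ball (0 : Euc n) 1, |h (‖v‖⁻¹ • v)| ≤ |h 0| + L := fun v hv => by
      have := hL.dist_le_mul (‖v‖⁻¹ • v) 0
      rw [Real.dist_eq, dist_zero_right] at this
      have h5 : |h (‖v‖⁻¹ • v)| ≤ |h 0| + |h (‖v‖⁻¹ • v) - h 0| := by
        have := abs_add_le (h 0) (h (‖v‖⁻¹ • v) - h 0); simpa using this
      have h6 : (L : ℝ) * ‖‖v‖⁻¹ • v‖ ≤ L := by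
        refine mul_le_of_le_one_right L.2 ?_
        rw [norm_smul, norm_inv, norm_norm]
        exact inv_mul_le_one
      linarith
    have hm : Measurable h := hL.continuous.measurable
    have hm' : Measurable fun v => h (‖v‖⁻¹ • v) := by fun_prop
    have i1 := integrableOn_ball_inner_mul hm w hbd
    have i2 := integrableOn_ball_inner_mul hm' w hbd'
    set A : Set (Euc n) := Metric.ball 0 1 \ Metric.ball 0 (1 - κ) with hA
    have hAm : MeasurableSet A := measurableSet_ball.diff measurableSet_ball
    have hflux : ∫ v, lineDeriv ℝ h v w * cutoff κ v =
        κ⁻¹ * ∫ v in A, inner ℝ (‖v‖⁻¹ • v) w * h v := by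
      rw [hL.integral_lineDeriv_mul_eq hψc hψs, ← integral_indicator hAm, ← integral_const_mul]
      refine integral_congr_ae ?_
      have n1 : ∀ᵐ v : Euc n, v ∉ Metric.sphere (0 : Euc n) 1 :=
        measure_eq_zero_iff_ae_notMem.1 (Measure.addHaar_sphere _ _ _)
      have n2 : ∀ᵐ v : Euc n, v ∉ Metric.sphere (0 : Euc n) (1 - κ) :=
        measure_eq_zero_iff_ae_notMem.1 (Measure.addHaar_sphere _ _ _)
      filter_upwards [n1, n2] with v h1 h2
      rw [lineDeriv_cutoff hκ hκ1 w v (by simpa using h1) (by simpa using h2)]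
      by_cases hv : v ∈ Metric.ball (0 : Euc n) (1 - κ)
      · have hvA : v ∉ A := fun h => h.2 hv
        rw [Set.indicator_of_mem hv, Set.indicator_of_mem (hcomp hv), Set.indicator_of_notMem hvA]
        ring
      · by_cases hv1 : v ∈ Metric.ball (0 : Euc n) 1
        · have hvA : v ∈ A := ⟨hv1, hv⟩
          rw [Set.indicator_of_notMem hv, Set.indicator_of_mem hv1, Set.indicator_of_mem hvA]
          ring
        · have hvA : v ∉ A := fun h => hv1 h.1
          rw [Set.indicator_of_notMem hv, Set.indicator_of_notMem hv1,
            Set.indicator_of_notMem hvA]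
          ring
    have hshell : ∫ v in A, inner ℝ (‖v‖⁻¹ • v) w * h (‖v‖⁻¹ • v) = J / n * s := by
      rw [hA, setIntegral_sdiff measurableSet_ball i2 hcomp]
      have e : ∀ ρ : ℝ, 0 < ρ → ∫ v in Metric.ball (0 : Euc n) ρ,
          inner ℝ (‖v‖⁻¹ • v) w * h (‖v‖⁻¹ • v) = J * (ρ ^ n / n) := fun ρ hρ => by
        rw [integral_ball_direction hn (fun v => inner ℝ v w * h v) hρ, hJ]
        simp only [mul_comm]
      rw [e 1 one_pos, e _ hκ2, hs, one_pow]
      ring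
    have hAvol : (volume : Measure (Euc n)).real A = V * s := by
      rw [hA, measureReal_sdiff hcomp measurableSet_ball, hvol _ hκ2, hs, ← hV]
      ring
    have hdiff : ∫ v in A, inner ℝ (‖v‖⁻¹ • v) w * h (‖v‖⁻¹ • v) ≤
        (∫ v in A, inner ℝ (‖v‖⁻¹ • v) w * h v) + ‖w‖ * (L * κ) * (V * s) := by
      have hc : ∫ v in A, ‖w‖ * (L * κ) = ‖w‖ * (L * κ) * (V * s) := by
        rw [setIntegral_const, hAvol, smul_eq_mul, mul_comm]
      rw [← hc, ← integral_add (i1.mono_set Set.sdiff_subset)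
        (integrableOn_const (measure_ne_top_of_subset Set.sdiff_subset measure_ball_lt_top.ne))]
      refine setIntegral_mono_on (i2.mono_set Set.sdiff_subset)
        ((i1.mono_set Set.sdiff_subset).add
        (integrableOn_const (measure_ne_top_of_subset Set.sdiff_subset measure_ball_lt_top.ne)))
        hAm fun v hv => ?_
      have h7 : ‖v‖ < 1 := by simpa using hv.1
      have h8 : 1 - κ ≤ ‖v‖ := by simpa using hv.2
      have h9 : dist (‖v‖⁻¹ • v) v ≤ κ := by
        have hv0 : ‖v‖ ≠ 0 := by linarith
        have : ‖v‖⁻¹ • v - v = (‖v‖⁻¹ - 1) • v := by rw [sub_smul, one_smul]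
        rw [dist_eq_norm, this, norm_smul, Real.norm_eq_abs, abs_of_nonneg, sub_mul,
          inv_mul_cancel₀ hv0]
        · linarith
        · rw [sub_nonneg]; exact (one_le_inv₀ (by linarith)).2 h7.le
      have h10 := hL.dist_le_mul (‖v‖⁻¹ • v) v
      have h11 : |h (‖v‖⁻¹ • v) - h v| ≤ L * κ :=
        h10.trans (mul_le_mul_of_nonneg_left h9 L.2)
      have h12 : inner ℝ (‖v‖⁻¹ • v) w * (h (‖v‖⁻¹ • v) - h v) ≤ ‖w‖ * (L * κ) := by
        refine (le_abs_self _).trans ?_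
        rw [abs_mul]
        exact mul_le_mul (abs_inner_direction_le v w) h11 (abs_nonneg _) (norm_nonneg _)
      linarith
    rw [hflux, inv_mul_le_iff₀ hκ] at h1
    rw [hshell] at hdiff
    rw [mul_div_assoc', div_le_iff₀ hκ]
    linarith
  -- This limit cancels the `1 / n` of the radial integral.
  have hslope : Tendsto (fun κ : ℝ => (1 - (1 - κ) ^ n) / κ) (𝓝[>] 0) (𝓝 n) := by
    have hd : HasDerivAt (fun κ : ℝ => 1 - (1 - κ) ^ n) n 0 := by
      have := (((hasDerivAt_id (0 : ℝ)).const_sub 1).pow n).const_sub 1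
      simpa using this
    have := hd.tendsto_slope_zero_right
    refine this.congr fun κ => ?_
    simp [div_eq_inv_mul]
  have hs0 : Tendsto (fun κ : ℝ => 1 - (1 - κ) ^ n) (𝓝[>] 0) (𝓝 0) := by
    have : ContinuousAt (fun κ : ℝ => 1 - (1 - κ) ^ n) 0 := by fun_prop
    have := this.tendsto.mono_left (nhdsWithin_le_nhds (s := Set.Ioi 0))
    simpa using this
  have hlim := le_of_tendsto_of_tendsto (hslope.const_mul (J / n))
    ((hs0.const_mul (|a| * V + L * ‖w‖ * V)).const_add (a * V))
    (by
      filter_upwards [Ioo_mem_nhdsGT (show (0 : ℝ) < 1 by norm_num)] with κ hκ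
      exact key κ hκ.1 hκ.2)
  rw [div_mul_cancel₀ _ hn'.ne', mul_zero, add_zero] at hlim
  exact hlim

/-- The gradient of the average of `h` over the ball of radius `μ` around `x`, written as an
average over the sphere. -/
noncomputable def smoothGrad {n : ℕ} (μ : ℝ) (h : Euc n → ℝ) (x : Euc n) : Euc n :=
  ∫ u : Metric.sphere (0 : Euc n) 1, ((n / μ) * h (x + μ • (u : Euc n))) • (u : Euc n)
    ∂uniformSphere n

theorem integrable_uniformSphere {n : ℕ} (hn : 0 < n) {E : Type*} [NormedAddCommGroup E]
    {F : Metric.sphere (0 : Euc n) 1 → E} (hF : Continuous F) : Integrable F (uniformSphere n) := by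
  have := isProbabilityMeasure_uniformSphere hn
  exact hF.integrable_of_hasCompactSupport (HasCompactSupport.of_compactSpace F)

theorem inner_smoothGrad {n : ℕ} (hn : 0 < n) (μ : ℝ) {h : Euc n → ℝ} (hc : Continuous h)
    (x w : Euc n) : inner ℝ (smoothGrad μ h x) w =
      (n / μ) * ∫ u : Metric.sphere (0 : Euc n) 1, h (x + μ • (u : Euc n)) * inner ℝ (u : Euc n) w
        ∂uniformSphere n := by
  rw [smoothGrad, real_inner_comm, ← integral_inner (integrable_uniformSphere hn (by fun_prop)),
    ← integral_const_mul]
  congr 1; ext u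
  rw [inner_smul_right, real_inner_comm]
  ring

open NNReal

/-- The flux inequality after rescaling the ball of radius `μ` around `x` to the unit ball; the
factor `n` of the flux and the `n / μ` of the estimator match. -/
theorem inner_smoothGrad_le {n : ℕ} (hn : 0 < n) {μ : ℝ} (hμ : 0 < μ) {h : Euc n → ℝ} {L : ℝ≥0}
    (hL : LipschitzWith L h) {x w : Euc n} {b : ℝ}
    (hb : ∀ v ∈ Metric.ball (0 : Euc n) 1, LineDifferentiableAt ℝ (fun v => h (x + μ • v)) v w →
      lineDeriv ℝ (fun v => h (x + μ • v)) v w ≤ μ * b) :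
    inner ℝ (smoothGrad μ h x) w ≤ b := by
  have hlip : LipschitzWith (L * ‖μ‖₊) fun v : Euc n => h (x + μ • v) := by
    refine hL.comp (LipschitzWith.of_dist_le_mul fun v v' => ?_)
    rw [dist_add_left, dist_smul₀]; rfl
  have := sphere_mean_le_of_lineDeriv_le hn hlip hb
  rw [inner_smoothGrad hn μ hL.continuous, div_mul_eq_mul_div, div_le_iff₀ hμ]
  linarith

/-- The averaged estimator is tested against its own direction. Single samples are as large as `n /
μ` times the values of `h`; that their mean is not is what makes blocks profitable. -/
theorem norm_smoothGrad_le {n : ℕ} (hn : 0 < n) {μ : ℝ} (hμ : 0 < μ) {h : Euc n → ℝ} {L : ℝ≥0}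
    (hL : LipschitzWith L h) (x : Euc n) : ‖smoothGrad μ h x‖ ≤ L := by
  set G := smoothGrad μ h x
  have hlip : LipschitzWith (L * ‖μ‖₊) fun v : Euc n => h (x + μ • v) := by
    refine hL.comp (LipschitzWith.of_dist_le_mul fun v v' => ?_)
    rw [dist_add_left, dist_smul₀]; rfl
  have h1 : inner ℝ G G ≤ L * ‖G‖ := inner_smoothGrad_le hn hμ hL fun v _ _ => by
    refine (le_abs_self _).trans ((norm_lineDeriv_le_of_lipschitz ℝ hlip).trans (le_of_eq ?_))
    rw [NNReal.coe_mul, coe_nnnorm, Real.norm_of_nonneg hμ.le]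
    ring
  rw [real_inner_self_eq_norm_sq] at h1
  by_contra! hcon
  have : 0 < ‖G‖ := lt_of_le_of_lt L.2 hcon
  nlinarith

/-- By convexity the derivative at `x + μv` towards `y + μv` is at most the difference of the two
values, and each value changes by at most `Lμ` when the perturbation is dropped. -/
theorem le_inner_smoothGrad {n : ℕ} (hn : 0 < n) {μ : ℝ} (hμ : 0 < μ) {h : Euc n → ℝ} {L : ℝ≥0}
    (hL : LipschitzWith L h) {B : Set (Euc n)} (hB : ConvexOn ℝ B h) {x y : Euc n}
    (hx : ∀ v ∈ Metric.ball (0 : Euc n) 1, x + μ • v ∈ B)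
    (hy : ∀ v ∈ Metric.ball (0 : Euc n) 1, y + μ • v ∈ B) :
    h x - h y - 2 * L * μ ≤ inner ℝ (smoothGrad μ h x) (x - y) := by
  have key : inner ℝ (smoothGrad μ h x) (y - x) ≤ h y - h x + 2 * L * μ := by
    refine inner_smoothGrad_le hn hμ hL fun v hv hd => ?_
    have hslope := hd.hasLineDerivAt.tendsto_slope_zero_right
    refine le_of_tendsto hslope ?_
    -- For `t < 1/μ` the number `tμ` is a convex weight: the perturbed point lies on the segment
    -- from `x + μv` to `y + μv`.
    filter_upwards [Ioo_mem_nhdsGT (show (0 : ℝ) < 1 / μ by positivity)] with t ht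
    have ht1 : t * μ ≤ 1 := by
      have := ht.2.le
      rwa [le_div_iff₀ hμ] at this
    have htμ : 0 ≤ t * μ := mul_nonneg ht.1.le hμ.le
    have hconv := hB.2 (hx v hv) (hy v hv) (sub_nonneg.2 ht1) htμ (by ring)
    have e : (1 - t * μ) • (x + μ • v) + (t * μ) • (y + μ • v) =
        x + μ • (v + t • (y - x)) := by module
    rw [e] at hconv
    simp only [smul_eq_mul] at hconv
    have hv1 : ‖v‖ ≤ 1 := by simpa using (mem_ball_zero_iff.1 hv).le
    have hnear : ∀ p : Euc n, |h (p + μ • v) - h p| ≤ L * μ := fun p => by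
      have := hL.dist_le_mul (p + μ • v) p
      rw [Real.dist_eq, dist_eq_norm, add_sub_cancel_left, norm_smul,
        Real.norm_of_nonneg hμ.le] at this
      exact this.trans (mul_le_mul_of_nonneg_left (mul_le_of_le_one_right hμ.le hv1) L.2)
    have h1 := (abs_le.1 (hnear y)).2
    have h2 := (abs_le.1 (hnear x)).1
    simp only [smul_eq_mul]
    rw [inv_mul_le_iff₀ ht.1]
    have h3 : h (x + μ • (v + t • (y - x))) - h (x + μ • v) ≤
        (t * μ) * (h (y + μ • v) - h (x + μ • v)) := by linarith
    refine h3.trans ?_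
    rw [mul_assoc t μ]
    refine mul_le_mul_of_nonneg_left (mul_le_mul_of_nonneg_left ?_ hμ.le) ht.1.le
    linarith
  have e : x - y = -(y - x) := by abel
  rw [e, inner_neg_right]
  linarith

end Smoothing

/-! ### Measurability of the iterates in the samples. -/

section Measurability

variable {Ω : Type*} [MeasurableSpace Ω] {n : ℕ} {lo : Euc n → Euc n}

theorem measurable_sInf_nat {p : Ω → ℕ → Prop} (hp : ∀ k, MeasurableSet {ω | p ω k}) :
    Measurable fun ω => sInf {k | p ω k} := by
  refine measurable_to_countable' fun k => ?_
  -- The second set accounts for the default value `0` of the infimum of the empty set.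
  have e : (fun ω => sInf {k | p ω k}) ⁻¹' {k} =
      ({ω | p ω k} ∩ ⋂ j, ⋂ (_ : j < k), {ω | p ω j}ᶜ) ∪
        ({ω | k = 0} ∩ ⋂ j, {ω | p ω j}ᶜ) := by
    ext ω
    simp only [Set.mem_preimage, Set.mem_singleton_iff, Set.mem_union, Set.mem_inter_iff,
      Set.mem_iInter, Set.mem_compl_iff, Set.mem_ofPred_eq]
    constructor
    · rintro rfl
      by_cases h : ∃ j, p ω j
      · exact Or.inl ⟨Nat.sInf_mem (s := {k | p ω k}) h, fun j hj => Nat.notMem_of_lt_sInf hj⟩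
      · push Not at h
        refine Or.inr ⟨?_, h⟩
        rw [Set.eq_empty_of_forall_notMem (s := {k | p ω k}) h, Nat.sInf_empty]
    · rintro (⟨h1, h2⟩ | ⟨rfl, h2⟩)
      · refine le_antisymm (Nat.sInf_le h1) ?_
        by_contra! hlt
        exact h2 _ hlt (Nat.sInf_mem (s := {k | p ω k}) ⟨k, h1⟩)
      · rw [Set.eq_empty_of_forall_notMem (s := {k | p ω k}) h2, Nat.sInf_empty]
  rw [e]
  exact ((hp k).inter (.iInter fun j => .iInter fun _ => (hp j).compl)).union
    ((MeasurableSet.const _).inter (.iInter fun j => (hp j).compl))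

theorem measurable_apply_nat {β : Type*} [MeasurableSpace β] {F : ℕ → Ω → β} {N : Ω → ℕ}
    (hF : ∀ k, Measurable (F k)) (hN : Measurable N) : Measurable fun ω => F (N ω) ω :=
  (measurable_from_prod_countable_right (f := fun q : ℕ × Ω => F q.1 q.2) hF).comp
    (hN.prodMk measurable_id)

theorem measurable_lineSearch {y x v : Ω → Euc n} (hy : Measurable y) (hx : Measurable x)
    (hv : Measurable v) : Measurable fun ω => lineSearch (y ω) (x ω) (v ω) := by
  unfold lineSearch
  fun_prop

theorem measurable_fwIter (hlo : Measurable lo) {x y : Ω → Euc n} (hx : Measurable x)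
    (hy : Measurable y) (i : ℕ) : Measurable fun ω => fwIter lo (x ω) (y ω) i := by
  induction i with
  | zero => exact hx
  | succ i ih =>
    have hv : Measurable fun ω => lo (fwIter lo (x ω) (y ω) i - y ω) := hlo.comp (ih.sub hy)
    exact ih.add ((measurable_lineSearch hy ih hv).smul (hv.sub ih))

theorem measurableSet_fwStop (ε : ℝ) (hlo : Measurable lo) {x y : Ω → Euc n} (hx : Measurable x)
    (hy : Measurable y) (i : ℕ) : MeasurableSet {ω | FWStop ε lo (x ω) (y ω) i} := by
  have hi := measurable_fwIter hlo hx hy i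
  have hv : Measurable fun ω => lo (fwIter lo (x ω) (y ω) i - y ω) := hlo.comp (hi.sub hy)
  exact (measurableSet_le (Measurable.inner (𝕜 := ℝ) (hi.sub hy) (hi.sub hv)) measurable_const).union
    (measurableSet_le ((hi.sub hy).norm.pow_const 2) measurable_const)

theorem measurable_fwOut (ε : ℝ) (hlo : Measurable lo) {x y : Ω → Euc n} (hx : Measurable x)
    (hy : Measurable y) : Measurable fun ω => fwOut ε lo (x ω) (y ω) :=
  measurable_apply_nat (measurable_fwIter hlo hx hy)
    (measurable_sInf_nat (measurableSet_fwStop ε hlo hx hy))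

theorem measurable_afpIter (ε : ℝ) (hlo : Measurable lo) {x y : Ω → Euc n} (hx : Measurable x)
    (hy : Measurable y) (i : ℕ) : Measurable fun ω => afpIter ε lo (x ω) (y ω) i := by
  induction i with
  | zero => exact hx.prodMk hy
  | succ i ih =>
    have h := measurable_fwOut ε hlo ih.fst ih.snd
    exact h.prodMk (ih.snd.sub ((ih.snd.sub h).const_smul (2 / 3 : ℝ)))

theorem measurable_afpOut (ε : ℝ) (hlo : Measurable lo) {x y : Ω → Euc n} (hx : Measurable x)
    (hy : Measurable y) : Measurable fun ω => afpOut ε lo (x ω) (y ω) := by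
  have hi := measurable_afpIter ε hlo hx hy
  have hp : ∀ i, Measurable fun ω => afpPoint ε lo (x ω) (y ω) i :=
    fun i => measurable_fwOut ε hlo (hi i).fst (hi i).snd
  have hN := measurable_sInf_nat (p := fun ω i => AFPStop ε lo (x ω) (y ω) i) fun i =>
    measurableSet_le (((hp i).sub (hi i).snd).norm.pow_const 2) measurable_const
  refine Measurable.ite (measurableSet_le ((hx.sub hy).norm.pow_const 2) measurable_const)
    (hx.prodMk hy) ?_
  exact measurable_apply_nat (fun i => (hp i).prodMk (hi i).snd) hN

theorem measurable_projBall {R : ℝ} : Measurable (projBall (n := n) R) := by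
  unfold projBall
  exact Measurable.ite (measurableSet_le measurable_norm measurable_const) measurable_id
    (by fun_prop)

variable {p : BanditParams} {f g : ℕ → Euc n → ℝ} {x₁ : Euc n}

/-- Only samples of earlier blocks are required to be measurable. The statement can thus be applied
with the σ-algebra generated by those samples, which yields independence from the current block. -/
theorem measurable_banditState (hlo : Measurable lo) (hf : ∀ t, Measurable (f t))
    (hg : ∀ t, Measurable (g t)) {u : ℕ → Ω → Euc n} (m : ℕ)
    (hu : ∀ t < m * p.K, Measurable (u t)) :
    Measurable (fun ω => (banditState p lo f g x₁ (fun t => u t ω) m).x) ∧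
    Measurable (fun ω => (banditState p lo f g x₁ (fun t => u t ω) m).y) ∧
    Measurable (fun ω => (banditState p lo f g x₁ (fun t => u t ω) m).lam) := by
  induction m with
  | zero => exact ⟨measurable_const, measurable_const, measurable_const⟩
  | succ m ih =>
    obtain ⟨hx, hy, hl⟩ := ih fun t ht => hu t (ht.trans_le (by gcongr; omega))
    have hub : ∀ t ∈ block p.K m, Measurable (u t) := fun t ht =>
      hu t (Finset.mem_Ico.1 ht).2
    have hz : ∀ t ∈ block p.K m, Measurable fun ω =>
        (banditState p lo f g x₁ (fun t => u t ω) m).x + p.μ • u t ω := fun t ht =>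
      hx.add ((hub t ht).const_smul p.μ)
    have hgx : Measurable fun ω => gradX p f g (fun t => u t ω) m
        (banditState p lo f g x₁ (fun t => u t ω) m) :=
      Finset.measurable_sum _ fun t ht =>
        (measurable_const.mul (((hf t).comp (hz t ht)).add
          (hl.mul (((hg t).comp (hz t ht)).max measurable_const)))).smul (hub t ht)
    have hgl : Measurable fun ω => gradLam p g (fun t => u t ω) m
        (banditState p lo f g x₁ (fun t => u t ω) m) :=
      Finset.measurable_sum _ fun t ht =>
        (((hg t).comp (hz t ht)).max measurable_const).sub (measurable_const.mul hl)
    have hps := measurable_projBall (R := p.R).comp (hy.sub (hgx.const_smul p.η))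
    have hso : Measurable (shrunkOracle p lo) := by
      unfold shrunkOracle
      fun_prop
    have hq := measurable_afpOut p.ε hso hx hps
    exact ⟨hq.fst, hq.snd, measurable_const.max (hl.add (measurable_const.mul hgl))⟩

end Measurability

/-! ### Dependence on function values at played points only. -/

section Congr

variable {n : ℕ} {p : BanditParams} {lo : Euc n → Euc n} {f g f' g' : ℕ → Euc n → ℝ} {x₁ : Euc n}
  {u u' : ℕ → Euc n}

theorem grad_congr (m : ℕ) (hu : ∀ t < (m + 1) * p.K, u t = u' t)
    (hf : ∀ t < (m + 1) * p.K,
      f t (played p lo f' g' x₁ u' t) = f' t (played p lo f' g' x₁ u' t))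
    (hg : ∀ t < (m + 1) * p.K,
      g t (played p lo f' g' x₁ u' t) = g' t (played p lo f' g' x₁ u' t)) :
    gradX p f g u m (banditState p lo f' g' x₁ u' m) =
        gradX p f' g' u' m (banditState p lo f' g' x₁ u' m) ∧
      gradLam p g u m (banditState p lo f' g' x₁ u' m) =
        gradLam p g' u' m (banditState p lo f' g' x₁ u' m) := by
  have hb : ∀ t ∈ block p.K m, u t = u' t ∧
      f t ((banditState p lo f' g' x₁ u' m).x + p.μ • u' t) =
        f' t ((banditState p lo f' g' x₁ u' m).x + p.μ • u' t) ∧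
      g t ((banditState p lo f' g' x₁ u' m).x + p.μ • u' t) =
        g' t ((banditState p lo f' g' x₁ u' m).x + p.μ • u' t) := fun t ht => by
    obtain ⟨h1, h2⟩ := Finset.mem_Ico.1 ht
    have hm : t / p.K = m := Nat.div_eq_of_lt_le h1 h2
    have h3 := hf t h2
    have h4 := hg t h2
    rw [played, hm] at h3 h4
    exact ⟨hu t h2, h3, h4⟩
  constructor
  · refine Finset.sum_congr rfl fun t ht => ?_
    obtain ⟨h1, h2, h3⟩ := hb t ht
    rw [h1, h2, h3]
  · refine Finset.sum_congr rfl fun t ht => ?_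
    obtain ⟨h1, h2, h3⟩ := hb t ht
    rw [h1, h3]

/-- The method depends on the functions through their values at the played points only. -/
theorem banditState_congr (m : ℕ)
    (hu : ∀ t < m * p.K, u t = u' t)
    (hf : ∀ t < m * p.K, f t (played p lo f' g' x₁ u' t) = f' t (played p lo f' g' x₁ u' t))
    (hg : ∀ t < m * p.K, g t (played p lo f' g' x₁ u' t) = g' t (played p lo f' g' x₁ u' t)) :
    banditState p lo f g x₁ u m = banditState p lo f' g' x₁ u' m := by
  induction m with
  | zero => rfl
  | succ m ih =>
    have hlt : ∀ t < m * p.K, t < (m + 1) * p.K := fun t ht => ht.trans_le (by gcongr; omega)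
    have ih := ih (fun t ht => hu t (hlt t ht)) (fun t ht => hf t (hlt t ht))
      (fun t ht => hg t (hlt t ht))
    obtain ⟨hgx, hgl⟩ := grad_congr m hu hf hg
    simp only [banditState, primalStep, ih, hgx, hgl]

/-- Agreement is required only along the trajectory for the primed data. This suits an exchange of
the functions for extensions known to agree on `S`, once that trajectory is known to stay in `S`. -/
theorem played_congr {T : ℕ} (hu : ∀ t < T, u t = u' t)
    (hf : ∀ t < T, f t (played p lo f' g' x₁ u' t) = f' t (played p lo f' g' x₁ u' t))
    (hg : ∀ t < T, g t (played p lo f' g' x₁ u' t) = g' t (played p lo f' g' x₁ u' t))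
    {t : ℕ} (ht : t < T) : played p lo f g x₁ u t = played p lo f' g' x₁ u' t := by
  have hlt : ∀ s < t / p.K * p.K, s < T := fun s hs =>
    (hs.trans_le (Nat.div_mul_le_self t p.K)).trans ht
  rw [played, played, banditState_congr _ (fun s hs => hu s (hlt s hs))
    (fun s hs => hf s (hlt s hs)) (fun s hs => hg s (hlt s hs)), hu t ht]

theorem totalCalls_congr {T : ℕ} (hu : ∀ t < T, u t = u' t)
    (hf : ∀ t < T, f t (played p lo f' g' x₁ u' t) = f' t (played p lo f' g' x₁ u' t))
    (hg : ∀ t < T, g t (played p lo f' g' x₁ u' t) = g' t (played p lo f' g' x₁ u' t)) :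
    totalCalls p lo f g x₁ u T = totalCalls p lo f' g' x₁ u' T := by
  refine Finset.sum_congr rfl fun m hm => ?_
  have hT : (m + 1) * p.K ≤ T :=
    (Nat.mul_le_mul_right _ (Finset.mem_range.1 hm)).trans (Nat.div_mul_le_self T p.K)
  have hlt : ∀ s < m * p.K, s < T := fun s hs =>
    hs.trans_le ((Nat.mul_le_mul_right _ (Nat.le_succ m)).trans hT)
  rw [banditState_congr m (fun s hs => hu s (hlt s hs))
    (fun s hs => hf s (hlt s hs)) (fun s hs => hg s (hlt s hs)), primalStep, primalStep,
    (grad_congr m (fun s hs => hu s (hs.trans_le hT)) (fun s hs => hf s (hs.trans_le hT))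
      (fun s hs => hg s (hs.trans_le hT))).1]

end Congr

/-! ### Deterministic estimates for one block. -/

/-- Data to which the analysis of the method applies: the assumptions of the setting, with global
Lipschitz bounds. -/
structure BanditInstance {n : ℕ} (p : BanditParams) (S : Set (Euc n)) (lo : Euc n → Euc n)
    (f g : ℕ → Euc n → ℝ) (x₁ : Euc n) (M : ℝ) : Prop where
  n_pos : 0 < n
  r_pos : 0 < p.r
  μ_pos : 0 < p.μ
  μ_lt : p.μ < p.r
  ε_pos : 0 < p.ε
  η_pos : 0 < p.η
  δ_nonneg : 0 ≤ p.δ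
  K_pos : 0 < p.K
  M_pos : 0 < M
  convex : Convex ℝ S
  compact : IsCompact S
  ball_sub : Metric.closedBall 0 p.r ⊆ S
  sub_ball : S ⊆ Metric.closedBall 0 p.R
  f_lip : ∀ t, LipschitzWith M.toNNReal (f t)
  g_lip : ∀ t, LipschitzWith M.toNNReal (g t)
  f_conv : ∀ t, ConvexOn ℝ (Metric.closedBall 0 p.R) (f t)
  g_conv : ∀ t, ConvexOn ℝ (Metric.closedBall 0 p.R) (g t)
  f_bdd : ∀ t, ∀ x ∈ S, |f t x| ≤ M
  g_bdd : ∀ t, ∀ x ∈ S, |g t x| ≤ M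
  oracle : IsLinearOracle S lo
  oracle_meas : Measurable lo
  init_mem : x₁ ∈ (fun x : Euc n => (1 - p.μ / p.r) • x) '' S

namespace BanditInstance

/-- The set `(1 - μ/r) S`. -/
def shrunk {n : ℕ} (p : BanditParams) (S : Set (Euc n)) : Set (Euc n) :=
  (fun x : Euc n => (1 - p.μ / p.r) • x) '' S

variable {n : ℕ} {p : BanditParams} {S : Set (Euc n)} {lo : Euc n → Euc n}
  {f g : ℕ → Euc n → ℝ} {x₁ : Euc n} {M : ℝ}

section

variable (H : BanditInstance p S lo f g x₁ M)
include H

theorem ratio_pos : 0 < p.μ / p.r := div_pos H.μ_pos H.r_pos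

theorem ratio_lt : p.μ / p.r < 1 := (div_lt_one H.r_pos).2 H.μ_lt

theorem r_le_R : p.r ≤ p.R := by
  have := euc_nontrivial H.n_pos
  obtain ⟨v, hv⟩ := exists_norm_eq (Euc n) H.r_pos.le
  have := H.sub_ball (H.ball_sub (mem_closedBall_zero_iff.2 hv.le))
  rw [mem_closedBall_zero_iff] at this
  linarith

theorem R_pos : 0 < p.R := H.r_pos.trans_le H.r_le_R

theorem zero_mem : (0 : Euc n) ∈ S := H.ball_sub (by simpa using H.r_pos.le)

theorem zero_mem_shrunk : (0 : Euc n) ∈ shrunk p S := ⟨0, H.zero_mem, smul_zero _⟩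

theorem norm_le_of_mem {x : Euc n} (hx : x ∈ S) : ‖x‖ ≤ p.R :=
  mem_closedBall_zero_iff.1 (H.sub_ball hx)

theorem convex_shrunk : Convex ℝ (shrunk p S) := H.convex.smul (1 - p.μ / p.r)

theorem compact_shrunk : IsCompact (shrunk p S) := H.compact.image (by fun_prop)

theorem oracle_shrunk : IsLinearOracle (shrunk p S) (shrunkOracle p lo) :=
  H.oracle.smul (sub_nonneg.2 H.ratio_lt.le)

theorem shrunk_subset : shrunk p S ⊆ S := by
  rintro _ ⟨x, hx, rfl⟩
  have := H.convex H.zero_mem hx H.ratio_pos.le (sub_nonneg.2 H.ratio_lt.le) (by ring)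
  simpa using this

theorem norm_le_of_mem_shrunk {x : Euc n} (hx : x ∈ shrunk p S) : ‖x‖ ≤ p.R :=
  H.norm_le_of_mem (H.shrunk_subset hx)

theorem diam_shrunk : ∀ x ∈ shrunk p S, ∀ z ∈ shrunk p S, ‖x - z‖ ≤ 2 * p.R := fun x hx z hz => by
  have := norm_sub_le x z
  have := H.norm_le_of_mem_shrunk hx
  have := H.norm_le_of_mem_shrunk hz
  linarith

/-- The perturbed point is the convex combination of `y ∈ S` and `r v ∈ S` with weights `1 - μ/r`
and `μ/r`. -/
theorem add_smul_mem {x v : Euc n} (hx : x ∈ shrunk p S) (hv : ‖v‖ ≤ 1) : x + p.μ • v ∈ S := by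
  obtain ⟨y, hy, rfl⟩ := hx
  have hb : p.r • v ∈ S := H.ball_sub (by
    rw [mem_closedBall_zero_iff, norm_smul, Real.norm_of_nonneg H.r_pos.le]
    exact mul_le_of_le_one_right H.r_pos.le hv)
  have := H.convex hy hb (sub_nonneg.2 H.ratio_lt.le) H.ratio_pos.le (by ring)
  rwa [smul_smul, div_mul_cancel₀ _ H.r_pos.ne'] at this

theorem norm_projBall_sub_le {y z : Euc n} (hz : ‖z‖ ≤ p.R) :
    ‖projBall p.R y - z‖ ^ 2 ≤ ‖y - z‖ ^ 2 := by
  unfold projBall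
  split_ifs with h
  · exact le_rfl
  · rw [not_le] at h
    have hy : 0 < ‖y‖ := H.R_pos.trans h
    rw [norm_sub_sq_real, norm_sub_sq_real, norm_smul, Real.norm_of_nonneg
      (div_nonneg H.R_pos.le hy.le), inner_smul_left, div_mul_cancel₀ _ hy.ne']
    simp only [conj_trivial]
    have h1 : p.R / ‖y‖ ≤ 1 := (div_le_one hy).2 h.le
    have h2 : inner ℝ y z ≤ ‖y‖ * p.R := (real_inner_le_norm y z).trans (by gcongr)
    have h3 : (1 - p.R / ‖y‖) * inner ℝ y z ≤ (1 - p.R / ‖y‖) * (‖y‖ * p.R) :=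
      mul_le_mul_of_nonneg_left h2 (sub_nonneg.2 h1)
    have h4 : (1 - p.R / ‖y‖) * (‖y‖ * p.R) = ‖y‖ * p.R - p.R ^ 2 := by field_simp
    nlinarith [sq_nonneg (‖y‖ - p.R)]

theorem max_g_bdd (t : ℕ) {x : Euc n} (hx : x ∈ S) : max (g t x) 0 ≤ M :=
  max_le ((le_abs_self _).trans (H.g_bdd t x hx)) H.M_pos.le

theorem f_sub_le (t : ℕ) (x y : Euc n) : f t x - f t y ≤ M * ‖x - y‖ := by
  have := (H.f_lip t).dist_le_mul x y
  rw [Real.dist_eq, dist_eq_norm, Real.coe_toNNReal _ H.M_pos.le] at this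
  exact (le_abs_self _).trans this

theorem max_g_lip (t : ℕ) : LipschitzWith M.toNNReal fun x => max (g t x) 0 :=
  (H.g_lip t).max_const 0

theorem max_g_sub_le (t : ℕ) (x y : Euc n) : max (g t x) 0 - max (g t y) 0 ≤ M * ‖x - y‖ := by
  have := (H.max_g_lip t).dist_le_mul x y
  rw [Real.dist_eq, dist_eq_norm, Real.coe_toNNReal _ H.M_pos.le] at this
  exact (le_abs_self _).trans this

end

section

variable (H : BanditInstance p S lo f g x₁ M) {u : ℕ → Euc n} (hu : ∀ t, ‖u t‖ ≤ 1)
include H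

theorem afpOut_spec {x : Euc n} (hx : x ∈ shrunk p S) (y : Euc n) :
    (afpOut p.ε (shrunkOracle p lo) x y).1 ∈ shrunk p S ∧
      ‖(afpOut p.ε (shrunkOracle p lo) x y).1 - (afpOut p.ε (shrunkOracle p lo) x y).2‖ ^ 2
        ≤ 3 * p.ε ∧
      ∀ z ∈ shrunk p S, ‖(afpOut p.ε (shrunkOracle p lo) x y).2 - z‖ ^ 2 ≤ ‖y - z‖ ^ 2 :=
  _root_.afpOut_spec H.convex_shrunk H.compact_shrunk H.oracle_shrunk H.diam_shrunk
    (mul_pos two_pos H.R_pos) H.ε_pos hx y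

variable (u) in
theorem x_mem (m : ℕ) : (banditState p lo f g x₁ u m).x ∈ shrunk p S := by
  induction m with
  | zero => exact H.init_mem
  | succ m ih => exact (H.afpOut_spec ih _).1

variable (u) in
theorem norm_x_sub_y_le (m : ℕ) :
    ‖(banditState p lo f g x₁ u m).x - (banditState p lo f g x₁ u m).y‖ ≤ √(3 * p.ε) := by
  refine Real.le_sqrt_of_sq_le ?_
  cases m with
  | zero => simpa [banditState] using H.ε_pos.le
  | succ m => exact (H.afpOut_spec (H.x_mem u m) _).2.1

variable (u) in
theorem norm_y_sub_le (m : ℕ) {z : Euc n} (hz : z ∈ shrunk p S) :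
    ‖(banditState p lo f g x₁ u m).y - z‖ ≤ 2 * p.R := by
  cases m with
  | zero => exact H.diam_shrunk _ H.init_mem _ hz
  | succ m =>
    have h1 := (H.afpOut_spec (H.x_mem u m)
      (primalStep p f g u m (banditState p lo f g x₁ u m))).2.2 z hz
    refine (le_of_sq_le_sq h1 (norm_nonneg _)).trans ?_
    have h2 := (projBall_spec H.R_pos.le (n := n)
      ((banditState p lo f g x₁ u m).y - p.η • gradX p f g u m (banditState p lo f g x₁ u m))).1
    rw [mem_closedBall_zero_iff] at h2
    refine (norm_sub_le _ _).trans ?_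
    have := H.norm_le_of_mem_shrunk hz
    rw [primalStep]
    linarith

omit H in
variable (u) in
theorem lam_nonneg (m : ℕ) : 0 ≤ (banditState p lo f g x₁ u m).lam := by
  cases m with
  | zero => exact le_rfl
  | succ m => exact le_max_left _ _

include hu in
theorem play_mem (m t : ℕ) : (banditState p lo f g x₁ u m).x + p.μ • u t ∈ S :=
  H.add_smul_mem (H.x_mem u m) (hu t)

include hu in
theorem played_mem (t : ℕ) : played p lo f g x₁ u t ∈ S := H.play_mem hu _ t

omit H in
theorem card_block (K m : ℕ) : (block K m).card = K := by
  rw [block, Nat.card_Ico, add_mul, one_mul, Nat.add_sub_cancel_left]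

include hu in
theorem gradLam_le (m : ℕ) :
    gradLam p g u m (banditState p lo f g x₁ u m) ≤ p.K * M := by
  have : ∀ t ∈ block p.K m, max (g t ((banditState p lo f g x₁ u m).x + p.μ • u t)) 0
      - p.δ * p.η * (banditState p lo f g x₁ u m).lam ≤ M := fun t _ => by
    have := H.max_g_bdd t (H.play_mem hu m t)
    have := mul_nonneg (mul_nonneg H.δ_nonneg H.η_pos.le) (lam_nonneg (p := p) (lo := lo)
      (f := f) (g := g) (x₁ := x₁) u m)
    linarith
  have := Finset.sum_le_card_nsmul _ _ _ this
  rwa [card_block, nsmul_eq_mul] at this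

-- A crude deterministic bound. It serves only to make every random variable bounded, hence
-- integrable; it does not enter the rates.
include hu in
theorem lam_le (m : ℕ) : (banditState p lo f g x₁ u m).lam ≤ m * (p.η * (p.K * M)) := by
  have h0 : 0 ≤ p.η * (p.K * M) := mul_nonneg H.η_pos.le (mul_nonneg (by positivity) H.M_pos.le)
  induction m with
  | zero => simp [banditState]
  | succ m ih =>
    refine max_le (by positivity) ?_
    have := mul_le_mul_of_nonneg_left (H.gradLam_le hu m) H.η_pos.le
    push_cast
    linarith

variable (u) in
/-- One step of the primal method. -/
theorem primal_step (m : ℕ) {z : Euc n} (hz : z ∈ shrunk p S) :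
    2 * p.η * inner ℝ (gradX p f g u m (banditState p lo f g x₁ u m))
        ((banditState p lo f g x₁ u m).x - z) ≤
      ‖(banditState p lo f g x₁ u m).y - z‖ ^ 2 - ‖(banditState p lo f g x₁ u (m + 1)).y - z‖ ^ 2
        + p.η ^ 2 * ‖gradX p f g u m (banditState p lo f g x₁ u m)‖ ^ 2
        + 2 * p.η * √(3 * p.ε) * ‖gradX p f g u m (banditState p lo f g x₁ u m)‖ := by
  set s := banditState p lo f g x₁ u m
  set G := gradX p f g u m s with hG
  have h1 : ‖(banditState p lo f g x₁ u (m + 1)).y - z‖ ^ 2 ≤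
      ‖primalStep p f g u m s - z‖ ^ 2 := (H.afpOut_spec (H.x_mem u m) _).2.2 z hz
  have h2 : ‖primalStep p f g u m s - z‖ ^ 2 ≤ ‖s.y - p.η • G - z‖ ^ 2 :=
    H.norm_projBall_sub_le (H.norm_le_of_mem_shrunk hz)
  have h3 : ‖s.y - p.η • G - z‖ ^ 2 =
      ‖s.y - z‖ ^ 2 - 2 * p.η * inner ℝ G (s.y - z) + p.η ^ 2 * ‖G‖ ^ 2 := by
    have : s.y - p.η • G - z = (s.y - z) - p.η • G := by abel
    rw [this, norm_sub_sq_real, inner_smul_right, norm_smul, mul_pow, Real.norm_eq_abs, sq_abs,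
      real_inner_comm]
    ring
  have h4 : inner ℝ G (s.x - z) = inner ℝ G (s.y - z) + inner ℝ G (s.x - s.y) := by
    rw [← inner_add_right]; congr 1; abel
  have h5 : inner ℝ G (s.x - s.y) ≤ ‖G‖ * √(3 * p.ε) :=
    (real_inner_le_norm _ _).trans (by gcongr; exact H.norm_x_sub_y_le u m)
  have h6 := mul_le_mul_of_nonneg_left h5 (mul_nonneg zero_le_two H.η_pos.le)
  rw [h4]
  linarith

include hu in
/-- One step of the dual method. -/
theorem dual_step (m : ℕ) {l : ℝ} (hl : 0 ≤ l) :
    2 * p.η * ((l - (banditState p lo f g x₁ u m).lam) *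
        ∑ t ∈ block p.K m, max (g t ((banditState p lo f g x₁ u m).x + p.μ • u t)) 0) ≤
      ((banditState p lo f g x₁ u m).lam - l) ^ 2
        - ((banditState p lo f g x₁ u (m + 1)).lam - l) ^ 2
        + p.η * (p.K * p.δ * p.η) * (l ^ 2 - (banditState p lo f g x₁ u m).lam ^ 2)
        + p.η ^ 2 * ((p.K * M) ^ 2
          + (p.K * p.δ * p.η * (banditState p lo f g x₁ u m).lam) ^ 2) := by
  set s := banditState p lo f g x₁ u m
  set A := ∑ t ∈ block p.K m, max (g t (s.x + p.μ • u t)) 0 with hA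
  have hs0 : 0 ≤ s.lam := lam_nonneg u m
  have hgl : gradLam p g u m s = A - p.K * p.δ * p.η * s.lam := by
    rw [gradLam, Finset.sum_sub_distrib, Finset.sum_const, card_block, nsmul_eq_mul]
    ring
  have hA0 : 0 ≤ A := Finset.sum_nonneg fun t _ => le_max_right _ _
  have hAM : A ≤ p.K * M := by
    have := Finset.sum_le_card_nsmul (block p.K m)
      (fun t => max (g t (s.x + p.μ • u t)) 0) M fun t _ => H.max_g_bdd t (H.play_mem hu m t)
    rwa [card_block, nsmul_eq_mul] at this
  have hnext : ((banditState p lo f g x₁ u (m + 1)).lam - l) ^ 2 ≤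
      (s.lam + p.η * gradLam p g u m s - l) ^ 2 := by
    change (max 0 (s.lam + p.η * gradLam p g u m s) - l) ^ 2 ≤ _
    rcases le_total 0 (s.lam + p.η * gradLam p g u m s) with h | h
    · rw [max_eq_right h]
    · rw [max_eq_left h]
      nlinarith
  set c := p.K * p.δ * p.η with hc
  have hc0 : 0 ≤ c := mul_nonneg (mul_nonneg (by positivity) H.δ_nonneg) H.η_pos.le
  rw [hgl] at hnext
  -- Both numbers are nonnegative, so the cross term has the favourable sign.
  have hsq : (A - c * s.lam) ^ 2 ≤ (p.K * M) ^ 2 + (c * s.lam) ^ 2 := by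
    have : 0 ≤ c * s.lam := mul_nonneg hc0 hs0
    nlinarith [mul_nonneg hA0 this]
  have h7 := mul_le_mul_of_nonneg_left hsq (sq_nonneg p.η)
  -- Strong concavity of the regularizer: `2λ(λ - l) = λ² - l² + (λ - l)²`.
  have h8 : c * (2 * s.lam * (s.lam - l)) ≥ c * (s.lam ^ 2 - l ^ 2) :=
    mul_le_mul_of_nonneg_left (by nlinarith [sq_nonneg (s.lam - l)]) hc0
  have h9 := mul_le_mul_of_nonneg_left h8 H.η_pos.le
  nlinarith

variable (u) in
/-- A bound of the number of oracle calls. -/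
theorem totalCalls_le {T : ℕ} (hT : T = p.K * p.K)
    (hN : (max 0 (9 / 4 * Real.log (p.R ^ 2 / p.ε)) + 2) * (4 * (2 * p.R) ^ 2 / p.ε + 3) ≤ p.K) :
    totalCalls p lo f g x₁ u T ≤ T := by
  have hK : T / p.K = p.K := by rw [hT, Nat.mul_div_cancel _ H.K_pos]
  rw [totalCalls, hK]
  refine (Finset.sum_le_card_nsmul _ _ (p.K : ℕ∞) fun m _ => ?_).trans ?_
  -- There are `K` blocks, each allowed `K` calls. The comparison point is the origin, at distance
  -- at most `R` from a point projected onto the ball.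
  · refine afpCalls_le H.convex_shrunk H.compact_shrunk H.oracle_shrunk H.diam_shrunk
      (mul_pos two_pos H.R_pos) H.ε_pos (H.x_mem u m) H.zero_mem_shrunk H.R_pos ?_ hN
    rw [sub_zero]
    exact mem_closedBall_zero_iff.1 (projBall_spec H.R_pos.le _).1
  · rw [Finset.card_range, nsmul_eq_mul, hT]
    push_cast
    exact le_rfl

end

end BanditInstance

/-! ### Independence and the moments of the gradient estimate. -/

section Independence

variable {Ω 𝒳 𝒰 : Type*} [MeasurableSpace Ω] [MeasurableSpace 𝒳] [MeasurableSpace 𝒰]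
  {P : Measure Ω} [IsProbabilityMeasure P]

/-- Integration over one of two independent variables first. -/
theorem ProbabilityTheory.IndepFun.integral_comp_prod {X : Ω → 𝒳} {U : Ω → 𝒰} (hind : IndepFun X U P)
    (hX : Measurable X) (hU : Measurable U) {ν : Measure 𝒰} (hlaw : P.map U = ν) {Φ : 𝒳 × 𝒰 → ℝ}
    (hΦ : Measurable Φ) (hint : Integrable (fun ω => Φ (X ω, U ω)) P) :
    Integrable (fun ω => ∫ v, Φ (X ω, v) ∂ν) P ∧
      ∫ ω, Φ (X ω, U ω) ∂P = ∫ ω, ∫ v, Φ (X ω, v) ∂ν ∂P := by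
  subst hlaw
  have := Measure.isProbabilityMeasure_map (μ := P) hX.aemeasurable
  have := Measure.isProbabilityMeasure_map (μ := P) hU.aemeasurable
  have hprod := (indepFun_iff_map_prod_eq_prod_map_map hX.aemeasurable hU.aemeasurable).1 hind
  have hi : Integrable Φ ((P.map X).prod (P.map U)) := by
    rw [← hprod]
    exact (integrable_map_measure hΦ.aestronglyMeasurable (hX.prodMk hU).aemeasurable).2 hint
  have hi2 := hi.integral_prod_left
  refine ⟨(integrable_map_measure hi2.aestronglyMeasurable hX.aemeasurable).1 hi2, ?_⟩
  rw [← integral_map (f := fun x => ∫ v, Φ (x, v) ∂P.map U) hX.aemeasurable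
    hi2.aestronglyMeasurable, ← integral_prod _ hi, ← hprod,
    integral_map (hX.prodMk hU).aemeasurable hΦ.aestronglyMeasurable]

theorem integrable_of_measurable_of_abs_le {F : Ω → ℝ} (hF : Measurable F) {B : ℝ}
    (hB : ∀ ω, |F ω| ≤ B) : Integrable F P :=
  Integrable.of_bound hF.aestronglyMeasurable B (ae_of_all _ hB)

end Independence

theorem sum_blocks {E : Type*} [AddCommMonoid E] (F : ℕ → E) (K N : ℕ) :
    ∑ m ∈ Finset.range N, ∑ t ∈ block K m, F t = ∑ t ∈ Finset.range (N * K), F t := by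
  induction N with
  | zero => simp
  | succ N ih =>
    rw [Finset.sum_range_succ, ih, block, Finset.range_eq_Ico,
      Finset.sum_Ico_consecutive _ (Nat.zero_le _) (by gcongr; omega), Finset.range_eq_Ico]

namespace BanditInstance

/-- The Lagrangian of round `t`. -/
noncomputable def lagrangian {n : ℕ} (f g : ℕ → Euc n → ℝ) (t : ℕ) (l : ℝ) (x : Euc n) : ℝ :=
  f t x + l * max (g t x) 0

/-- The contribution of round `t` to the gradient estimate. -/
noncomputable def gradTerm {n : ℕ} (p : BanditParams) (f g : ℕ → Euc n → ℝ) (t : ℕ)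
    (q : Euc n × ℝ) (v : Euc n) : Euc n :=
  ((n / p.μ) * lagrangian f g t q.2 (q.1 + p.μ • v)) • v

variable {n : ℕ} {p : BanditParams} {S : Set (Euc n)} {lo : Euc n → Euc n}
  {f g : ℕ → Euc n → ℝ} {x₁ : Euc n} {M : ℝ} (H : BanditInstance p S lo f g x₁ M)

section

include H

theorem lagrangian_lip (t : ℕ) {l : ℝ} (hl : 0 ≤ l) :
    LipschitzWith (M * (1 + l)).toNNReal (lagrangian f g t l) := by
  refine LipschitzWith.of_dist_le_mul fun x y => ?_
  have h1 := (H.f_lip t).dist_le_mul x y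
  have h2 := (H.max_g_lip t).dist_le_mul x y
  rw [Real.coe_toNNReal _ H.M_pos.le, Real.dist_eq] at h1 h2
  rw [Real.coe_toNNReal _ (mul_nonneg H.M_pos.le (by linarith)), Real.dist_eq, lagrangian, lagrangian]
  have e : f t x + l * max (g t x) 0 - (f t y + l * max (g t y) 0) =
      (f t x - f t y) + l * (max (g t x) 0 - max (g t y) 0) := by ring
  rw [e]
  refine (abs_add_le _ _).trans ?_
  rw [abs_mul, abs_of_nonneg hl]
  have := mul_le_mul_of_nonneg_left h2 hl
  linarith

theorem lagrangian_conv (t : ℕ) {l : ℝ} (hl : 0 ≤ l) :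
    ConvexOn ℝ (Metric.closedBall 0 p.R) (lagrangian f g t l) := by
  have h0 : ConvexOn ℝ (Metric.closedBall (0 : Euc n) p.R) fun _ => (0 : ℝ) :=
    convexOn_const 0 (convex_closedBall _ _)
  exact (H.f_conv t).add (((H.g_conv t).sup h0).smul hl)

theorem abs_lagrangian_le (t : ℕ) {l : ℝ} (hl : 0 ≤ l) {x : Euc n} (hx : x ∈ S) :
    |lagrangian f g t l x| ≤ M * (1 + l) := by
  refine (abs_add_le _ _).trans ?_
  rw [abs_mul, abs_of_nonneg hl, abs_of_nonneg (le_max_right (g t x) 0)]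
  have := mul_le_mul_of_nonneg_left (H.max_g_bdd t hx) hl
  have := H.f_bdd t x hx
  linarith

theorem norm_gradTerm_le (t : ℕ) {q : Euc n × ℝ} (hq : q.1 ∈ shrunk p S) (hl : 0 ≤ q.2) {v : Euc n}
    (hv : ‖v‖ ≤ 1) : ‖gradTerm p f g t q v‖ ≤ n / p.μ * (M * (1 + q.2)) := by
  rw [gradTerm, norm_smul, Real.norm_eq_abs, abs_mul, abs_of_nonneg
    (div_nonneg (Nat.cast_nonneg n) H.μ_pos.le)]
  have h1 := H.abs_lagrangian_le (t := t) hl (H.add_smul_mem hq hv)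
  have h2 : 0 ≤ (n : ℝ) / p.μ := div_nonneg (Nat.cast_nonneg n) H.μ_pos.le
  have h3 : 0 ≤ M * (1 + q.2) := (abs_nonneg _).trans h1
  calc _ ≤ n / p.μ * (M * (1 + q.2)) * 1 := by gcongr
    _ = _ := mul_one _

theorem measurable_gradTerm (t : ℕ) {α : Type*} [MeasurableSpace α] {q : α → Euc n × ℝ}
    {v : α → Euc n} (hq : Measurable q) (hv : Measurable v) :
    Measurable fun a => gradTerm p f g t (q a) (v a) := by
  have hf := (H.f_lip t).continuous.measurable
  have hg := (H.g_lip t).continuous.measurable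
  have hz : Measurable fun a => (q a).1 + p.μ • v a := hq.fst.add (hv.const_smul p.μ)
  exact (((hf.comp hz).add (hq.snd.mul ((hg.comp hz).max measurable_const))).const_mul _).smul hv

theorem norm_smoothGrad_lagrangian_le (t : ℕ) {l : ℝ} (hl : 0 ≤ l) (x : Euc n) :
    ‖smoothGrad p.μ (lagrangian f g t l) x‖ ≤ M * (1 + l) := by
  have := norm_smoothGrad_le H.n_pos H.μ_pos (H.lagrangian_lip t hl) x
  rwa [Real.coe_toNNReal _ (mul_nonneg H.M_pos.le (by linarith))] at this

theorem le_inner_smoothGrad_lagrangian (t : ℕ) {l : ℝ} (hl : 0 ≤ l) {x z : Euc n}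
    (hx : x ∈ shrunk p S) (hz : z ∈ shrunk p S) :
    lagrangian f g t l x - lagrangian f g t l z - 2 * M * p.μ * (1 + l) ≤
      inner ℝ (smoothGrad p.μ (lagrangian f g t l) x) (x - z) := by
  have hsub : ∀ w ∈ shrunk p S, ∀ v ∈ Metric.ball (0 : Euc n) 1,
      w + p.μ • v ∈ Metric.closedBall (0 : Euc n) p.R := fun w hw v hv =>
    H.sub_ball (H.add_smul_mem hw (mem_ball_zero_iff.1 hv).le)
  have := le_inner_smoothGrad H.n_pos H.μ_pos (H.lagrangian_lip t hl) (H.lagrangian_conv t hl)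
    (hsub x hx) (hsub z hz)
  rw [Real.coe_toNNReal _ (mul_nonneg H.M_pos.le (by linarith))] at this
  linarith

theorem integral_gradTerm (t : ℕ) (q : Euc n × ℝ) :
    Integrable (fun v : Metric.sphere (0 : Euc n) 1 => gradTerm p f g t q v) (uniformSphere n) ∧
    ∫ v : Metric.sphere (0 : Euc n) 1, gradTerm p f g t q v ∂uniformSphere n =
      smoothGrad p.μ (lagrangian f g t q.2) q.1 := by
  have hf := (H.f_lip t).continuous
  have hg := (H.g_lip t).continuous
  refine ⟨integrable_uniformSphere H.n_pos ?_, rfl⟩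
  unfold gradTerm lagrangian
  fun_prop

end

variable {Ω : Type*} [MeasurableSpace Ω] {P : Measure Ω} [IsProbabilityMeasure P]
  {u : ℕ → Ω → Metric.sphere (0 : Euc n) 1}

variable (p lo f g x₁ u) in
/-- The variables at the beginning of block `m` as random variables. -/
noncomputable abbrev rState (m : ℕ) (ω : Ω) : BanditState n :=
  banditState p lo f g x₁ (fun s => (u s ω : Euc n)) m

variable (p lo f g x₁ u) in
/-- The pair `(x_m, λ_m)`. -/
noncomputable def rPair (m : ℕ) (ω : Ω) : Euc n × ℝ :=
  ((rState p lo f g x₁ u m ω).x, (rState p lo f g x₁ u m ω).lam)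

omit [MeasurableSpace Ω] in
theorem norm_sample_le (t : ℕ) (ω : Ω) : ‖(u t ω : Euc n)‖ ≤ 1 :=
  (mem_sphere_zero_iff_norm.1 (u t ω).2).le

include H in
theorem measurable_rState (hum : ∀ t, Measurable (u t)) (m : ℕ) :
    Measurable (fun ω => (rState p lo f g x₁ u m ω).x) ∧
    Measurable (fun ω => (rState p lo f g x₁ u m ω).y) ∧
    Measurable (fun ω => (rState p lo f g x₁ u m ω).lam) :=
  measurable_banditState (u := fun s ω => (u s ω : Euc n)) H.oracle_meas
    (fun t => (H.f_lip t).continuous.measurable)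
    (fun t => (H.g_lip t).continuous.measurable) m
    fun t _ => measurable_subtype_coe.comp (hum t)

include H in
theorem measurable_rPair (hum : ∀ t, Measurable (u t)) (m : ℕ) :
    Measurable (rPair p lo f g x₁ u m) :=
  (H.measurable_rState hum m).1.prodMk (H.measurable_rState hum m).2.2

omit [IsProbabilityMeasure P] in
include H in
/-- The variables at the beginning of a block are independent of the samples of the block. -/
theorem indepFun_rPair (hum : ∀ t, Measurable (u t))
    (hind : iIndepFun (fun t : Fin (p.K * p.K) => u t) P) {m : ℕ} (hm : m < p.K)
    {s t : ℕ} (hs : s ∈ block p.K m) (ht : t ∈ block p.K m) :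
    IndepFun (rPair p lo f g x₁ u m) (fun ω => (u s ω, u t ω)) P := by
  have hT : (m + 1) * p.K ≤ p.K * p.K := by gcongr; omega
  obtain ⟨hs1, hs2⟩ := Finset.mem_Ico.1 hs
  obtain ⟨ht1, ht2⟩ := Finset.mem_Ico.1 ht
  let I : Set (Fin (p.K * p.K)) := {i | (i : ℕ) < m * p.K}
  have hI := indep_iSup_of_disjoint (fun i : Fin (p.K * p.K) => (hum i).comap_le) hind
    (disjoint_compl_right (a := I))
  -- Measurability is applied to the σ-algebra of the samples before block `m`, which is independent
  -- of that of the remaining samples.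
  have hX : Measurable[⨆ i ∈ I, MeasurableSpace.comap (u (i : ℕ)) inferInstance]
      (rPair p lo f g x₁ u m) := by
    have := @measurable_banditState Ω (⨆ i ∈ I, MeasurableSpace.comap (u (i : ℕ)) inferInstance)
      n lo p f g x₁ H.oracle_meas (fun t => (H.f_lip t).continuous.measurable)
      (fun t => (H.g_lip t).continuous.measurable) (fun s ω => (u s ω : Euc n)) m
      (fun t ht => measurable_subtype_coe.comp (measurable_iff_comap_le.2
        (le_iSup₂_of_le (f := fun (i : Fin (p.K * p.K)) (_ : i ∈ I) =>
          MeasurableSpace.comap (u (i : ℕ)) inferInstance)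
          (⟨t, ht.trans_le (by nlinarith)⟩ : Fin (p.K * p.K)) ht le_rfl)))
    exact this.1.prodMk this.2.2
  have hU : ∀ t, m * p.K ≤ t → t < (m + 1) * p.K →
      Measurable[⨆ i ∈ Iᶜ, MeasurableSpace.comap (u (i : ℕ)) inferInstance] (u t) :=
    fun t ht1 ht2 => measurable_iff_comap_le.2
        (le_iSup₂_of_le (f := fun (i : Fin (p.K * p.K)) (_ : i ∈ Iᶜ) =>
          MeasurableSpace.comap (u (i : ℕ)) inferInstance)
          (⟨t, ht2.trans_le hT⟩ : Fin (p.K * p.K)) (not_lt.2 ht1) le_rfl)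
  have hV := (hU s hs1 hs2).prodMk (hU t ht1 ht2)
  exact indep_of_indep_of_le_left (indep_of_indep_of_le_right hI hV.comap_le) hX.comap_le

/-- Needed for the mixed second moments, where two samples of one block are integrated out together.
-/
theorem map_pair_eq_prod {T : ℕ} (hum : ∀ t, Measurable (u t))
    (hlaw : ∀ t < T, P.map (u t) = uniformSphere n)
    (hind : iIndepFun (fun t : Fin T => u t) P) {s t : ℕ} (hs : s < T) (ht : t < T) (hst : s ≠ t) :
    P.map (fun ω => (u s ω, u t ω)) = (uniformSphere n).prod (uniformSphere n) := by
  have := hind.indepFun (i := ⟨s, hs⟩) (j := ⟨t, ht⟩) (by simpa using hst)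
  rw [(indepFun_iff_map_prod_eq_prod_map_map (hum s).aemeasurable (hum t).aemeasurable).1 this,
    hlaw s hs, hlaw t ht]

end BanditInstance

namespace BanditInstance

variable {n : ℕ} {p : BanditParams} {S : Set (Euc n)} {lo : Euc n → Euc n}
  {f g : ℕ → Euc n → ℝ} {x₁ : Euc n} {M : ℝ} (H : BanditInstance p S lo f g x₁ M)
  {Ω : Type*} [MeasurableSpace Ω] {P : Measure Ω} [IsProbabilityMeasure P]
  {u : ℕ → Ω → Metric.sphere (0 : Euc n) 1}

variable (p lo f g x₁ u) in
/-- The gradient estimate of block `m`. -/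
noncomputable def rGrad (m : ℕ) (ω : Ω) : Euc n :=
  gradX p f g (fun s => (u s ω : Euc n)) m (rState p lo f g x₁ u m ω)

omit [MeasurableSpace Ω] in
theorem rGrad_eq (m : ℕ) (ω : Ω) : rGrad p lo f g x₁ u m ω =
    ∑ t ∈ block p.K m, gradTerm p f g t (rPair p lo f g x₁ u m ω) (u t ω) := rfl

variable (p M) in
/-- A deterministic bound of `λ_m`. -/
noncomputable def lamBound (m : ℕ) : ℝ := m * (p.η * (p.K * M))

include H

omit [MeasurableSpace Ω] in
variable (u) in
theorem rPair_fst_mem (m : ℕ) (ω : Ω) : (rPair p lo f g x₁ u m ω).1 ∈ shrunk p S := H.x_mem _ m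

omit H [MeasurableSpace Ω] in
variable (u) in
theorem rPair_snd_nonneg (m : ℕ) (ω : Ω) : 0 ≤ (rPair p lo f g x₁ u m ω).2 := lam_nonneg _ m

omit [MeasurableSpace Ω] in
variable (u) in
theorem rPair_snd_le (m : ℕ) (ω : Ω) : (rPair p lo f g x₁ u m ω).2 ≤ lamBound p M m :=
  H.lam_le (fun t => norm_sample_le t ω) m

omit [MeasurableSpace Ω] in
variable (u) in
theorem norm_gradTerm_rPair_le (m t : ℕ) (ω : Ω) :
    ‖gradTerm p f g t (rPair p lo f g x₁ u m ω) (u t ω)‖ ≤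
      n / p.μ * (M * (1 + (rPair p lo f g x₁ u m ω).2)) :=
  H.norm_gradTerm_le t (H.rPair_fst_mem u m ω) (rPair_snd_nonneg u m ω) (norm_sample_le t ω)

omit [MeasurableSpace Ω] in
variable (u) in
theorem norm_gradTerm_rPair_le_const (m t : ℕ) (ω : Ω) :
    ‖gradTerm p f g t (rPair p lo f g x₁ u m ω) (u t ω)‖ ≤
      n / p.μ * (M * (1 + lamBound p M m)) := by
  refine (H.norm_gradTerm_rPair_le u m t ω).trans ?_
  have := H.rPair_snd_le u m ω
  have := H.M_pos
  have := H.μ_pos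
  gcongr

theorem measurable_gradTerm_rPair (hum : ∀ t, Measurable (u t)) (m t : ℕ) :
    Measurable fun ω => gradTerm p f g t (rPair p lo f g x₁ u m ω) (u t ω) :=
  H.measurable_gradTerm t (H.measurable_rPair hum m) (measurable_subtype_coe.comp (hum t))

theorem measurable_rGrad (hum : ∀ t, Measurable (u t)) (m : ℕ) :
    Measurable (rGrad p lo f g x₁ u m) := by
  have : Measurable fun ω => ∑ t ∈ block p.K m, gradTerm p f g t (rPair p lo f g x₁ u m ω) (u t ω) :=
    Finset.measurable_sum _ fun t _ => H.measurable_gradTerm_rPair hum m t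
  exact this

omit [MeasurableSpace Ω] in
variable (u) in
theorem norm_rGrad_le (m : ℕ) (ω : Ω) : ‖rGrad p lo f g x₁ u m ω‖ ≤
    p.K * (n / p.μ * (M * (1 + lamBound p M m))) := by
  rw [rGrad_eq]
  refine (norm_sum_le _ _).trans ((Finset.sum_le_card_nsmul _ _ _
    fun t _ => H.norm_gradTerm_rPair_le_const u m t ω).trans ?_)
  rw [card_block, nsmul_eq_mul]

theorem integrable_rGrad_sq (hum : ∀ t, Measurable (u t)) (m : ℕ) :
    Integrable (fun ω => ‖rGrad p lo f g x₁ u m ω‖ ^ 2) P := by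
  refine integrable_of_measurable_of_abs_le ((H.measurable_rGrad hum m).norm.pow_const 2)
    (B := (p.K * (n / p.μ * (M * (1 + lamBound p M m)))) ^ 2) fun ω => ?_
  rw [abs_of_nonneg (sq_nonneg _)]
  have := H.norm_rGrad_le u m ω
  gcongr

theorem integrable_one_add_sq (hum : ∀ t, Measurable (u t)) (m : ℕ) :
    Integrable (fun ω => (1 + (rPair p lo f g x₁ u m ω).2) ^ 2) P := by
  refine integrable_of_measurable_of_abs_le
    (((H.measurable_rPair hum m).snd.const_add 1).pow_const 2)
    (B := (1 + lamBound p M m) ^ 2) fun ω => ?_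
  rw [abs_of_nonneg (sq_nonneg _)]
  have := H.rPair_snd_le u m ω
  have := rPair_snd_nonneg (p := p) (lo := lo) (f := f) (g := g) (x₁ := x₁) u m ω
  gcongr

/-- Mixed second moments of the summands of the gradient estimate. -/
theorem integral_inner_gradTerm_le (hum : ∀ t, Measurable (u t))
    (hlaw : ∀ t < p.K * p.K, P.map (u t) = uniformSphere n)
    (hind : iIndepFun (fun t : Fin (p.K * p.K) => u t) P) {m : ℕ} (hm : m < p.K)
    {s t : ℕ} (hs : s ∈ block p.K m) (ht : t ∈ block p.K m) (hst : s ≠ t) :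
    ∫ ω, inner ℝ (gradTerm p f g s (rPair p lo f g x₁ u m ω) (u s ω))
        (gradTerm p f g t (rPair p lo f g x₁ u m ω) (u t ω)) ∂P ≤
      M ^ 2 * ∫ ω, (1 + (rPair p lo f g x₁ u m ω).2) ^ 2 ∂P := by
  have := isProbabilityMeasure_uniformSphere H.n_pos
  have hT : (m + 1) * p.K ≤ p.K * p.K := by gcongr; omega
  have hsT := (Finset.mem_Ico.1 hs).2.trans_le hT
  have htT := (Finset.mem_Ico.1 ht).2.trans_le hT
  obtain ⟨h1, h2⟩ := (H.indepFun_rPair hum hind hm hs ht).integral_comp_prod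
    (H.measurable_rPair hum m) ((hum s).prodMk (hum t))
    (map_pair_eq_prod hum hlaw hind hsT htT hst)
    (Φ := fun r => inner ℝ (gradTerm p f g s r.1 r.2.1) (gradTerm p f g t r.1 r.2.2))
    (Measurable.inner (𝕜 := ℝ)
      (H.measurable_gradTerm s measurable_fst (measurable_subtype_coe.comp measurable_snd.fst))
      (H.measurable_gradTerm t measurable_fst (measurable_subtype_coe.comp measurable_snd.snd)))
    (integrable_of_measurable_of_abs_le (Measurable.inner (𝕜 := ℝ)
      (H.measurable_gradTerm_rPair hum m s) (H.measurable_gradTerm_rPair hum m t))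
      (B := (n / p.μ * (M * (1 + lamBound p M m))) * (n / p.μ * (M * (1 + lamBound p M m))))
      fun ω => (abs_real_inner_le_norm _ _).trans (mul_le_mul
        (H.norm_gradTerm_rPair_le_const u m s ω) (H.norm_gradTerm_rPair_le_const u m t ω)
        (norm_nonneg _) ((norm_nonneg _).trans (H.norm_gradTerm_rPair_le_const u m s ω))))
  rw [h2, ← integral_const_mul]
  refine integral_mono h1 ((H.integrable_one_add_sq hum m).const_mul _) fun ω => ?_
  set q := rPair p lo f g x₁ u m ω with hq
  have hq0 : 0 ≤ q.2 := rPair_snd_nonneg u m ω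
  obtain ⟨is, es⟩ := H.integral_gradTerm s q
  obtain ⟨it, et⟩ := H.integral_gradTerm t q
  -- For fixed `q` the integral over two independent directions factors into the inner product of
  -- the two smoothed gradients, whose norms are free of `n / μ`.
  have e : ∫ v, inner ℝ (gradTerm p f g s q (v.1 : Metric.sphere (0 : Euc n) 1))
      (gradTerm p f g t q (v.2 : Metric.sphere (0 : Euc n) 1))
        ∂(uniformSphere n).prod (uniformSphere n) =
      inner ℝ (smoothGrad p.μ (lagrangian f g s q.2) q.1)
        (smoothGrad p.μ (lagrangian f g t q.2) q.1) := by
    have hf : ∀ t, Continuous (f t) := fun t => (H.f_lip t).continuous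
    have hg : ∀ t, Continuous (g t) := fun t => (H.g_lip t).continuous
    rw [integral_prod]
    · simp only
      have : ∀ v : Metric.sphere (0 : Euc n) 1, ∫ w : Metric.sphere (0 : Euc n) 1,
          inner ℝ (gradTerm p f g s q v) (gradTerm p f g t q w) ∂uniformSphere n =
          inner ℝ (smoothGrad p.μ (lagrangian f g t q.2) q.1) (gradTerm p f g s q v) := fun v => by
        rw [integral_inner it, et, real_inner_comm]
      simp only [this]
      rw [integral_inner is, es, real_inner_comm]
    · have hcont : Continuous fun v : Metric.sphere (0 : Euc n) 1 × Metric.sphere (0 : Euc n) 1 =>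
          inner ℝ (gradTerm p f g s q v.1) (gradTerm p f g t q v.2) := by
        have := hf s
        have := hf t
        have := hg s
        have := hg t
        unfold gradTerm lagrangian
        fun_prop
      exact hcont.integrable_of_hasCompactSupport (HasCompactSupport.of_compactSpace _)
  simp only
  rw [e]
  refine (real_inner_le_norm _ _).trans ?_
  have := mul_le_mul (H.norm_smoothGrad_lagrangian_le s hq0 q.1)
    (H.norm_smoothGrad_lagrangian_le t hq0 q.1) (norm_nonneg _)
    (mul_nonneg H.M_pos.le (by linarith))
  linarith

/-- The second moment of the gradient estimate of a block. -/
theorem integral_rGrad_sq_le (hum : ∀ t, Measurable (u t))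
    (hlaw : ∀ t < p.K * p.K, P.map (u t) = uniformSphere n)
    (hind : iIndepFun (fun t : Fin (p.K * p.K) => u t) P) {m : ℕ} (hm : m < p.K) :
    ∫ ω, ‖rGrad p lo f g x₁ u m ω‖ ^ 2 ∂P ≤
      M ^ 2 * (p.K * (n / p.μ) ^ 2 + p.K ^ 2) * ∫ ω, (1 + (rPair p lo f g x₁ u m ω).2) ^ 2 ∂P := by
  set E := ∫ ω, (1 + (rPair p lo f g x₁ u m ω).2) ^ 2 ∂P with hE
  have hE0 : 0 ≤ E := integral_nonneg fun ω => sq_nonneg _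
  have hint : ∀ s t : ℕ, Integrable (fun ω =>
      inner ℝ (gradTerm p f g s (rPair p lo f g x₁ u m ω) (u s ω))
        (gradTerm p f g t (rPair p lo f g x₁ u m ω) (u t ω))) P := fun s t =>
    integrable_of_measurable_of_abs_le (Measurable.inner (𝕜 := ℝ)
      (H.measurable_gradTerm_rPair hum m s) (H.measurable_gradTerm_rPair hum m t))
      (B := (n / p.μ * (M * (1 + lamBound p M m))) * (n / p.μ * (M * (1 + lamBound p M m))))
      fun ω => (abs_real_inner_le_norm _ _).trans (mul_le_mul
        (H.norm_gradTerm_rPair_le_const u m s ω) (H.norm_gradTerm_rPair_le_const u m t ω)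
        (norm_nonneg _) ((norm_nonneg _).trans (H.norm_gradTerm_rPair_le_const u m s ω)))
  have hexp : ∀ ω, ‖rGrad p lo f g x₁ u m ω‖ ^ 2 = ∑ s ∈ block p.K m, ∑ t ∈ block p.K m,
      inner ℝ (gradTerm p f g s (rPair p lo f g x₁ u m ω) (u s ω))
        (gradTerm p f g t (rPair p lo f g x₁ u m ω) (u t ω)) := fun ω => by
    rw [← real_inner_self_eq_norm_sq, rGrad_eq, sum_inner]
    simp only [inner_sum]
  simp only [hexp]
  rw [integral_finsetSum _ fun s _ => integrable_finsetSum _ fun t _ => hint s t]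
  simp only [integral_finsetSum _ fun t _ => hint _ t]
  -- The off-diagonal bound is also granted to the diagonal entries, which turns `K(K - 1)` into
  -- `K²`.
  have hterm : ∀ s ∈ block p.K m, ∀ t ∈ block p.K m,
      ∫ ω, inner ℝ (gradTerm p f g s (rPair p lo f g x₁ u m ω) (u s ω))
        (gradTerm p f g t (rPair p lo f g x₁ u m ω) (u t ω)) ∂P ≤
      (if s = t then M ^ 2 * (n / p.μ) ^ 2 * E else 0) + M ^ 2 * E := by
    intro s hs t ht
    by_cases hst : s = t
    · subst hst
      have : ∫ ω, inner ℝ (gradTerm p f g s (rPair p lo f g x₁ u m ω) (u s ω))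
          (gradTerm p f g s (rPair p lo f g x₁ u m ω) (u s ω)) ∂P ≤ M ^ 2 * (n / p.μ) ^ 2 * E := by
        rw [hE, ← integral_const_mul]
        refine integral_mono (hint s s) ((H.integrable_one_add_sq hum m).const_mul _) fun ω => ?_
        have h1 := H.norm_gradTerm_rPair_le u m s ω
        have h2 := pow_le_pow_left₀ (norm_nonneg _) h1 2
        simp only [real_inner_self_eq_norm_sq]
        refine h2.trans (le_of_eq ?_)
        ring
      rw [if_pos rfl]
      have : 0 ≤ M ^ 2 * E := mul_nonneg (sq_nonneg _) hE0
      linarith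
    · rw [if_neg hst, zero_add]
      exact H.integral_inner_gradTerm_le hum hlaw hind hm hs ht hst
  refine (Finset.sum_le_sum fun s hs => Finset.sum_le_sum (hterm s hs)).trans (le_of_eq ?_)
  simp only [Finset.sum_add_distrib, Finset.sum_ite_eq, Finset.sum_const, card_block, nsmul_eq_mul]
  rw [Finset.sum_congr rfl fun s hs => if_pos hs, Finset.sum_const, card_block, nsmul_eq_mul]
  ring

theorem integrable_inner_rGrad (hum : ∀ t, Measurable (u t)) (m : ℕ) {z : Euc n}
    (hz : z ∈ shrunk p S) :
    Integrable (fun ω => inner ℝ (rGrad p lo f g x₁ u m ω) ((rPair p lo f g x₁ u m ω).1 - z)) P := by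
  refine integrable_of_measurable_of_abs_le (Measurable.inner (𝕜 := ℝ) (H.measurable_rGrad hum m)
    ((H.measurable_rPair hum m).fst.sub_const z))
    (B := (p.K * (n / p.μ * (M * (1 + lamBound p M m)))) * (2 * p.R)) fun ω => ?_
  exact (abs_real_inner_le_norm _ _).trans (mul_le_mul (H.norm_rGrad_le u m ω)
    (H.diam_shrunk _ (H.rPair_fst_mem u m ω) _ hz) (norm_nonneg _)
    ((norm_nonneg _).trans (H.norm_rGrad_le u m ω)))

variable (f g M p) in
omit H in
/-- The loss of a block against `z`, corrected by the smoothing error. -/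
noncomputable def blockGap (m : ℕ) (z : Euc n) (q : Euc n × ℝ) : ℝ :=
  ∑ t ∈ block p.K m, (lagrangian f g t q.2 q.1 - lagrangian f g t q.2 z - 2 * M * p.μ * (1 + q.2))

theorem integrable_gap (hum : ∀ t, Measurable (u t)) (m t : ℕ) {z : Euc n}
    (hz : z ∈ shrunk p S) : Integrable (fun ω =>
      lagrangian f g t (rPair p lo f g x₁ u m ω).2 (rPair p lo f g x₁ u m ω).1
        - lagrangian f g t (rPair p lo f g x₁ u m ω).2 z
        - 2 * M * p.μ * (1 + (rPair p lo f g x₁ u m ω).2)) P := by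
  have hf := (H.f_lip t).continuous.measurable
  have hg := (H.g_lip t).continuous.measurable
  have hq := H.measurable_rPair hum m
  have hq1 := hq.fst
  have hq2 := hq.snd
  refine integrable_of_measurable_of_abs_le (by unfold lagrangian; fun_prop)
    (B := M * (1 + lamBound p M m) + M * (1 + lamBound p M m)
      + 2 * M * p.μ * (1 + lamBound p M m)) fun ω => ?_
  have hl0 := rPair_snd_nonneg (p := p) (lo := lo) (f := f) (g := g) (x₁ := x₁) u m ω
  have hl1 := H.rPair_snd_le u m ω
  have h1 := H.abs_lagrangian_le t hl0 (H.shrunk_subset (H.rPair_fst_mem u m ω))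
  have h2 := H.abs_lagrangian_le t hl0 (H.shrunk_subset hz)
  have hM := H.M_pos
  have hμ := H.μ_pos
  have h3 : M * (1 + (rPair p lo f g x₁ u m ω).2) ≤ M * (1 + lamBound p M m) := by gcongr
  have h4 : 2 * M * p.μ * (1 + (rPair p lo f g x₁ u m ω).2) ≤
      2 * M * p.μ * (1 + lamBound p M m) := by gcongr
  have h5 : 0 ≤ 2 * M * p.μ * (1 + (rPair p lo f g x₁ u m ω).2) := by positivity
  rw [abs_le] at h1 h2 ⊢
  constructor <;> linarith

theorem integrable_blockGap (hum : ∀ t, Measurable (u t)) (m : ℕ) {z : Euc n}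
    (hz : z ∈ shrunk p S) :
    Integrable (fun ω => blockGap p f g M m z (rPair p lo f g x₁ u m ω)) P :=
  integrable_finsetSum _ fun t _ => H.integrable_gap hum m t hz

/-- The gradient estimate is, in expectation, a subgradient up to the smoothing error. -/
theorem integral_blockGap_le (hum : ∀ t, Measurable (u t))
    (hlaw : ∀ t < p.K * p.K, P.map (u t) = uniformSphere n)
    (hind : iIndepFun (fun t : Fin (p.K * p.K) => u t) P) {m : ℕ} (hm : m < p.K) {z : Euc n}
    (hz : z ∈ shrunk p S) :
    ∫ ω, blockGap p f g M m z (rPair p lo f g x₁ u m ω) ∂P ≤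
      ∫ ω, inner ℝ (rGrad p lo f g x₁ u m ω) ((rPair p lo f g x₁ u m ω).1 - z) ∂P := by
  have := isProbabilityMeasure_uniformSphere H.n_pos
  have hT : (m + 1) * p.K ≤ p.K * p.K := by gcongr; omega
  have hint : ∀ t, Integrable (fun ω =>
      inner ℝ (gradTerm p f g t (rPair p lo f g x₁ u m ω) (u t ω))
        ((rPair p lo f g x₁ u m ω).1 - z)) P := fun t =>
    integrable_of_measurable_of_abs_le (Measurable.inner (𝕜 := ℝ)
      (H.measurable_gradTerm_rPair hum m t) ((H.measurable_rPair hum m).fst.sub_const z))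
      (B := (n / p.μ * (M * (1 + lamBound p M m))) * (2 * p.R))
      fun ω => (abs_real_inner_le_norm _ _).trans (mul_le_mul
        (H.norm_gradTerm_rPair_le_const u m t ω)
        (H.diam_shrunk _ (H.rPair_fst_mem u m ω) _ hz)
        (norm_nonneg _) ((norm_nonneg _).trans (H.norm_gradTerm_rPair_le_const u m t ω)))
  simp only [rGrad_eq, sum_inner, blockGap]
  rw [integral_finsetSum _ fun t _ => hint t,
    integral_finsetSum _ fun t _ => H.integrable_gap hum m t hz]
  refine Finset.sum_le_sum fun t ht => ?_
  have htT := (Finset.mem_Ico.1 ht).2.trans_le hT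
  -- Independence from the pair `(u_t, u_t)`, projected to one component, is independence from
  -- `u_t`.
  obtain ⟨h1, h2⟩ := ((H.indepFun_rPair hum hind hm ht ht).comp measurable_id
      measurable_fst).integral_comp_prod (H.measurable_rPair hum m) (hum t) (hlaw t htT)
    (Φ := fun r => inner ℝ (gradTerm p f g t r.1 r.2) (r.1.1 - z))
    (Measurable.inner (𝕜 := ℝ)
      (H.measurable_gradTerm t measurable_fst (measurable_subtype_coe.comp measurable_snd))
      (measurable_fst.fst.sub_const z)) (hint t)
  refine (integral_mono (H.integrable_gap hum m t hz) h1 fun ω => ?_).trans_eq h2.symm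
  obtain ⟨it, et⟩ := H.integral_gradTerm t (rPair p lo f g x₁ u m ω)
  have e : ∫ v : Metric.sphere (0 : Euc n) 1, inner ℝ (gradTerm p f g t (rPair p lo f g x₁ u m ω) v)
      ((rPair p lo f g x₁ u m ω).1 - z) ∂uniformSphere n =
      inner ℝ (smoothGrad p.μ (lagrangian f g t (rPair p lo f g x₁ u m ω).2)
        (rPair p lo f g x₁ u m ω).1) ((rPair p lo f g x₁ u m ω).1 - z) := by
    rw [real_inner_comm, ← et, ← integral_inner it]
    exact integral_congr_ae (ae_of_all _ fun v => real_inner_comm _ _)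
  refine le_trans ?_ e.ge
  exact H.le_inner_smoothGrad_lagrangian t (rPair_snd_nonneg u m ω) (H.rPair_fst_mem u m ω) hz

end BanditInstance

/-! ### The primal-dual inequality, per block and in expectation. -/

/-- The arithmetic of the primal-dual inequality of a block: `N` is the norm of the gradient estimate,
`Y` and `Z` are the decrease of the squared primal and dual distance. -/
theorem primal_dual_arith {η b q c E A B N ip gap lam l Y Z k : ℝ} (hη : 0 < η) (hb : 0 < b)
    (hq : 0 ≤ q) (hE : 0 ≤ E) (hprim : 2 * η * ip ≤ Y + η ^ 2 * N ^ 2 + 2 * η * q * N)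
    (hdual : 2 * η * ((l - lam) * A) ≤
      Z + η * c * (l ^ 2 - lam ^ 2) + η ^ 2 * (k ^ 2 + (c * lam) ^ 2))
    (hplay : B + lam * A ≤ gap + E * (1 + lam))
    (hδ : η * b ^ 2 + q * b + E ≤ c / 2 * (1 - η * c)) :
    B + l * A ≤ (Y + Z) / (2 * η) + (gap - ip)
      + (η / 2 + q / (2 * b)) * (N ^ 2 - b ^ 2 * (1 + lam) ^ 2)
      + (η * b ^ 2 + 3 / 2 * (q * b) + 2 * E + η / 2 * k ^ 2) + c / 2 * l ^ 2 := by
  have hdiv : ∀ a b : ℝ, 2 * η * a ≤ b → a ≤ b / (2 * η) := fun a b h => by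
    rw [le_div_iff₀ (by positivity)]; linarith
  have h1 := hdiv _ _ hprim
  have h2 := hdiv _ _ hdual
  have e1 : (Y + η ^ 2 * N ^ 2 + 2 * η * q * N) / (2 * η) =
      Y / (2 * η) + η / 2 * N ^ 2 + q * N := by field_simp
  have e2 : (Z + η * c * (l ^ 2 - lam ^ 2) + η ^ 2 * (k ^ 2 + (c * lam) ^ 2)) / (2 * η) =
      Z / (2 * η) + c / 2 * (l ^ 2 - lam ^ 2) + η / 2 * (k ^ 2 + (c * lam) ^ 2) := by
    field_simp
  rw [e1] at h1
  rw [e2] at h2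
  -- The norm is traded for its square, since only the second moment is controlled; the weight `b`
  -- balances the two terms at the expected size of `N`.
  have h3 : q * N ≤ q / (2 * b) * N ^ 2 + q * b / 2 := by
    have e : q / (2 * b) * N ^ 2 + q * b / 2 - q * N = q / (2 * b) * (N - b) ^ 2 := by
      field_simp; ring
    have : 0 ≤ q / (2 * b) * (N - b) ^ 2 := by positivity
    linarith
  have e4 : (η / 2 + q / (2 * b)) * (b ^ 2 * (1 + lam) ^ 2) =
      (η * b ^ 2 + q * b) / 2 * (1 + lam) ^ 2 := by field_simp
  have hW0 : 0 ≤ η * b ^ 2 + q * b := by positivity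
  rw [add_div, mul_sub, e4]
  generalize hW : η * b ^ 2 + q * b = W at *
  have h4 : W / 2 * (1 + lam) ^ 2 ≤ W + W * lam ^ 2 := by
    nlinarith [mul_nonneg hW0 (sq_nonneg (1 - lam))]
  have h5 : E * (1 + lam) ≤ 2 * E + E * lam ^ 2 := by
    nlinarith [mul_nonneg hE (sq_nonneg (1 / 2 - lam))]
  -- All terms in `λ²` are gathered here: `hδ` says exactly that the regularization outweighs them.
  have h6 := mul_le_mul_of_nonneg_right hδ (sq_nonneg lam)
  linarith

namespace BanditInstance

variable {n : ℕ} {p : BanditParams} {S : Set (Euc n)} {lo : Euc n → Euc n}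
  {f g : ℕ → Euc n → ℝ} {x₁ : Euc n} {M : ℝ} (H : BanditInstance p S lo f g x₁ M)

variable (p M) in
/-- The error per round of smoothing, of perturbing the played points, and of shrinking the set. -/
noncomputable def roundError : ℝ := M * p.μ * (3 + p.R / p.r)

variable (p M) in
/-- The error per block if the gradient estimate of the block has second moment at most `b²`. -/
noncomputable def blockError (b : ℝ) : ℝ :=
  p.η * b ^ 2 + 3 / 2 * (√(3 * p.ε) * b) + 2 * (p.K * roundError p M) + p.η / 2 * (p.K * M) ^ 2

variable (p) in
/-- The squared distances of the iterates from `z` and `l`. -/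
noncomputable def potential (z : Euc n) (l : ℝ) (s : BanditState n) : ℝ :=
  ‖s.y - z‖ ^ 2 + (s.lam - l) ^ 2

include H

theorem roundError_nonneg : 0 ≤ roundError p M :=
  mul_nonneg (mul_nonneg H.M_pos.le H.μ_pos.le)
    (add_nonneg (by norm_num) (div_nonneg H.R_pos.le H.r_pos.le))

omit H in
theorem shrink_mem {x : Euc n} (hx : x ∈ S) : (1 - p.μ / p.r) • x ∈ shrunk p S := ⟨x, hx, rfl⟩

/-- The loss of a block at the played points, in terms of the loss at the iterate. -/
theorem sum_played_le (m : ℕ) {u : ℕ → Euc n} (hu : ∀ t, ‖u t‖ ≤ 1) {x xs : Euc n} {l : ℝ}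
    (hl : 0 ≤ l) (hxs : xs ∈ S) (hfeas : ∀ t ∈ block p.K m, g t xs ≤ 0) :
    ∑ t ∈ block p.K m, (f t (x + p.μ • u t) - f t xs + l * max (g t (x + p.μ • u t)) 0) ≤
      blockGap p f g M m ((1 - p.μ / p.r) • xs) (x, l) + p.K * roundError p M * (1 + l) := by
  have hc : p.K * roundError p M * (1 + l) = ∑ t ∈ block p.K m, roundError p M * (1 + l) := by
    rw [Finset.sum_const, card_block, nsmul_eq_mul, mul_assoc]
  rw [hc, blockGap, ← Finset.sum_add_distrib]
  refine Finset.sum_le_sum fun t ht => ?_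
  have hn1 : M * ‖x + p.μ • u t - x‖ ≤ M * p.μ := by
    rw [add_sub_cancel_left, norm_smul, Real.norm_of_nonneg H.μ_pos.le]
    exact mul_le_mul_of_nonneg_left (mul_le_of_le_one_right H.μ_pos.le (hu t)) H.M_pos.le
  have hn2 : M * ‖(1 - p.μ / p.r) • xs - xs‖ ≤ M * p.μ * (p.R / p.r) := by
    have e : (1 - p.μ / p.r) • xs - xs = -((p.μ / p.r) • xs) := by module
    rw [e, norm_neg, norm_smul, Real.norm_of_nonneg H.ratio_pos.le]
    have := mul_le_mul_of_nonneg_left (H.norm_le_of_mem hxs)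
      (mul_nonneg H.M_pos.le H.ratio_pos.le)
    calc _ = M * (p.μ / p.r) * ‖xs‖ := by ring
      _ ≤ _ := this
      _ = _ := by ring
  have h1 := (H.f_sub_le t (x + p.μ • u t) x).trans hn1
  have h2 := (H.max_g_sub_le t (x + p.μ • u t) x).trans hn1
  have h3 := (H.f_sub_le t ((1 - p.μ / p.r) • xs) xs).trans hn2
  have h4 := (H.max_g_sub_le t ((1 - p.μ / p.r) • xs) xs).trans hn2
  rw [max_eq_right (hfeas t ht)] at h4
  have h5 := mul_le_mul_of_nonneg_left h2 hl
  have h6 := mul_le_mul_of_nonneg_left h4 hl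
  simp only [lagrangian, roundError]
  linarith

/-- The primal-dual inequality of a block. -/
theorem block_le (m : ℕ) {u : ℕ → Euc n} (hu : ∀ t, ‖u t‖ ≤ 1) {xs : Euc n} {l b : ℝ}
    (hl : 0 ≤ l) (hb : 0 < b) (hxs : xs ∈ S) (hfeas : ∀ t ∈ block p.K m, g t xs ≤ 0)
    (hδ : p.η * b ^ 2 + √(3 * p.ε) * b + p.K * roundError p M ≤
      p.K * p.δ * p.η / 2 * (1 - p.η * (p.K * p.δ * p.η))) :
    ∑ t ∈ block p.K m, (f t ((banditState p lo f g x₁ u m).x + p.μ • u t) - f t xs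
        + l * max (g t ((banditState p lo f g x₁ u m).x + p.μ • u t)) 0) ≤
      (potential ((1 - p.μ / p.r) • xs) l (banditState p lo f g x₁ u m)
          - potential ((1 - p.μ / p.r) • xs) l (banditState p lo f g x₁ u (m + 1))) / (2 * p.η)
        + (blockGap p f g M m ((1 - p.μ / p.r) • xs)
            ((banditState p lo f g x₁ u m).x, (banditState p lo f g x₁ u m).lam)
          - inner ℝ (gradX p f g u m (banditState p lo f g x₁ u m))
            ((banditState p lo f g x₁ u m).x - (1 - p.μ / p.r) • xs))
        + (p.η / 2 + √(3 * p.ε) / (2 * b)) *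
          (‖gradX p f g u m (banditState p lo f g x₁ u m)‖ ^ 2
            - b ^ 2 * (1 + (banditState p lo f g x₁ u m).lam) ^ 2)
        + blockError p M b + p.K * p.δ * p.η / 2 * l ^ 2 := by
  have hη := H.η_pos
  have hz := shrink_mem (p := p) hxs
  have hprim := H.primal_step u m hz
  have hdual := H.dual_step hu m hl
  have hplay := H.sum_played_le m hu (x := (banditState p lo f g x₁ u m).x)
    (lam_nonneg (p := p) (lo := lo) (f := f) (g := g) (x₁ := x₁) u m) hxs hfeas
  have es : ∀ a : ℝ, ∑ t ∈ block p.K m, (f t ((banditState p lo f g x₁ u m).x + p.μ • u t) - f t xs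
      + a * max (g t ((banditState p lo f g x₁ u m).x + p.μ • u t)) 0) =
      ∑ t ∈ block p.K m, (f t ((banditState p lo f g x₁ u m).x + p.μ • u t) - f t xs) +
      a * ∑ t ∈ block p.K m, max (g t ((banditState p lo f g x₁ u m).x + p.μ • u t)) 0 :=
    fun a => by rw [Finset.sum_add_distrib, ← Finset.mul_sum]
  rw [es] at hplay ⊢
  refine (primal_dual_arith hη hb (Real.sqrt_nonneg _)
    (mul_nonneg (Nat.cast_nonneg _) H.roundError_nonneg) hprim hdual hplay hδ).trans (le_of_eq ?_)
  unfold potential blockError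
  ring

variable {Ω : Type*} [MeasurableSpace Ω] {P : Measure Ω} [IsProbabilityMeasure P]
  {u : ℕ → Ω → Metric.sphere (0 : Euc n) 1}

variable (u) in
omit [MeasurableSpace Ω] in
theorem rPlayed_mem (t : ℕ) (ω : Ω) :
    played p lo f g x₁ (fun s => (u s ω : Euc n)) t ∈ S :=
  H.played_mem (fun t => norm_sample_le t ω) t

theorem measurable_rPlayed (hum : ∀ t, Measurable (u t)) (t : ℕ) :
    Measurable fun ω => played p lo f g x₁ (fun s => (u s ω : Euc n)) t :=
  (H.measurable_rState hum _).1.add ((measurable_subtype_coe.comp (hum t)).const_smul p.μ)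

theorem integrable_f_played (hum : ∀ t, Measurable (u t)) (t : ℕ) :
    Integrable (fun ω => f t (played p lo f g x₁ (fun s => (u s ω : Euc n)) t)) P :=
  integrable_of_measurable_of_abs_le
    ((H.f_lip t).continuous.measurable.comp (H.measurable_rPlayed hum t))
    fun ω => H.f_bdd t _ (H.rPlayed_mem u t ω)

theorem integrable_max_g_played (hum : ∀ t, Measurable (u t)) (t : ℕ) :
    Integrable (fun ω => max (g t (played p lo f g x₁ (fun s => (u s ω : Euc n)) t)) 0) P :=
  integrable_of_measurable_of_abs_le
    (((H.g_lip t).continuous.measurable.comp (H.measurable_rPlayed hum t)).max measurable_const)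
    fun ω => by
      rw [abs_of_nonneg (le_max_right _ _)]
      exact H.max_g_bdd t (H.rPlayed_mem u t ω)

/-- The primal-dual inequality in expectation. -/
theorem regret_add_mul_violation_le (hum : ∀ t, Measurable (u t))
    (hlaw : ∀ t < p.K * p.K, P.map (u t) = uniformSphere n)
    (hind : iIndepFun (fun t : Fin (p.K * p.K) => u t) P) {xs : Euc n} {l b : ℝ}
    (hl : 0 ≤ l) (hb : 0 < b) (hxs : xs ∈ S) (hfeas : ∀ t < p.K * p.K, g t xs ≤ 0)
    (hb2 : M ^ 2 * (p.K * (n / p.μ) ^ 2 + p.K ^ 2) ≤ b ^ 2)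
    (hδ : p.η * b ^ 2 + √(3 * p.ε) * b + p.K * roundError p M ≤
      p.K * p.δ * p.η / 2 * (1 - p.η * (p.K * p.δ * p.η))) :
    (∫ ω, ∑ t ∈ Finset.range (p.K * p.K),
        f t (played p lo f g x₁ (fun s => (u s ω : Euc n)) t) ∂P)
      - ∑ t ∈ Finset.range (p.K * p.K), f t xs
      + l * ∫ ω, ∑ t ∈ Finset.range (p.K * p.K),
        max (g t (played p lo f g x₁ (fun s => (u s ω : Euc n)) t)) 0 ∂P ≤
      (4 * p.R ^ 2 + l ^ 2) / (2 * p.η)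
        + p.K * (blockError p M b + p.K * p.δ * p.η / 2 * l ^ 2) := by
  set z := (1 - p.μ / p.r) • xs with hzdef
  have hz : z ∈ shrunk p S := shrink_mem hxs
  set w := p.η / 2 + √(3 * p.ε) / (2 * b) with hw
  have hw0 : 0 ≤ w := by
    have := H.η_pos
    positivity
  -- The stochastic remainder of a block. Its expectation is nonpositive by the approximate
  -- subgradient property and by the second moment bound.
  set D : ℕ → Ω → ℝ := fun m ω =>
    (blockGap p f g M m z (rPair p lo f g x₁ u m ω)
      - inner ℝ (rGrad p lo f g x₁ u m ω) ((rPair p lo f g x₁ u m ω).1 - z))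
    + w * (‖rGrad p lo f g x₁ u m ω‖ ^ 2 - b ^ 2 * (1 + (rPair p lo f g x₁ u m ω).2) ^ 2) with hD
  have i1 : ∀ m, Integrable (fun ω => blockGap p f g M m z (rPair p lo f g x₁ u m ω)) P :=
    fun m => H.integrable_blockGap hum m hz
  have i2 : ∀ m, Integrable (fun ω =>
      inner ℝ (rGrad p lo f g x₁ u m ω) ((rPair p lo f g x₁ u m ω).1 - z)) P :=
    fun m => H.integrable_inner_rGrad hum m hz
  have i3 : ∀ m, Integrable (fun ω => ‖rGrad p lo f g x₁ u m ω‖ ^ 2) P :=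
    fun m => H.integrable_rGrad_sq hum m
  have i4 : ∀ m, Integrable (fun ω => b ^ 2 * (1 + (rPair p lo f g x₁ u m ω).2) ^ 2) P :=
    fun m => (H.integrable_one_add_sq hum m).const_mul _
  have i12 : ∀ m, Integrable (fun ω => blockGap p f g M m z (rPair p lo f g x₁ u m ω) -
      inner ℝ (rGrad p lo f g x₁ u m ω) ((rPair p lo f g x₁ u m ω).1 - z)) P :=
    fun m => (i1 m).sub (i2 m)
  have i34 : ∀ m, Integrable (fun ω => w * (‖rGrad p lo f g x₁ u m ω‖ ^ 2
      - b ^ 2 * (1 + (rPair p lo f g x₁ u m ω).2) ^ 2)) P :=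
    fun m => ((i3 m).sub (i4 m)).const_mul w
  have iD : ∀ m, Integrable (D m) P := fun m => (i12 m).add (i34 m)
  have hDle : ∀ m < p.K, ∫ ω, D m ω ∂P ≤ 0 := fun m hm => by
    simp only [hD]
    rw [integral_add (i12 m) (i34 m),
      integral_sub (i1 m) (i2 m), integral_const_mul, integral_sub (i3 m) (i4 m),
      integral_const_mul]
    have h1 := H.integral_blockGap_le hum hlaw hind hm hz
    have h2 := H.integral_rGrad_sq_le hum hlaw hind hm
    have h3 : 0 ≤ ∫ ω, (1 + (rPair p lo f g x₁ u m ω).2) ^ 2 ∂P :=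
      integral_nonneg fun ω => sq_nonneg _
    have h4 := mul_le_mul_of_nonneg_right hb2 h3
    have h5 := mul_nonneg hw0 (sub_nonneg.2 (h2.trans h4))
    linarith
  have hpath : ∀ ω, ∑ t ∈ Finset.range (p.K * p.K),
        (f t (played p lo f g x₁ (fun s => (u s ω : Euc n)) t) - f t xs
          + l * max (g t (played p lo f g x₁ (fun s => (u s ω : Euc n)) t)) 0) ≤
      ((4 * p.R ^ 2 + l ^ 2) / (2 * p.η)
        + p.K * (blockError p M b + p.K * p.δ * p.η / 2 * l ^ 2))
        + ∑ m ∈ Finset.range p.K, D m ω := fun ω => by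
    rw [← sum_blocks]
    have hblk : ∀ m ∈ Finset.range p.K, ∑ t ∈ block p.K m,
        (f t (played p lo f g x₁ (fun s => (u s ω : Euc n)) t) - f t xs
          + l * max (g t (played p lo f g x₁ (fun s => (u s ω : Euc n)) t)) 0) ≤
        (potential z l (rState p lo f g x₁ u m ω) / (2 * p.η)
          - potential z l (rState p lo f g x₁ u (m + 1) ω) / (2 * p.η))
        + (blockError p M b + p.K * p.δ * p.η / 2 * l ^ 2) + D m ω := fun m hm => by
      have hT : (m + 1) * p.K ≤ p.K * p.K := by
        have := Finset.mem_range.1 hm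
        gcongr; omega
      have := H.block_le m (u := fun s => (u s ω : Euc n)) (fun t => norm_sample_le t ω) hl hb hxs
        (fun t ht => hfeas t ((Finset.mem_Ico.1 ht).2.trans_le hT)) hδ
      have e : ∀ t ∈ block p.K m, played p lo f g x₁ (fun s => (u s ω : Euc n)) t =
          (rState p lo f g x₁ u m ω).x + p.μ • (u t ω : Euc n) := fun t ht => by
        obtain ⟨h1, h2⟩ := Finset.mem_Ico.1 ht
        rw [played, Nat.div_eq_of_lt_le h1 h2]
      rw [Finset.sum_congr rfl fun t ht => by rw [e t ht]]
      refine this.trans (le_of_eq ?_)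
      simp only [hD, rGrad, rPair, rState, hzdef, hw]
      ring
    refine (Finset.sum_le_sum hblk).trans ?_
    rw [Finset.sum_add_distrib, Finset.sum_add_distrib, Finset.sum_range_sub', Finset.sum_const,
      Finset.card_range, nsmul_eq_mul]
    -- After telescoping only the initial potential matters: the start is within `2R` of `z`, and
    -- the dual variable starts at `0`.
    have h0 : potential z l (rState p lo f g x₁ u 0 ω) ≤ 4 * p.R ^ 2 + l ^ 2 := by
      have h1 := H.norm_y_sub_le (fun s => (u s ω : Euc n)) 0 hz
      have h2 : ‖(rState p lo f g x₁ u 0 ω).y - z‖ ^ 2 ≤ (2 * p.R) ^ 2 := by gcongr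
      have h3 : (rState p lo f g x₁ u 0 ω).lam = 0 := rfl
      rw [potential, h3]
      linarith
    have h1 : potential z l (rState p lo f g x₁ u 0 ω) / (2 * p.η) ≤
        (4 * p.R ^ 2 + l ^ 2) / (2 * p.η) :=
      div_le_div_of_nonneg_right h0 (mul_nonneg zero_le_two H.η_pos.le)
    have h2 : 0 ≤ potential z l (rState p lo f g x₁ u p.K ω) / (2 * p.η) :=
      div_nonneg (by unfold potential; positivity) (mul_nonneg zero_le_two H.η_pos.le)
    linarith
  have iF := integrable_finsetSum (Finset.range (p.K * p.K)) fun t _ =>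
    H.integrable_f_played (P := P) hum t
  have iG := integrable_finsetSum (Finset.range (p.K * p.K)) fun t _ =>
    H.integrable_max_g_played (P := P) hum t
  have iS := integrable_finsetSum (Finset.range p.K) fun m _ => iD m
  have iF' : Integrable (fun ω => ∑ t ∈ Finset.range (p.K * p.K),
      f t (played p lo f g x₁ (fun s => (u s ω : Euc n)) t)
        - ∑ t ∈ Finset.range (p.K * p.K), f t xs) P := iF.sub (integrable_const _)
  have hfin := integral_mono (μ := P) (iF'.add (iG.const_mul l))
    ((integrable_const _).add iS) (fun ω => by
      have := hpath ω
      rw [Finset.sum_add_distrib, Finset.sum_sub_distrib, ← Finset.mul_sum] at this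
      exact this)
  simp only [Pi.add_apply] at hfin
  rw [integral_add iF' (iG.const_mul l),
    integral_sub iF (integrable_const _), integral_const_mul, integral_const,
    integral_add (integrable_const _) iS, integral_const, integral_finsetSum _ fun m _ => iD m,
    probReal_univ, one_smul, one_smul] at hfin
  have := Finset.sum_nonpos fun m hm => hDle m (Finset.mem_range.1 hm)
  linarith

end BanditInstance

/-! ### Numerical inequalities behind the parameters, with `a = √n`, `ρ = √r`, `x = T^{1/4}`, `ℓ =
√(log T)`, `s = √183`. -/

section Arithmetic

/-- The chosen dual regularization absorbs the terms that are quadratic in the dual variable. -/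
theorem regularization_le {a ρ R M x ℓ B s : ℝ} (ha : 1 ≤ a) (hρ : 0 < ρ) (hR : ρ ^ 2 ≤ R)
    (hM : 0 < M) (hx : 0 < x) (hℓ : 1 ≤ ℓ) (hs : 2 ≤ s) (h1 : a * R / ρ ^ 2 ≤ B)
    (h2 : a * R / ρ ≤ B) (h3 : R ≤ B) (hxl : 48 * s * R * B * ℓ ≤ a * x ^ 2) :
    R / (a * M * x ^ 3) * (M * x ^ 2 * (a / ρ + 1)) ^ 2
      + s * R * ℓ / x * (M * x ^ 2 * (a / ρ + 1))
      + x ^ 2 * (M * (a * ρ / x) * (3 + R / ρ ^ 2)) ≤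
    24 * s * M * B * x * ℓ / 2 * (1 - R / (a * M * x ^ 3) * (24 * s * M * B * x * ℓ)) := by
  have hR0 : 0 < R := lt_of_lt_of_le (by positivity) hR
  have hB0 : 0 < B := hR0.trans_le h3
  have ha0 : 0 < a := by linarith
  have e1 : R / (a * M * x ^ 3) * (M * x ^ 2 * (a / ρ + 1)) ^ 2 =
      M * x * (a * R / ρ ^ 2 + 2 * (R / ρ) + R / a) := by
    field_simp
    ring
  have e2 : s * R * ℓ / x * (M * x ^ 2 * (a / ρ + 1)) = s * (M * x * ℓ) * (a * R / ρ + R) := by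
    field_simp
  have e3 : x ^ 2 * (M * (a * ρ / x) * (3 + R / ρ ^ 2)) = M * x * (3 * (a * ρ) + a * R / ρ) := by
    field_simp
  have e4 : R / (a * M * x ^ 3) * (24 * s * M * B * x * ℓ) =
      24 * s * R * B * ℓ / (a * x ^ 2) := by field_simp
  have h4 : R / a ≤ B := (div_le_self hR0.le ha).trans h3
  have h5 : R / ρ ≤ a * R / ρ := by
    rw [mul_div_assoc]; exact le_mul_of_one_le_left (by positivity) ha
  have h6 : a * ρ ≤ a * R / ρ := by
    rw [le_div_iff₀ hρ]; nlinarith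
  -- So `ηc ≤ 1/2`, and the right-hand side is at least `6 s M B x ℓ`. The left-hand side is at most
  -- `(8 + 2s) M B x ℓ`, and `8 ≤ 4s`; this is the origin of the factor 24.
  have h7 : 24 * s * R * B * ℓ / (a * x ^ 2) ≤ 1 / 2 := by
    rw [div_le_iff₀ (by positivity)]; linarith
  rw [e1, e2, e3, e4]
  have h8 : M * x * (a * R / ρ ^ 2 + 2 * (R / ρ) + R / a) ≤ M * x * (4 * B) := by gcongr; linarith
  have h9 : s * (M * x * ℓ) * (a * R / ρ + R) ≤ s * (M * x * ℓ) * (2 * B) := by gcongr; linarith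
  have h10 : M * x * (3 * (a * ρ) + a * R / ρ) ≤ M * x * (4 * B) := by gcongr; linarith
  have h11 : M * x * B ≤ M * x * B * ℓ := le_mul_of_one_le_right (by positivity) hℓ
  have h12 : 2 * (M * x * B * ℓ) ≤ s * (M * x * B * ℓ) := by gcongr
  have h13 : 24 * s * M * B * x * ℓ / 2 * (1 / 2) ≤
      24 * s * M * B * x * ℓ / 2 * (1 - 24 * s * R * B * ℓ / (a * x ^ 2)) := by
    gcongr; linarith
  refine le_trans ?_ h13
  nlinarith

/-- After extracting `a M x³`, the terms without `ℓ` are at most `5m` plus 10 copies of `R/ρ`, and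
the projection error adds `(3/2)·14 = 21` copies of `R(1/a + 1/ρ)ℓ`; hence 31. -/
theorem regret_arith {a ρ R M x ℓ s m : ℝ} (ha : 1 ≤ a) (hρ : 0 < ρ) (hR : ρ ^ 2 ≤ R)
    (hM : 0 < M) (hx : 0 < x) (hℓ : 1 ≤ ℓ) (hs : s ≤ 14) (h1 : R / ρ ^ 2 ≤ m)
    (h2 : R ≤ m) :
    4 * R ^ 2 / (2 * (R / (a * M * x ^ 3))) + x ^ 2 *
      (R / (a * M * x ^ 3) * (M * x ^ 2 * (a / ρ + 1)) ^ 2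
      + 3 / 2 * (s * R * ℓ / x * (M * x ^ 2 * (a / ρ + 1)))
      + 2 * (x ^ 2 * (M * (a * ρ / x) * (3 + R / ρ ^ 2)))
      + R / (a * M * x ^ 3) / 2 * (x ^ 2 * M) ^ 2) ≤
    31 * (a * M * x ^ 3 * (m + R * (1 / a + 1 / ρ) * ℓ)) := by
  have hR0 : 0 < R := lt_of_lt_of_le (by positivity) hR
  have ha0 : 0 < a := by linarith
  have e : 4 * R ^ 2 / (2 * (R / (a * M * x ^ 3))) + x ^ 2 *
      (R / (a * M * x ^ 3) * (M * x ^ 2 * (a / ρ + 1)) ^ 2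
      + 3 / 2 * (s * R * ℓ / x * (M * x ^ 2 * (a / ρ + 1)))
      + 2 * (x ^ 2 * (M * (a * ρ / x) * (3 + R / ρ ^ 2)))
      + R / (a * M * x ^ 3) / 2 * (x ^ 2 * M) ^ 2) =
      a * M * x ^ 3 * (2 * R + (R / ρ ^ 2 + 2 * (R / (a * ρ)) + R / a ^ 2)
        + 3 / 2 * (s * (R * (1 / a + 1 / ρ) * ℓ)) + 2 * (3 * ρ + R / ρ) + R / (2 * a ^ 2)) := by
    field_simp
    ring
  rw [e, mul_left_comm 31]
  refine mul_le_mul_of_nonneg_left ?_ (by positivity)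
  have h3 : R / (a * ρ) ≤ R * (1 / ρ) := by
    rw [mul_one_div]
    exact div_le_div_of_nonneg_left hR0.le hρ (le_mul_of_one_le_left hρ.le ha)
  have h4 : R / a ^ 2 ≤ R := div_le_self hR0.le (one_le_pow₀ ha)
  have h4' : R / (2 * a ^ 2) ≤ R := div_le_self hR0.le (by nlinarith)
  have h5 : ρ ≤ R * (1 / ρ) := by
    rw [mul_one_div, le_div_iff₀ hρ]; linarith
  have e6 : R / ρ = R * (1 / ρ) := by ring
  have h7 : R * (1 / ρ) ≤ R * (1 / a + 1 / ρ) * ℓ := by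
    have h8 : R * (1 / ρ) ≤ R * (1 / a + 1 / ρ) := by
      have : 0 ≤ 1 / a := by positivity
      gcongr; linarith
    exact h8.trans (le_mul_of_one_le_right (by positivity) hℓ)
  have h8 : s * (R * (1 / a + 1 / ρ) * ℓ) ≤ 14 * (R * (1 / a + 1 / ρ) * ℓ) := by gcongr
  have h9 : 0 < R * (1 / ρ) := by positivity
  rw [e6]
  linarith

/-- If `l V ≤ D + l² W` for all `l ≥ 0` then `V² ≤ 4 W D`. -/
theorem sq_le_of_forall_mul_le {V D W : ℝ} (hV : 0 ≤ V) (hW : 0 < W)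
    (h : ∀ l, 0 ≤ l → l * V ≤ D + l ^ 2 * W) : V ^ 2 ≤ 4 * W * D := by
  -- The maximizer of `l V - l² W`.
  have := h (V / (2 * W)) (by positivity)
  have e1 : V / (2 * W) * V = V ^ 2 / (2 * W) := by ring
  have e2 : (V / (2 * W)) ^ 2 * W = V ^ 2 / (2 * W) / 2 := by field_simp
  rw [e1, e2] at this
  have h2 : V ^ 2 / (2 * W) ≤ 2 * D := by linarith
  rw [div_le_iff₀ (by positivity)] at h2
  linarith

/-- The number of passes is of order `L = log T` and each Frank-Wolfe run takes order `x²/L` steps,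
so the logarithm in `ε` cancels. The leading coefficient is `(17/8)(16/61) = 34/61 < 1`, which
leaves room for the lower-order term. -/
theorem calls_arith {L x R : ℝ} (hL : 2 ≤ L) (hx : 20 * L ≤ x) (hR : 0 < R)
    (hlog : Real.log (x ^ 4) = L) :
    (max 0 (9 / 4 * Real.log (R ^ 2 / (61 * R ^ 2 * L / x ^ 2))) + 2) *
      (4 * (2 * R) ^ 2 / (61 * R ^ 2 * L / x ^ 2) + 3) ≤ x ^ 2 := by
  have hx0 : 40 ≤ x := by linarith
  have hx1 : 0 < x := by linarith
  have hlx : Real.log x = L / 4 := by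
    rw [Real.log_pow] at hlog
    push_cast at hlog
    linarith
  have e1 : R ^ 2 / (61 * R ^ 2 * L / x ^ 2) = x ^ 2 / (61 * L) := by
    field_simp
  have e2 : 4 * (2 * R) ^ 2 / (61 * R ^ 2 * L / x ^ 2) = 16 * x ^ 2 / (61 * L) := by
    field_simp
    norm_num
  have h1 : Real.log (x ^ 2 / (61 * L)) ≤ L / 2 := by
    have : x ^ 2 / (61 * L) ≤ x ^ 2 := div_le_self (by positivity) (by linarith)
    refine (Real.log_le_log (by positivity) this).trans ?_
    rw [Real.log_pow, hlx]
    push_cast; linarith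
  have h2 : max 0 (9 / 4 * Real.log (x ^ 2 / (61 * L))) ≤ 9 / 8 * L :=
    max_le (by positivity) (by linarith)
  rw [e1, e2]
  have h3 : max 0 (9 / 4 * Real.log (x ^ 2 / (61 * L))) + 2 ≤ 17 / 8 * L := by linarith
  have h4 : 17 / 8 * L * (16 * x ^ 2 / (61 * L) + 3) = 34 / 61 * x ^ 2 + 51 / 8 * L := by
    field_simp; ring
  refine (mul_le_mul_of_nonneg_right h3 (by positivity)).trans ?_
  rw [h4]
  nlinarith

end Arithmetic

theorem exists_horizon (c : ℝ) : ∃ T₀ : ℕ, ∀ T : ℕ, T₀ ≤ T →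
    0 < T ∧ 2 ≤ Real.log T ∧ c * Real.log T ≤ (T : ℝ) ^ (1 / 4 : ℝ) := by
  have h1 : ∀ᶠ t : ℝ in Filter.atTop, c * Real.log t ≤ t ^ (1 / 4 : ℝ) := by
    have := ((isLittleO_log_rpow_atTop (show (0 : ℝ) < 1 / 4 by norm_num)).const_mul_left c).bound
      one_pos
    filter_upwards [this, Filter.eventually_ge_atTop 0] with t ht h0
    rw [one_mul, Real.norm_of_nonneg (Real.rpow_nonneg h0 _)] at ht
    exact (le_abs_self _).trans ht
  have h2 : ∀ᶠ t : ℝ in Filter.atTop, 2 ≤ Real.log t := Real.tendsto_log_atTop.eventually_ge_atTop 2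
  have h3 := tendsto_natCast_atTop_atTop.eventually
    (h1.and (h2.and (Filter.eventually_gt_atTop (0 : ℝ))))
  obtain ⟨T₀, hT⟩ := Filter.eventually_atTop.1 h3
  exact ⟨T₀, fun T h => ⟨by exact_mod_cast (hT T h).2.2, (hT T h).2.1, (hT T h).1⟩⟩

/-! ### Extension of the functions from the ball to Lipschitz functions on the whole space. -/

section Extension

variable {n : ℕ} {R G M : ℝ} {h : Euc n → ℝ}

theorem ConvexWithSubgradientBound.sub_le (hh : ConvexWithSubgradientBound R G h) {x y : Euc n}
    (hx : x ∈ Metric.closedBall (0 : Euc n) R) (hy : y ∈ Metric.closedBall (0 : Euc n) R) :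
    h x - h y ≤ G * ‖x - y‖ := by
  obtain ⟨v, hv, hG⟩ := hh.2 x hx
  have h1 := hv y hy
  have e : inner ℝ v (y - x) = -inner ℝ v (x - y) := by rw [← inner_neg_right, neg_sub]
  have h2 := (real_inner_le_norm v (x - y)).trans (mul_le_mul_of_nonneg_right hG (norm_nonneg _))
  linarith

/-- A globally Lipschitz function that agrees with `h` on the ball. -/
theorem ConvexWithSubgradientBound.exists_lipschitz (hh : ConvexWithSubgradientBound R G h)
    (hGM : G ≤ M) : ∃ F : Euc n → ℝ, LipschitzWith M.toNNReal F ∧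
      ConvexOn ℝ (Metric.closedBall 0 R) F ∧ Set.EqOn h F (Metric.closedBall 0 R) := by
  have hl : LipschitzOnWith M.toNNReal h (Metric.closedBall 0 R) := by
    refine LipschitzOnWith.of_dist_le_mul fun x hx y hy => ?_
    rw [Real.dist_eq, dist_eq_norm]
    have h1 := hh.sub_le hx hy
    have h2 := hh.sub_le hy hx
    rw [norm_sub_rev] at h2
    have h3 : G * ‖x - y‖ ≤ M.toNNReal * ‖x - y‖ :=
      mul_le_mul_of_nonneg_right (hGM.trans (Real.le_coe_toNNReal M)) (norm_nonneg _)
    exact abs_le.2 ⟨by linarith, by linarith⟩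
  obtain ⟨F, hF, heq⟩ := hl.extend_real
  exact ⟨F, hF, hh.1.congr heq, heq⟩

/-- Global Lipschitz extensions of a family of functions given for `t < T`. -/
theorem exists_lipschitz_family {S : Set (Euc n)} {f : ℕ → Euc n → ℝ} {T : ℕ} {m : ℝ}
    (hSR : S ⊆ Metric.closedBall 0 R) (hM : 0 ≤ M) (hGM : G ≤ M) (hmM : m ≤ M)
    (hf : ∀ t < T, ConvexWithSubgradientBound R G (f t)) (hb : ∀ t < T, ∀ x ∈ S, |f t x| ≤ m) :
    ∃ F : ℕ → Euc n → ℝ, (∀ t, LipschitzWith M.toNNReal (F t)) ∧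
      (∀ t, ConvexOn ℝ (Metric.closedBall 0 R) (F t)) ∧ (∀ t, ∀ x ∈ S, |F t x| ≤ M) ∧
      ∀ t < T, ∀ x ∈ S, f t x = F t x := by
  have key : ∀ t, ∃ F : Euc n → ℝ, LipschitzWith M.toNNReal F ∧
      ConvexOn ℝ (Metric.closedBall 0 R) F ∧ (∀ x ∈ S, |F x| ≤ M) ∧
      (t < T → ∀ x ∈ S, f t x = F x) := fun t => by
    by_cases ht : t < T
    · obtain ⟨F, h1, h2, h3⟩ := (hf t ht).exists_lipschitz hGM
      exact ⟨F, h1, h2, fun x hx => by rw [← h3 (hSR hx)]; exact (hb t ht x hx).trans hmM,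
        fun _ x hx => h3 (hSR hx)⟩
    · exact ⟨fun _ => 0, LipschitzWith.const' 0, convexOn_const 0 (convex_closedBall _ _),
        fun x _ => by simpa using hM, fun h => absurd h ht⟩
  choose F h1 h2 h3 h4 using key
  exact ⟨F, h1, h2, h3, h4⟩

end Extension

/-! ### The chosen parameters in terms of `T^{1/4}`. -/

section Parameters

variable {n T K : ℕ} {R r M : ℝ}

/-- The maximum that occurs in the dual regularization. -/
noncomputable def deltaScale (n : ℕ) (R r : ℝ) : ℝ :=
  max (max (n / r) (n / √r)) (max √n (n / (√r * R)))

/-- The maximum that occurs in the bound of the constraint violation. -/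
noncomputable def violationScale (n : ℕ) (R r : ℝ) : ℝ :=
  max (max (max (R / r) (R / √r)) (max (R / √n) (1 / √r))) (1 / R)

theorem rpow_quarter_pow (T : ℕ) (k : ℕ) :
    ((T : ℝ) ^ (1 / 4 : ℝ)) ^ k = (T : ℝ) ^ ((1 / 4 : ℝ) * k) := by
  rw [Real.rpow_mul (Nat.cast_nonneg T), Real.rpow_natCast]

theorem chosenParams_ε : (chosenParams n T K R r M).ε =
    61 * R ^ 2 * Real.log T / ((T : ℝ) ^ (1 / 4 : ℝ)) ^ 2 := by
  rw [rpow_quarter_pow]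
  change 61 * R ^ 2 * (T : ℝ) ^ (-(1 / 2) : ℝ) * Real.log T = _
  rw [Real.rpow_neg (Nat.cast_nonneg T)]
  norm_num
  ring

theorem chosenParams_η : (chosenParams n T K R r M).η =
    R / (√n * M * ((T : ℝ) ^ (1 / 4 : ℝ)) ^ 3) := by
  rw [rpow_quarter_pow]
  change R / (√n * M) * (T : ℝ) ^ (-(3 / 4) : ℝ) = _
  rw [Real.rpow_neg (Nat.cast_nonneg T)]
  norm_num
  ring

theorem chosenParams_μ : (chosenParams n T K R r M).μ = √n * √r / (T : ℝ) ^ (1 / 4 : ℝ) := by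
  change √(n * r) * (T : ℝ) ^ (-(1 / 4) : ℝ) = _
  rw [Real.rpow_neg (Nat.cast_nonneg T), Real.sqrt_mul (Nat.cast_nonneg n)]
  ring

theorem chosenParams_δ : (chosenParams n T K R r M).δ =
    24 * √183 * M ^ 2 * deltaScale n R r * ((T : ℝ) ^ (1 / 4 : ℝ)) ^ 2 * √(Real.log T) := by
  rw [rpow_quarter_pow]
  change 24 * √183 * M ^ 2 * deltaScale n R r * (T : ℝ) ^ (1 / 2 : ℝ) * √(Real.log T) = _
  norm_num

theorem sqrt_three_mul_chosenParams_ε (hT : (0 : ℝ) < T) (hR : 0 < R) (hL : 0 ≤ Real.log T) :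
    √(3 * (chosenParams n T K R r M).ε) =
      √183 * R * √(Real.log T) / (T : ℝ) ^ (1 / 4 : ℝ) := by
  have hx : 0 < (T : ℝ) ^ (1 / 4 : ℝ) := Real.rpow_pos_of_pos hT _
  have e : 3 * (chosenParams n T K R r M).ε =
      183 * (R * √(Real.log T) / (T : ℝ) ^ (1 / 4 : ℝ)) ^ 2 := by
    rw [chosenParams_ε, div_pow, mul_pow, Real.sq_sqrt hL]; ring
  rw [e, Real.sqrt_mul (by norm_num), Real.sqrt_sq (by positivity)]
  ring

/-- Since `n/μ = √n T^{1/4}/√r` and `K = T^{1/2}`, the variance part `K(n/μ)²` and the mean part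
`K²` are both of order `T`: this is the balance that fixes the block length. -/
theorem chosenParams_block_variance (hn : 0 < n) (hr : 0 < r) (hT : (0 : ℝ) < T)
    (hK : (K : ℝ) = ((T : ℝ) ^ (1 / 4 : ℝ)) ^ 2) :
    M ^ 2 * ((K : ℝ) * (n / (chosenParams n T K R r M).μ) ^ 2 + (K : ℝ) ^ 2) ≤
      (M * ((T : ℝ) ^ (1 / 4 : ℝ)) ^ 2 * (√n / √r + 1)) ^ 2 := by
  have hx : 0 < (T : ℝ) ^ (1 / 4 : ℝ) := Real.rpow_pos_of_pos hT _
  have hn' : (0 : ℝ) < n := by exact_mod_cast hn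
  have ha : 0 < √(n : ℝ) := Real.sqrt_pos.2 hn'
  have ha2 : √(n : ℝ) ^ 2 = n := Real.sq_sqrt hn'.le
  have hρ : 0 < √r := Real.sqrt_pos.2 hr
  rw [chosenParams_μ, hK]
  generalize (T : ℝ) ^ (1 / 4 : ℝ) = x at *
  have e0 : (n : ℝ) / (√n * √r / x) = √n * x / √r := by
    rw [div_div_eq_mul_div, div_eq_div_iff (by positivity) (by positivity)]
    linear_combination -(x * √r) * ha2
  have h0 : 0 ≤ √(n : ℝ) / √r := by positivity
  rw [e0]
  calc M ^ 2 * (x ^ 2 * (√n * x / √r) ^ 2 + (x ^ 2) ^ 2)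
      = M ^ 2 * x ^ 4 * ((√n / √r) ^ 2 + 1) := by ring
    _ ≤ M ^ 2 * x ^ 4 * (√n / √r + 1) ^ 2 := by
        refine mul_le_mul_of_nonneg_left ?_ (by positivity)
        linarith [add_sq (√(n : ℝ) / √r) 1]
    _ = _ := by ring

theorem chosenParams_δ_mul_η (hn : 0 < n) (hM : 0 < M) (hT : (0 : ℝ) < T)
    (hK : (K : ℝ) = ((T : ℝ) ^ (1 / 4 : ℝ)) ^ 2) :
    (K : ℝ) * (chosenParams n T K R r M).δ * (chosenParams n T K R r M).η =
      24 * √183 * M * (deltaScale n R r * R / √n) * (T : ℝ) ^ (1 / 4 : ℝ) * √(Real.log T) := by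
  have hx : 0 < (T : ℝ) ^ (1 / 4 : ℝ) := Real.rpow_pos_of_pos hT _
  have ha : 0 < √(n : ℝ) := Real.sqrt_pos.2 (by exact_mod_cast hn)
  rw [chosenParams_δ, chosenParams_η, hK]
  generalize (T : ℝ) ^ (1 / 4 : ℝ) = x at *
  generalize √(Real.log T) = ℓ
  generalize √(183 : ℝ) = s
  generalize √(n : ℝ) = a at *
  generalize deltaScale n R r = d
  field_simp

/-- Each entry of the first maximum is `n/R` times an entry of the second. This is how the choice of
`δ` enters the violation bound. -/
theorem deltaScale_mul_le (hn : 0 < n) (hr : 0 < r) (hR : 0 < R) :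
    deltaScale n R r * R / √n ≤ √n * violationScale n R r := by
  have hn' : (0 : ℝ) < n := by exact_mod_cast hn
  have ha : 0 < √(n : ℝ) := Real.sqrt_pos.2 hn'
  have hρ : 0 < √r := Real.sqrt_pos.2 hr
  have ha2 : √(n : ℝ) * √n = n := Real.mul_self_sqrt hn'.le
  have key : deltaScale n R r ≤ n * violationScale n R r / R := by
    have h : ∀ v, v ≤ violationScale n R r → n * v / R ≤ n * violationScale n R r / R :=
      fun v hv => by gcongr
    refine max_le (max_le ?_ ?_) (max_le ?_ ?_)
    · refine le_trans (le_of_eq ?_) (h (R / r) ?_)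
      · field_simp
      · exact (le_max_left _ _).trans ((le_max_left _ _).trans (le_max_left _ _))
    · refine le_trans (le_of_eq ?_) (h (R / √r) ?_)
      · field_simp
      · exact (le_max_right _ _).trans ((le_max_left _ _).trans (le_max_left _ _))
    · refine le_trans (le_of_eq ?_) (h (R / √n) ?_)
      · rw [eq_div_iff hR.ne', mul_div_assoc', eq_div_iff ha.ne']; linear_combination R * ha2
      · exact (le_max_left _ _).trans ((le_max_right _ _).trans (le_max_left _ _))
    · refine le_trans (le_of_eq ?_) (h (1 / √r) ?_)
      · field_simp
      · exact (le_max_right _ _).trans ((le_max_right _ _).trans (le_max_left _ _))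
  rw [le_div_iff₀ hR] at key
  rw [div_le_iff₀ ha]
  calc _ ≤ n * violationScale n R r := key
    _ = _ := by rw [mul_right_comm, ha2]

/-- The three quantities that `δ` has to dominate in `regularization_le`. -/
theorem le_deltaScale_mul (hn : 0 < n) (hr : 0 < r) (hR : 0 < R) :
    √n * R / √r ^ 2 ≤ deltaScale n R r * R / √n ∧ √n * R / √r ≤ deltaScale n R r * R / √n ∧
      R ≤ deltaScale n R r * R / √n := by
  have hn' : (0 : ℝ) < n := by exact_mod_cast hn
  have ha : 0 < √(n : ℝ) := Real.sqrt_pos.2 hn'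
  have hρ : 0 < √r := Real.sqrt_pos.2 hr
  have ha2 : √(n : ℝ) * √n = n := Real.mul_self_sqrt hn'.le
  have h : ∀ v, v ≤ deltaScale n R r → v * R / √n ≤ deltaScale n R r * R / √n :=
    fun v hv => by gcongr
  refine ⟨?_, ?_, ?_⟩
  · refine le_trans (le_of_eq ?_) (h (n / r) ((le_max_left _ _).trans (le_max_left _ _)))
    rw [Real.sq_sqrt hr.le, div_mul_eq_mul_div, div_div,
      div_eq_div_iff hr.ne' (by positivity)]
    linear_combination R * r * ha2
  · refine le_trans (le_of_eq ?_) (h (n / √r) ((le_max_right _ _).trans (le_max_left _ _)))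
    rw [div_mul_eq_mul_div, div_div, div_eq_div_iff hρ.ne' (by positivity)]
    linear_combination R * √r * ha2
  · refine le_trans (le_of_eq ?_) (h √n ((le_max_left _ _).trans (le_max_right _ _)))
    field_simp

end Parameters

/-- A number whose product with `log T` is to be at most `T^{1/4}`. -/
noncomputable def horizonScale (n : ℕ) (R r G M : ℝ) : ℝ :=
  20 + √n / √r + 48 * √183 * R * (deltaScale n R r * R / √n) / √n +
    31 * (√n * M) * (max (max (R / r) R) (1 / √r) + R * (1 / √n + 1 / √r)) / (R * G)

theorem sqrt_183_bounds : 2 ≤ √(183 : ℝ) ∧ √(183 : ℝ) ≤ 14 :=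
  ⟨Real.le_sqrt_of_sq_le (by norm_num), Real.sqrt_le_iff.2 (by norm_num)⟩

/-! ### Consequences of a large horizon. -/

section SizeOfHorizon

variable {a ρ R M x ℓ L B s m v G W V η : ℝ}

theorem regularization_horizon (ha : 0 < a) (hs : 0 ≤ s) (hR : 0 < R) (hB : 0 < B) (hx : 1 ≤ x)
    (hℓ : ℓ ≤ L) (h : 48 * s * R * B / a * L ≤ x) : 48 * s * R * B * ℓ ≤ a * x ^ 2 := by
  have h1 : 48 * s * R * B * ℓ ≤ 48 * s * R * B * L := by gcongr
  have h2 : 48 * s * R * B * L = a * (48 * s * R * B / a * L) := by field_simp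
  have h3 : a * (48 * s * R * B / a * L) ≤ a * x := by gcongr
  have h4 : a * x ≤ a * x ^ 2 := mul_le_mul_of_nonneg_left (by nlinarith) ha.le
  linarith

/-- For large `T` the regret bound, of order `x³ℓ`, is below the trivial order `R G T`; this keeps
`G_f` as the factor in the violation bound. -/
theorem regret_horizon (ha : 0 < a) (hρ : 0 < ρ) (hR : 0 < R) (hM : 0 < M) (hG : 0 < G)
    (hx : 0 < x) (hm : 0 ≤ m) (hL : 1 ≤ L) (hℓ : ℓ ≤ L)
    (h : 31 * (a * M) * (m + R * (1 / a + 1 / ρ)) / (R * G) * L ≤ x) :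
    31 * (a * M * x ^ 3 * (m + R * (1 / a + 1 / ρ) * ℓ)) ≤ R * G * x ^ 4 := by
  have h1 : m + R * (1 / a + 1 / ρ) * ℓ ≤ (m + R * (1 / a + 1 / ρ)) * L := by
    have h2 : R * (1 / a + 1 / ρ) * ℓ ≤ R * (1 / a + 1 / ρ) * L := by gcongr
    have h3 : m ≤ m * L := le_mul_of_one_le_right hm hL
    linarith
  have h4 : 31 * (a * M) * (m + R * (1 / a + 1 / ρ)) * L ≤ R * G * x := by
    rwa [div_mul_eq_mul_div, div_le_iff₀ (by positivity), mul_comm x] at h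
  calc 31 * (a * M * x ^ 3 * (m + R * (1 / a + 1 / ρ) * ℓ))
      ≤ 31 * (a * M * x ^ 3 * ((m + R * (1 / a + 1 / ρ)) * L)) := by gcongr
    _ = x ^ 3 * (31 * (a * M) * (m + R * (1 / a + 1 / ρ)) * L) := by ring
    _ ≤ x ^ 3 * (R * G * x) := by gcongr
    _ = _ := by ring

/-- The coefficient is `4·169·3 = 2028`, where `1/2 + 12·14 ≤ 169`; it is rounded up to `46²`. -/
theorem violation_arith (ha : 0 < a) (hR : 0 < R) (hM : 0 < M) (hG : 0 < G) (hx : 0 < x)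
    (hℓ : 1 ≤ ℓ) (hs : s ≤ 14) (hv : 1 / R ≤ v) (hB0 : 0 < B) (hB : B ≤ a * v)
    (hV : V ^ 2 ≤ 4 * (1 / (2 * (R / (a * M * x ^ 3))) + x ^ 2 * (24 * s * M * B * x * ℓ) / 2) *
      (3 * (R * G * x ^ 4))) :
    V ^ 2 ≤ 2116 * (R * G * M * v * a * x ^ 7 * ℓ) := by
  have hv0 : 0 < v := lt_of_lt_of_le (by positivity) hv
  have e1 : 1 / (2 * (R / (a * M * x ^ 3))) = a * M * x ^ 3 * (1 / R) / 2 := by field_simp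
  have e2 : x ^ 2 * (24 * s * M * B * x * ℓ) / 2 = 12 * s * (M * x ^ 3 * ℓ * B) := by ring
  have h1 : a * M * x ^ 3 * (1 / R) ≤ a * M * x ^ 3 * (ℓ * v) := by
    gcongr
    exact hv.trans (le_mul_of_one_le_left hv0.le hℓ)
  have h2 : M * x ^ 3 * ℓ * B ≤ M * x ^ 3 * ℓ * (a * v) := by gcongr
  have h3 : 12 * s * (M * x ^ 3 * ℓ * B) ≤ 12 * 14 * (M * x ^ 3 * ℓ * (a * v)) := by gcongr
  have h4 : 0 < a * M * x ^ 3 * ℓ * v := by positivity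
  rw [e1, e2] at hV
  have h5 : a * M * x ^ 3 * (1 / R) / 2 + 12 * s * (M * x ^ 3 * ℓ * B) ≤
      169 * (a * M * x ^ 3 * ℓ * v) := by linarith
  have h6 := mul_le_mul_of_nonneg_right (mul_le_mul_of_nonneg_left h5 (zero_le_four (α := ℝ)))
    (show 0 ≤ 3 * (R * G * x ^ 4) by positivity)
  have h7 : 0 < R * G * M * v * a * x ^ 7 * ℓ := by positivity
  linarith

end SizeOfHorizon

/-! ### Regret and violation bounds for globally Lipschitz data. -/

section Main

variable {n : ℕ} {p : BanditParams} {M G : ℝ} {S : Set (Euc n)} {lo : Euc n → Euc n}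
  {f g : ℕ → Euc n → ℝ} {x₁ : Euc n}
  {Ω : Type*} [MeasurableSpace Ω] {P : Measure Ω} [IsProbabilityMeasure P]
  {u : ℕ → Ω → Metric.sphere (0 : Euc n) 1}

/-- A lower bound of the regret. -/
theorem BanditInstance.neg_le_regret (H : BanditInstance p S lo f g x₁ M) (hG : 0 ≤ G)
    (hum : ∀ t, Measurable (u t)) {xs : Euc n} (hxs : xs ∈ S) {T : ℕ}
    (hf : ∀ t < T, ∀ x ∈ S, ∀ y ∈ S, f t x - f t y ≤ G * ‖x - y‖) :
    -(2 * (p.R * G * T)) ≤ (∫ ω, ∑ t ∈ Finset.range T,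
      f t (played p lo f g x₁ (fun s => (u s ω : Euc n)) t) ∂P) - ∑ t ∈ Finset.range T, f t xs := by
  have i1 := integrable_finsetSum (Finset.range T) fun t _ =>
    H.integrable_f_played (P := P) hum t
  have h1 := integral_mono (μ := P)
    (integrable_const (∑ t ∈ Finset.range T, f t xs - 2 * (p.R * G * T))) i1 fun ω => by
      have : ∑ t ∈ Finset.range T, f t xs ≤ ∑ t ∈ Finset.range T,
          (f t (played p lo f g x₁ (fun s => (u s ω : Euc n)) t) + 2 * (p.R * G)) :=
        Finset.sum_le_sum fun t ht => by
          have hp := H.rPlayed_mem u t ω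
          have h1 := hf t (Finset.mem_range.1 ht) xs hxs _ hp
          have h2 : ‖xs - played p lo f g x₁ (fun s => (u s ω : Euc n)) t‖ ≤ p.R + p.R :=
            (norm_sub_le _ _).trans (add_le_add (H.norm_le_of_mem hxs) (H.norm_le_of_mem hp))
          have h3 := mul_le_mul_of_nonneg_left h2 hG
          linarith
      rw [Finset.sum_add_distrib, Finset.sum_const, Finset.card_range, nsmul_eq_mul] at this
      simp only
      linarith
  rw [integral_const, probReal_univ, one_smul] at h1
  linarith

theorem BanditInstance.bounds_of_params (H : BanditInstance p S lo f g x₁ M)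
    {a ρ x ℓ L B s m v : ℝ} (ha : 1 ≤ a) (hρ : 0 < ρ) (hρR : ρ ^ 2 ≤ p.R) (hx : 1 ≤ x)
    (hℓ : 1 ≤ ℓ) (hℓL : ℓ ≤ L) (hs2 : 2 ≤ s) (hs14 : s ≤ 14)
    (hB1 : a * p.R / ρ ^ 2 ≤ B) (hB2 : a * p.R / ρ ≤ B) (hB3 : p.R ≤ B) (hBv : B ≤ a * v)
    (hv : 1 / p.R ≤ v) (hm1 : p.R / ρ ^ 2 ≤ m) (hm2 : p.R ≤ m)
    (hc2 : 48 * s * p.R * B / a * L ≤ x)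
    (hc3 : 31 * (a * M) * (m + p.R * (1 / a + 1 / ρ)) / (p.R * G) * L ≤ x)
    (hK : (p.K : ℝ) = x ^ 2) (hε : √(3 * p.ε) = s * p.R * ℓ / x)
    (hη : p.η = p.R / (a * M * x ^ 3))
    (hre : BanditInstance.roundError p M = M * (a * ρ / x) * (3 + p.R / ρ ^ 2))
    (hc : p.K * p.δ * p.η = 24 * s * M * B * x * ℓ)
    (hb2 : M ^ 2 * (p.K * (n / p.μ) ^ 2 + p.K ^ 2) ≤ (M * x ^ 2 * (a / ρ + 1)) ^ 2)
    (hG : 0 < G)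
    (hum : ∀ t, Measurable (u t)) (hlaw : ∀ t < p.K * p.K, P.map (u t) = uniformSphere n)
    (hind : iIndepFun (fun t : Fin (p.K * p.K) => u t) P) {xs : Euc n} (hxs : xs ∈ S)
    (hfeas : ∀ t < p.K * p.K, g t xs ≤ 0)
    (hf : ∀ t < p.K * p.K, ∀ x ∈ S, ∀ y ∈ S, f t x - f t y ≤ G * ‖x - y‖) :
    (∫ ω, ∑ t ∈ Finset.range (p.K * p.K), f t (played p lo f g x₁
        (fun s => (u s ω : Euc n)) t) ∂P) - ∑ t ∈ Finset.range (p.K * p.K), f t xs ≤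
      46 * (a * M * x ^ 3 * (m + p.R * (1 / a + 1 / ρ) * ℓ)) ∧
    (∫ ω, ∑ t ∈ Finset.range (p.K * p.K), max (g t (played p lo f g x₁
        (fun s => (u s ω : Euc n)) t)) 0 ∂P) ^ 2 ≤
      2116 * (p.R * G * M * v * a * x ^ 7 * ℓ) := by
  have hR0 := H.R_pos
  have hM0 := H.M_pos
  have ha0 : 0 < a := by linarith
  have hx0 : 0 < x := by linarith
  have hB0 : 0 < B := hR0.trans_le hB3
  have hm0 : 0 ≤ m := hR0.le.trans hm2
  have hxl := regularization_horizon ha0 (by linarith) hR0 hB0 hx hℓL hc2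
  have hU := regret_horizon ha0 hρ hR0 hM0 hG hx0 hm0 (hℓ.trans hℓL) hℓL hc3
  have hreg := regularization_le ha hρ hρR hM0 hx0 hℓ hs2 hB1 hB2 hB3 hxl
  have hregret := regret_arith ha hρ hρR hM0 hx0 hℓ hs14 hm1 hm2
  obtain ⟨b, hb⟩ : ∃ b, b = M * x ^ 2 * (a / ρ + 1) := ⟨_, rfl⟩
  have hb0 : 0 < b := by rw [hb]; positivity
  rw [← hb] at hb2 hreg hregret
  rw [← hη, ← hε, ← hre, ← hc, ← hK] at hreg
  rw [← hη, ← hε, ← hre, ← hK] at hregret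
  have master := fun (l : ℝ) (hl : 0 ≤ l) => H.regret_add_mul_violation_le (P := P) hum hlaw hind hl
    hb0 hxs hfeas hb2 hreg
  have hlow := H.neg_le_regret (P := P) hG.le hum hxs hf
  rw [Nat.cast_mul, hK, show x ^ 2 * x ^ 2 = x ^ 4 by ring] at hlow
  have hV0 : 0 ≤ ∫ ω, ∑ t ∈ Finset.range (p.K * p.K), max (g t (played p lo f g x₁
        (fun s => (u s ω : Euc n)) t)) 0 ∂P :=
    integral_nonneg fun ω => Finset.sum_nonneg fun t _ => le_max_right _ _
  generalize (∫ ω, ∑ t ∈ Finset.range (p.K * p.K), max (g t (played p lo f g x₁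
        (fun s => (u s ω : Euc n)) t)) 0 ∂P) = V at *
  generalize (∫ ω, ∑ t ∈ Finset.range (p.K * p.K), f t (played p lo f g x₁
        (fun s => (u s ω : Euc n)) t) ∂P) - ∑ t ∈ Finset.range (p.K * p.K), f t xs = F at *
  -- The error terms independent of `l` form the regret bound; those quadratic in `l` come from the
  -- initial dual distance and from the regularization.
  have master' : ∀ l, 0 ≤ l → F + l * V ≤
      31 * (a * M * x ^ 3 * (m + p.R * (1 / a + 1 / ρ) * ℓ))
      + l ^ 2 * (1 / (2 * p.η) + p.K * (p.K * p.δ * p.η) / 2) := fun l hl => by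
    refine (master l hl).trans (le_trans (le_of_eq ?_)
      (add_le_add_left hregret (l ^ 2 * (1 / (2 * p.η) + p.K * (p.K * p.δ * p.η) / 2))))
    unfold BanditInstance.blockError
    ring
  constructor
  · have := master' 0 le_rfl
    have h0 : 0 ≤ a * M * x ^ 3 * (m + p.R * (1 / a + 1 / ρ) * ℓ) := by positivity
    linarith
  · have hη0 := H.η_pos
    have hδ0 := H.δ_nonneg
    -- `3 = 1 + 2`: the upper bound of the regret, at most `R G x⁴`, and the trivial lower bound `-2
    -- R G x⁴`.
    have hsq := sq_le_of_forall_mul_le (D := 3 * (p.R * G * x ^ 4)) hV0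
      (show 0 < 1 / (2 * p.η) + p.K * (p.K * p.δ * p.η) / 2 by positivity) fun l hl => by
        have := master' l hl
        linarith
    rw [hc, hη, hK] at hsq
    exact violation_arith ha0 hR0 hM0 hG hx0 hℓ hs14 hv hB0 hBv hsq

end Main

section MainChosen

variable {n T K : ℕ} {R r M G : ℝ} {S : Set (Euc n)} {lo : Euc n → Euc n}
  {f g : ℕ → Euc n → ℝ} {x₁ : Euc n}

/-- The bounds of the theorem for globally Lipschitz functions and measurable samples. -/
theorem BanditInstance.bounds (H : BanditInstance (chosenParams n T K R r M) S lo f g x₁ M)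
    (hT : T = K * K) (hL : 2 ≤ Real.log T) (hG : 0 < G)
    (hx : horizonScale n R r G M * Real.log T ≤ (T : ℝ) ^ (1 / 4 : ℝ)) {xs : Euc n} (hxs : xs ∈ S)
    (hfeas : ∀ t < T, g t xs ≤ 0) (hf : ∀ t < T, ∀ x ∈ S, ∀ y ∈ S, f t x - f t y ≤ G * ‖x - y‖)
    {Ω : Type*} [MeasurableSpace Ω] {P : Measure Ω} [IsProbabilityMeasure P]
    {u : ℕ → Ω → Metric.sphere (0 : Euc n) 1}
    (hum : ∀ t, Measurable (u t)) (hlaw : ∀ t < T, P.map (u t) = uniformSphere n)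
    (hind : iIndepFun (fun t : Fin T => u t) P) :
    (∫ ω, ∑ t ∈ Finset.range T, f t (played (chosenParams n T K R r M) lo f g x₁
        (fun s => (u s ω : Euc n)) t) ∂P) - ∑ t ∈ Finset.range T, f t xs ≤
      46 * (√n * M * (T : ℝ) ^ (3 / 4 : ℝ) *
        (max (max (R / r) R) (1 / √r) + R * (1 / √n + 1 / √r) * √(Real.log T))) ∧
    (∫ ω, ∑ t ∈ Finset.range T, max (g t (played (chosenParams n T K R r M) lo f g x₁
        (fun s => (u s ω : Euc n)) t)) 0 ∂P) ≤
      46 * (√(R * G * M * violationScale n R r) *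
          (n : ℝ) ^ (1 / 4 : ℝ) * (T : ℝ) ^ (7 / 8 : ℝ) * Real.log T ^ (1 / 4 : ℝ)) ∧
    ∀ v : ℕ → Euc n, totalCalls (chosenParams n T K R r M) lo f g x₁ v T ≤ T := by
  have hη := chosenParams_η (n := n) (T := T) (K := K) (R := R) (r := r) (M := M)
  have hμ := chosenParams_μ (n := n) (T := T) (K := K) (R := R) (r := r) (M := M)
  have hδ := chosenParams_δ (n := n) (T := T) (K := K) (R := R) (r := r) (M := M)
  have hR0 : 0 < R := H.R_pos
  have hr0 : 0 < r := H.r_pos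
  have hM0 : 0 < M := H.M_pos
  have hn : 0 < n := H.n_pos
  have hn' : (1 : ℝ) ≤ n := by exact_mod_cast hn
  have hK0 : 0 < K := H.K_pos
  have hx4 : ((T : ℝ) ^ (1 / 4 : ℝ)) ^ 4 = T := by rw [rpow_quarter_pow]; norm_num
  have hx3 : ((T : ℝ) ^ (1 / 4 : ℝ)) ^ 3 = (T : ℝ) ^ (3 / 4 : ℝ) := by
    rw [rpow_quarter_pow]; norm_num
  have hx7 : ((T : ℝ) ^ (1 / 4 : ℝ)) ^ 7 = ((T : ℝ) ^ (7 / 8 : ℝ)) ^ 2 := by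
    rw [rpow_quarter_pow, ← Real.rpow_natCast, ← Real.rpow_mul (Nat.cast_nonneg T)]; norm_num
  have hTK : (T : ℝ) = (K : ℝ) * K := by rw [hT]; push_cast; rfl
  have hT0 : (0 : ℝ) < T := by rw [hTK]; positivity
  have hxpos : 0 < (T : ℝ) ^ (1 / 4 : ℝ) := Real.rpow_pos_of_pos hT0 _
  have hKx : (K : ℝ) = ((T : ℝ) ^ (1 / 4 : ℝ)) ^ 2 := by
    have : (K : ℝ) ^ 2 = (((T : ℝ) ^ (1 / 4 : ℝ)) ^ 2) ^ 2 := by rw [← pow_mul, hx4, hTK]; ring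
    exact (pow_left_inj₀ (Nat.cast_nonneg K) (by positivity) two_ne_zero).1 this
  have hℓsq : √(Real.log T) ^ 2 = Real.log T := Real.sq_sqrt (by linarith)
  have hℓq : √(Real.log T) = (Real.log T ^ (1 / 4 : ℝ)) ^ 2 := by
    rw [Real.sqrt_eq_rpow, ← Real.rpow_natCast, ← Real.rpow_mul (by linarith)]; norm_num
  have hnq : √(n : ℝ) = ((n : ℝ) ^ (1 / 4 : ℝ)) ^ 2 := by
    rw [Real.sqrt_eq_rpow, ← Real.rpow_natCast, ← Real.rpow_mul (by linarith)]; norm_num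
  have ha : 1 ≤ √(n : ℝ) := Real.one_le_sqrt.2 hn'
  have ha0 : 0 < √(n : ℝ) := by linarith
  have ha2 : √(n : ℝ) ^ 2 = n := Real.sq_sqrt (by linarith)
  have hρ : 0 < √r := Real.sqrt_pos.2 hr0
  have hρ2 : √r ^ 2 = r := Real.sq_sqrt hr0.le
  have hℓ : 1 ≤ √(Real.log T) := Real.one_le_sqrt.2 (by linarith)
  have hℓL : √(Real.log T) ≤ Real.log T := by nlinarith
  obtain ⟨hB1, hB2, hB3⟩ := le_deltaScale_mul (R := R) hn hr0 hR0
  have hB0 : 0 < deltaScale n R r * R / √n := hR0.trans_le hB3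
  obtain ⟨hs2, hs14⟩ := sqrt_183_bounds
  have hκ0 : 0 ≤ max (max (R / r) R) (1 / √r) :=
    le_max_of_le_left (le_max_of_le_right hR0.le)
  have hbig : ∀ v, v ≤ horizonScale n R r G M → v * Real.log T ≤ (T : ℝ) ^ (1 / 4 : ℝ) :=
    fun v hv => (mul_le_mul_of_nonneg_right hv (by linarith)).trans hx
  have hterm1 : 0 ≤ √n / √r := by positivity
  have hterm2 : 0 ≤ 48 * √183 * R * (deltaScale n R r * R / √n) / √n := by positivity
  have hterm3 : 0 ≤ 31 * (√n * M) * (max (max (R / r) R) (1 / √r) + R * (1 / √n + 1 / √r))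
      / (R * G) := by positivity
  -- The summands of `horizonScale` are used one at a time: the oracle count here, then `ηc ≤ 1/2`,
  -- then the comparison of the regret bound with `R G T`.
  have hc1 : 20 * Real.log T ≤ (T : ℝ) ^ (1 / 4 : ℝ) := hbig _ (by unfold horizonScale; linarith)
  have hc2 : 48 * √183 * R * (deltaScale n R r * R / √n) / √n * Real.log T ≤
    (T : ℝ) ^ (1 / 4 : ℝ) := hbig _ (by unfold horizonScale; linarith)
  have hc3 : 31 * (√n * M) * (max (max (R / r) R) (1 / √r) + R * (1 / √n + 1 / √r)) / (R * G) *
    Real.log T ≤ (T : ℝ) ^ (1 / 4 : ℝ) := hbig _ (by unfold horizonScale; linarith)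
  have hsε := sqrt_three_mul_chosenParams_ε (n := n) (K := K) (r := r) (M := M) (hT := hT0) hR0
    (by linarith)
  have hb2 := chosenParams_block_variance (K := K) (R := R) (M := M) hn hr0 hT0 hKx
  have hc := chosenParams_δ_mul_η (K := K) (R := R) (r := r) (M := M) hn hM0 hT0 hKx
  have hre : BanditInstance.roundError (chosenParams n T K R r M) M =
      M * (√n * √r / (T : ℝ) ^ (1 / 4 : ℝ)) * (3 + R / √r ^ 2) := by
    rw [BanditInstance.roundError, hμ, hρ2]; rfl
  refine ⟨?_, ?_, fun v => ?_⟩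
  rotate_left 2
  · refine H.totalCalls_le v hT ?_
    rw [chosenParams_ε]
    exact (calls_arith hL hc1 hR0 (by rw [hx4])).trans_eq hKx.symm
  all_goals
    subst hT
    obtain ⟨h1, h2⟩ := H.bounds_of_params (P := P) ha hρ (by rw [hρ2]; exact H.r_le_R)
      (by linarith) hℓ hℓL hs2 hs14 hB1 hB2 hB3 (deltaScale_mul_le hn hr0 hR0)
      (le_max_right _ _) (m := max (max (R / r) R) (1 / √r))
      (by rw [hρ2]; exact (le_max_left _ _).trans (le_max_left _ _))
      ((le_max_right _ _).trans (le_max_left _ _))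
      hc2 hc3 hKx hsε hη hre hc hb2 hG hum hlaw hind hxs hfeas hf
  · rw [← hx3]; exact h1
  · refine le_of_sq_le_sq (h2.trans (le_of_eq ?_)) (by positivity)
    have hv0 : 0 < violationScale n R r := lt_of_lt_of_le (by positivity) (le_max_right _ (1 / R))
    simp only [mul_pow]
    rw [Real.sq_sqrt (by positivity), ← hnq, ← hx7, ← hℓq]
    change 2116 * (R * G * M * violationScale n R r * √n * _ * _) = _
    ring

end MainChosen

/-! ### Passage to the stated hypotheses. -/

section Transfer

variable {n : ℕ} {Ω : Type*} [MeasurableSpace Ω] {P : Measure Ω} [IsProbabilityMeasure P]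

/-- Samples with given laws agree almost everywhere with measurable ones. -/
theorem exists_measurable_samples {T : ℕ} {u : ℕ → Ω → Metric.sphere (0 : Euc n) 1}
    (hlaw : ∀ t < T, HasLaw (u t) (uniformSphere n) P) (hind : iIndepFun (fun t : Fin T => u t) P) :
    ∃ v : ℕ → Ω → Metric.sphere (0 : Euc n) 1, (∀ t, Measurable (v t)) ∧
      (∀ t < T, P.map (v t) = uniformSphere n) ∧ iIndepFun (fun t : Fin T => v t) P ∧
      ∀ᵐ ω ∂P, ∀ t < T, u t ω = v t ω := by
  have key : ∀ t, ∃ v : Ω → Metric.sphere (0 : Euc n) 1, Measurable v ∧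
      (t < T → u t =ᵐ[P] v) := fun t => by
    by_cases ht : t < T
    · exact ⟨_, (hlaw t ht).aemeasurable.measurable_mk, fun _ => (hlaw t ht).aemeasurable.ae_eq_mk⟩
    · obtain ⟨ω⟩ := nonempty_of_isProbabilityMeasure P
      exact ⟨_, measurable_const (a := u t ω), fun h => absurd h ht⟩
  choose v hv huv using key
  refine ⟨v, hv, fun t ht => ?_, hind.congr fun t => huv t t.2,
    ae_all_iff.2 fun t => ?_⟩
  · rw [← Measure.map_congr (huv t ht), (hlaw t ht).map_eq]
  · exact Filter.eventually_imp_distrib_left.2 fun ht => huv t ht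

theorem le_of_closedBall_subset {R r : ℝ} (hn : 0 < n) (hr : 0 ≤ r)
    (h : Metric.closedBall (0 : Euc n) r ⊆ Metric.closedBall 0 R) : r ≤ R := by
  have h1 : EuclideanSpace.single (⟨0, hn⟩ : Fin n) r ∈ Metric.closedBall (0 : Euc n) r := by
    simp [abs_of_nonneg hr]
  simpa [abs_of_nonneg hr] using h h1

/-- Ensures `μ < r`, because `μ / r = (√n / √r) / T^{1/4}`. -/
theorem lt_horizonScale {R r G M : ℝ} (hn : 0 < n) (hr : 0 < r) (hR : 0 < R) (hG : 0 < G)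
    (hM : 0 < M) : √n / √r < horizonScale n R r G M := by
  have hB := hR.trans_le (le_deltaScale_mul (R := R) hn hr hR).2.2
  have hm : 0 ≤ max (max (R / r) R) (1 / √r) := le_max_of_le_left (le_max_of_le_right hR.le)
  have h1 : 0 ≤ 48 * √183 * R * (deltaScale n R r * R / √n) / √n := by positivity
  have h2 : 0 ≤ 31 * (√n * M) * (max (max (R / r) R) (1 / √r) + R * (1 / √n + 1 / √r))
    / (R * G) := by positivity
  unfold horizonScale
  linarith

theorem banditInstance_chosenParams {T K : ℕ} {R r M G : ℝ} {S : Set (Euc n)}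
    {lo : Euc n → Euc n} {f g : ℕ → Euc n → ℝ} {x₁ : Euc n} (hn : 0 < n) (hr : 0 < r) (hG : 0 < G)
    (hM : 0 < M) (hK : 0 < K) (hL : 2 ≤ Real.log T)
    (hx : horizonScale n R r G M * Real.log T ≤ (T : ℝ) ^ (1 / 4 : ℝ))
    (hconv : Convex ℝ S) (hcomp : IsCompact S) (hrS : Metric.closedBall 0 r ⊆ S)
    (hSR : S ⊆ Metric.closedBall 0 R)
    (hf : ∀ t, LipschitzWith M.toNNReal (f t)) (hg : ∀ t, LipschitzWith M.toNNReal (g t))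
    (hfc : ∀ t, ConvexOn ℝ (Metric.closedBall 0 R) (f t))
    (hgc : ∀ t, ConvexOn ℝ (Metric.closedBall 0 R) (g t))
    (hfb : ∀ t, ∀ x ∈ S, |f t x| ≤ M) (hgb : ∀ t, ∀ x ∈ S, |g t x| ≤ M)
    (hlo : IsLinearOracle S lo) (hlom : Measurable lo)
    (hx₁ : x₁ ∈ (fun x : Euc n => (1 - (chosenParams n T K R r M).μ /
      (chosenParams n T K R r M).r) • x) '' S) :
    BanditInstance (chosenParams n T K R r M) S lo f g x₁ M := by
  have hR : 0 < R := hr.trans_le (le_of_closedBall_subset hn hr.le (hrS.trans hSR))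
  have hT : (0 : ℝ) < T := by
    rcases Nat.eq_zero_or_pos T with rfl | h
    · norm_num at hL
    · exact_mod_cast h
  have hxpos : 0 < (T : ℝ) ^ (1 / 4 : ℝ) := Real.rpow_pos_of_pos hT _
  have ha : 0 < √(n : ℝ) := Real.sqrt_pos.2 (by exact_mod_cast hn)
  have hρ : 0 < √r := Real.sqrt_pos.2 hr
  have hlt := lt_horizonScale (R := R) hn hr hR hG hM
  refine
    { n_pos := hn, r_pos := hr, K_pos := hK, M_pos := hM, convex := hconv, compact := hcomp,
      ball_sub := hrS, sub_ball := hSR, f_lip := hf, g_lip := hg, f_conv := hfc, g_conv := hgc,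
      f_bdd := hfb, g_bdd := hgb, oracle := hlo, oracle_meas := hlom, init_mem := hx₁,
      μ_pos := ?_, μ_lt := ?_, ε_pos := ?_, η_pos := ?_, δ_nonneg := ?_ }
  · rw [chosenParams_μ]; positivity
  · rw [chosenParams_μ]
    change _ < r
    have h0 : 0 ≤ √(n : ℝ) / √r := by positivity
    have h1 : √n / √r < (T : ℝ) ^ (1 / 4 : ℝ) := by nlinarith
    rw [div_lt_iff₀ hρ] at h1
    rw [div_lt_iff₀ hxpos]
    calc √n * √r < (T : ℝ) ^ (1 / 4 : ℝ) * √r * √r := by gcongr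
      _ = _ := by rw [mul_assoc, Real.mul_self_sqrt hr.le, mul_comm]
  · rw [chosenParams_ε]; positivity
  · rw [chosenParams_η]; positivity
  · rw [chosenParams_δ]
    have : 0 ≤ deltaScale n R r := le_max_of_le_right (le_max_of_le_left ha.le)
    positivity

end Transfer

theorem mainTheorem3 :
    ∃ C : ℝ, 0 < C ∧
    ∀ (n : ℕ) (R r Gf Gg Mf Mg : ℝ), 0 < n → 0 < r → 0 < Gf →
    ∃ T₀ : ℕ, ∀ (T K : ℕ), T₀ ≤ T → (K : ℝ) = (T : ℝ) ^ (1 / 2 : ℝ) →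
    ∀ (S : Set (Euc n)) (f g : ℕ → Euc n → ℝ) (lo : Euc n → Euc n) (x₁ : Euc n) (M : ℝ)
      (p : BanditParams),
      Convex ℝ S → IsCompact S →
      Metric.closedBall 0 r ⊆ S → S ⊆ Metric.closedBall 0 R →
      (∀ t < T, ConvexWithSubgradientBound R Gf (f t)) →
      (∀ t < T, ConvexWithSubgradientBound R Gg (g t)) →
      (∀ t < T, ∀ x ∈ S, |f t x| ≤ Mf) →
      (∀ t < T, ∀ x ∈ S, |g t x| ≤ Mg) →
      (feasibleSet S g T).Nonempty →
      IsLinearOracle S lo → Measurable lo →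
      M = max (max Gf Gg) (max Mf Mg) →
      p = chosenParams n T K R r M →
      x₁ ∈ (fun x : Euc n => (1 - p.μ / p.r) • x) '' S →
    ∀ (Ω : Type*) (_ : MeasurableSpace Ω) (P : Measure Ω) (_ : IsProbabilityMeasure P)
      (u : ℕ → Ω → Metric.sphere (0 : Euc n) 1) (z : ℕ → Ω → Euc n),
      (∀ t < T, HasLaw (u t) (uniformSphere n) P) →
      iIndepFun (fun t : Fin T => u t) P →
      (∀ t ω, z t ω = played p lo f g x₁ (fun s => (u s ω : Euc n)) t) →
      (∀ t < T, ∀ ω, z t ω ∈ S) ∧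
      (∀ t < T, Integrable (fun ω => f t (z t ω)) P ∧
        Integrable (fun ω => max (g t (z t ω)) 0) P) ∧
      (∃ xs ∈ feasibleSet S g T,
        IsMinOn (fun x => ∑ t ∈ Finset.range T, f t x) (feasibleSet S g T) xs ∧
        (∫ ω, ∑ t ∈ Finset.range T, f t (z t ω) ∂P) - ∑ t ∈ Finset.range T, f t xs ≤
          C * (√n * M * (T : ℝ) ^ (3 / 4 : ℝ) *
            (max (max (R / r) R) (1 / √r) + R * (1 / √n + 1 / √r) * √(Real.log T)))) ∧
      (∫ ω, ∑ t ∈ Finset.range T, max (g t (z t ω)) 0 ∂P) ≤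
        C * (√(R * Gf * M *
            max (max (max (R / r) (R / √r)) (max (R / √n) (1 / √r))) (1 / R)) *
          (n : ℝ) ^ (1 / 4 : ℝ) * (T : ℝ) ^ (7 / 8 : ℝ) * Real.log T ^ (1 / 4 : ℝ)) ∧
      (∀ ω, totalCalls p lo f g x₁ (fun s => (u s ω : Euc n)) T ≤ T) := by
  -- `46 = √2116` is dictated by the violation bound; the regret bound alone holds with 31.
  refine ⟨46, by norm_num, fun n R r Gf Gg Mf Mg hn hr hGf => ?_⟩
  obtain ⟨T₀, hT₀⟩ := exists_horizon
    (horizonScale n R r Gf (max (max Gf Gg) (max Mf Mg)))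
  refine ⟨T₀, fun T K hTT hKT S f g lo x₁ M p hconv hcomp hrS hSR hf hg hfb hgb hne hlo hlom hMdef
    hp hx₁ Ω _ P _ u z hlaw hind hz => ?_⟩
  obtain ⟨hT, hL, hx⟩ := hT₀ T hTT
  rw [← hMdef] at hx
  have hGfM : Gf ≤ M := by rw [hMdef]; exact (le_max_left _ _).trans (le_max_left _ _)
  have hGgM : Gg ≤ M := by rw [hMdef]; exact (le_max_right _ _).trans (le_max_left _ _)
  have hMfM : Mf ≤ M := by rw [hMdef]; exact (le_max_left _ _).trans (le_max_right _ _)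
  have hMgM : Mg ≤ M := by rw [hMdef]; exact (le_max_right _ _).trans (le_max_right _ _)
  have hM : 0 < M := hGf.trans_le hGfM
  have hKK : T = K * K := by
    have : (T : ℝ) = (K : ℝ) * K := by
      rw [hKT, ← Real.rpow_add (by exact_mod_cast hT)]; norm_num
    exact_mod_cast this
  have hK : 0 < K := Nat.pos_of_ne_zero fun h => by simp [h] at hKK; omega
  obtain ⟨F, hFl, hFc, hFb, hfF⟩ := exists_lipschitz_family hSR hM.le hGfM hMfM hf hfb
  obtain ⟨G, hGl, hGc, hGb, hgG⟩ := exists_lipschitz_family hSR hM.le hGgM hMgM hg hgb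
  subst hp
  have H := banditInstance_chosenParams (f := F) (g := G) hn hr hGf hM hK hL hx hconv hcomp hrS hSR
    hFl hGl hFc hGc hFb hGb hlo hlom hx₁
  obtain ⟨v, hvm, hvlaw, hvind, huv⟩ := exists_measurable_samples hlaw hind
  have hmem : ∀ (w : ℕ → Ω → Metric.sphere (0 : Euc n) 1) t ω, played (chosenParams n T K R r M)
    lo F G x₁ (fun s => (w s ω : Euc n)) t ∈ S := H.rPlayed_mem
  -- The run with the extensions stays in `S`, where they agree with the given functions, so both
  -- runs coincide for every `ω`. Replacing `u` by `v` is then only an almost sure identity, enough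
  -- for the expectations.
  have hzF : ∀ ω, ∀ t < T, z t ω = played (chosenParams n T K R r M) lo F G x₁
      (fun s => (u s ω : Euc n)) t := fun ω t ht => by
    rw [hz]
    exact played_congr (fun _ _ => rfl) (fun s hs => hfF s hs _ (hmem u s ω))
      (fun s hs => hgG s hs _ (hmem u s ω)) ht
  have hzS : ∀ t < T, ∀ ω, z t ω ∈ S := fun t ht ω => by rw [hzF ω t ht]; exact hmem u t ω
  have hzv : ∀ᵐ ω ∂P, ∀ t < T, z t ω = played (chosenParams n T K R r M) lo F G x₁
      (fun s => (v s ω : Euc n)) t := by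
    filter_upwards [huv] with ω hω t ht
    rw [hzF ω t ht]
    exact played_congr (fun s hs => by rw [hω s hs]) (fun _ _ => rfl) (fun _ _ => rfl) ht
  have hfz : ∀ᵐ ω ∂P, ∀ t < T, f t (z t ω) = F t (played (chosenParams n T K R r M) lo F G x₁
      (fun s => (v s ω : Euc n)) t) := by
    filter_upwards [hzv] with ω hω t ht
    rw [hfF t ht _ (hzS t ht ω), hω t ht]
  have hgz : ∀ᵐ ω ∂P, ∀ t < T, g t (z t ω) = G t (played (chosenParams n T K R r M) lo F G x₁
      (fun s => (v s ω : Euc n)) t) := by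
    filter_upwards [hzv] with ω hω t ht
    rw [hgG t ht _ (hzS t ht ω), hω t ht]
  have hfeas : feasibleSet S g T = S ∩ ⋂ t, ⋂ (_ : t < T), {x | G t x ≤ 0} := by
    ext x
    simp only [feasibleSet, Set.mem_ofPred_eq, Set.mem_inter_iff, Set.mem_iInter]
    exact and_congr_right fun hxS => forall₂_congr fun t ht => by rw [hgG t ht x hxS]
  -- The given functions need not be continuous off the ball; on `S` the extensions describe the
  -- same set by closed conditions.
  have hcompact : IsCompact (feasibleSet S g T) := by
    rw [hfeas]
    exact hcomp.inter_right (isClosed_iInter fun t => isClosed_iInter fun _ =>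
      isClosed_le (hGl t).continuous continuous_const)
  have hsum : ∀ x ∈ S, ∑ t ∈ Finset.range T, f t x = ∑ t ∈ Finset.range T, F t x := fun x hxS =>
    Finset.sum_congr rfl fun t ht => hfF t (Finset.mem_range.1 ht) x hxS
  obtain ⟨xs, hxs, hmin⟩ := hcompact.exists_isMinOn (f := fun x => ∑ t ∈ Finset.range T, F t x) hne
    (continuous_finsetSum _ fun t _ => (hFl t).continuous).continuousOn
  obtain ⟨h1, h2, h3⟩ := H.bounds (P := P) hKK hL hGf hx hxs.1
    (fun t ht => by rw [← hgG t ht xs hxs.1]; exact hxs.2 t ht)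
    (fun t ht x hxS y hyS => by
      rw [← hfF t ht x hxS, ← hfF t ht y hyS]
      exact (hf t ht).sub_le (hSR hxS) (hSR hyS)) hvm hvlaw hvind
  refine ⟨hzS, fun t ht => ⟨?_, ?_⟩, ⟨xs, hxs, fun y hy => ?_, ?_⟩, ?_, fun ω => ?_⟩
  · refine (H.integrable_f_played (P := P) hvm t).congr ?_
    filter_upwards [hfz] with ω hω using (hω t ht).symm
  · refine (H.integrable_max_g_played (P := P) hvm t).congr ?_
    filter_upwards [hgz] with ω hω
    rw [hω t ht]
  · simpa only [Set.mem_ofPred_eq, hsum xs hxs.1, hsum y hy.1] using hmin hy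
  · rw [hsum xs hxs.1, integral_congr_ae (g := fun ω => ∑ t ∈ Finset.range T,
      F t (played (chosenParams n T K R r M) lo F G x₁ (fun s => (v s ω : Euc n)) t))]
    · exact h1
    · filter_upwards [hfz] with ω hω
      exact Finset.sum_congr rfl fun t ht => hω t (Finset.mem_range.1 ht)
  · rw [integral_congr_ae (g := fun ω => ∑ t ∈ Finset.range T,
      max (G t (played (chosenParams n T K R r M) lo F G x₁ (fun s => (v s ω : Euc n)) t)) 0)]
    · exact h2
    · filter_upwards [hgz] with ω hω
      exact Finset.sum_congr rfl fun t ht => by rw [hω t (Finset.mem_range.1 ht)]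
  · rw [totalCalls_congr (fun _ _ => rfl) (fun s hs => hfF s hs _ (hmem u s ω))
      (fun s hs => hgG s hs _ (hmem u s ω))]
    exact h3 _
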